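/- **Caccioppoli inequality with boundary terms for bi-Laplace equations.** Let $n\ge 2$ and, for $R>0$, let $B_R^+=\{x\in\mathbb R^n: |x|<R,\ x_n>0\}$ and $\mathbf B_R=\{x\in\mathbb R^n: |x|<R,\ x_n=0\}$. Let $g$ be a smooth Riemannian metric on a neighbourhood of $\overline{B_3^+}$, and let $\triangle=\triangle_g$ be its Laplace–Beltrami operator (for instance, $g$ may be the Euclidean metric and $\triangle$ the usual Laplacian). Then there is a constant $C>0$, depending only on $n$ and $g$, such that the following holds. Let $M\ge 1$, let $W$ be a real measurable function on $B_3^+$ with $\|W\|_{L^\infty(B_3^+)}\le M$, and let the real function $u$ belong to $H^4(B_r^+)$ for every $0<r<3$ and solve $$\triangle^2u=Wu\quad\text{a.e. in } B_3^+ .$$ Then $$\|\nabla\triangle u\|_{L^2(B_{1/2}^+)}+\|\nabla^2u\|_{L^2(B_{1/2}^+)}+\|\nabla u\|_{L^2(B_{1/2}^+)}\le C\Big(M\|u\|_{L^2(B_2^+)}+\sum_{j=0}^{3}\Big\|\frac{\partial^ju}{\partial\nu^j}\Big\|_{H^{3-j}(\mathbf B_2)}\Big).$$ Here $\nabla$ and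 $\nabla^2$ are the gradient and the covariant Hessian of $g$; the $L^2$ norms on half balls are taken with respect to $g$ and its volume measure; $\nu$ is the outward unit normal, with components $\nu^i=-g^{in}/\sqrt{g^{nn}}$ (extended into $B_3^+$ by this formula, i.e. as the $g$-unit normal of the level sets of $x_n$), and $\partial^ju/\partial\nu^j=(\nu^i\partial_i)^ju$, restricted to $\mathbf B_2$ in the sense of traces; $H^k(\mathbf B_2)$ is the usual Sobolev space in the coordinates $(x_1,\dots,x_{n-1})$, with the convention that $\|f\|_{H^k(\mathbf B_2)}=\infty$ if $f\notin H^k(\mathbf B_2)$. -/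

import Mathlib

open scoped ContDiff ENNReal
open MeasureTheory

noncomputable section

namespace BiLaplace

/-- The half ball `B_R^+ = {x : |x| < R, x_n > 0}` in `ℝ^n`, `n = d + 1`. -/
def halfBall (d : ℕ) (R : ℝ) : Set (EuclideanSpace ℝ (Fin (d + 1))) :=
  {x | ‖x‖ < R ∧ 0 < x (Fin.last d)}

/-- The point `(y, 0)` of the hyperplane `{x_n = 0}`. The ball `{|x| < R, x_n = 0}` on the boundary
is identified through this map with the ball `|y| < R` of `ℝ^(n-1)`. -/
def bdryPt {d : ℕ} (y : EuclideanSpace ℝ (Fin d)) : EuclideanSpace ℝ (Fin (d + 1)) :=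
  WithLp.toLp 2 (Fin.snoc (α := fun _ => ℝ) (fun i => y i) 0)

/-- The classical partial derivative `∂_i f`. -/
def pderiv {n : ℕ} (i : Fin n) (f : EuclideanSpace ℝ (Fin n) → ℝ)
    (x : EuclideanSpace ℝ (Fin n)) : ℝ :=
  fderiv ℝ f x (EuclideanSpace.single i 1)

/-! ### Weak derivatives and Sobolev spaces -/

/-- `f'` is the weak partial derivative `∂_i f` on the open set `U`. -/
def HasWeakPartial {n : ℕ} (U : Set (EuclideanSpace ℝ (Fin n))) (i : Fin n)
    (f f' : EuclideanSpace ℝ (Fin n) → ℝ) : Prop :=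
  LocallyIntegrableOn f U ∧ LocallyIntegrableOn f' U ∧
    ∀ φ : EuclideanSpace ℝ (Fin n) → ℝ, ContDiff ℝ ∞ φ → HasCompactSupport φ → tsupport φ ⊆ U →
      ∫ x in U, f x * pderiv i φ x = - ∫ x in U, f' x * φ x

open Classical in
/-- A representative of the weak partial derivative `∂_i f` on `U` (unique almost everywhere on `U`);
by convention `0` if there is no weak derivative. -/
def weakPartial {n : ℕ} (U : Set (EuclideanSpace ℝ (Fin n))) (i : Fin n)
    (f : EuclideanSpace ℝ (Fin n) → ℝ) : EuclideanSpace ℝ (Fin n) → ℝ :=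
  if h : ∃ f', HasWeakPartial U i f f' then h.choose else 0

/-- `f ∈ H^k(B_r^+)` for every `r < R`: the weak derivatives of `f` on `B_R^+` up to order `k` exist
and are square integrable on each smaller half ball, i.e. up to the flat part of the boundary. -/
def MemHUpToFlat (d : ℕ) (R : ℝ) : ℕ → (EuclideanSpace ℝ (Fin (d + 1)) → ℝ) → Prop
  | 0, f => ∀ r < R, MemLp f 2 (volume.restrict (halfBall d r))
  | k + 1, f => (∀ r < R, MemLp f 2 (volume.restrict (halfBall d r))) ∧
      ∀ i, ∃ f', HasWeakPartial (halfBall d R) i f f' ∧ MemHUpToFlat d R k f'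

open Classical in
/-- The square of the Sobolev norm: `‖f‖²_{H^k(U)} = ∑_{j ≤ k} ∫_U |∇^j f|²`, which is `∞` if a weak
derivative of order at most `k` does not exist. -/
def sobolevNormSq {n : ℕ} (U : Set (EuclideanSpace ℝ (Fin n))) :
    ℕ → (EuclideanSpace ℝ (Fin n) → ℝ) → ℝ≥0∞
  | 0, f => ∫⁻ x in U, ‖f x‖ₑ ^ 2
  | k + 1, f => (∫⁻ x in U, ‖f x‖ₑ ^ 2) +
      ∑ i, if ∃ f', HasWeakPartial U i f f' then sobolevNormSq U k (weakPartial U i f) else ∞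

/-- The Sobolev norm `‖f‖_{H^k(U)}`. -/
def sobolevNorm {n : ℕ} (U : Set (EuclideanSpace ℝ (Fin n))) (k : ℕ)
    (f : EuclideanSpace ℝ (Fin n) → ℝ) : ℝ≥0∞ :=
  (sobolevNormSq U k f) ^ (1 / 2 : ℝ)

/-- `b` is the trace on `{|x| < R, x_n = 0}` of `f`, a function on `B_R^+` of class `W^{1,1}` in the
normal direction up to the flat boundary: Green's formula
`∫_{B_R^+} (f ∂_n φ + ∂_n f φ) = - ∫_{|y| < R} b(y) φ(y, 0) dy` holds for all test functions `φ`
on the full ball. -/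
def IsTrace (d : ℕ) (R : ℝ) (f : EuclideanSpace ℝ (Fin (d + 1)) → ℝ)
    (b : EuclideanSpace ℝ (Fin d) → ℝ) : Prop :=
  ∃ f' : EuclideanSpace ℝ (Fin (d + 1)) → ℝ,
    HasWeakPartial (halfBall d R) (Fin.last d) f f' ∧
    (∀ r < R, IntegrableOn f (halfBall d r) ∧ IntegrableOn f' (halfBall d r) ∧
      IntegrableOn b (Metric.ball 0 r)) ∧
    ∀ φ : EuclideanSpace ℝ (Fin (d + 1)) → ℝ, ContDiff ℝ ∞ φ → HasCompactSupport φ →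
      tsupport φ ⊆ Metric.ball 0 R →
      ∫ x in halfBall d R, (f x * pderiv (Fin.last d) φ x + f' x * φ x) =
        - ∫ y in Metric.ball (0 : EuclideanSpace ℝ (Fin d)) R, b y * φ (bdryPt y)

open Classical in
/-- `‖f‖_{H^k}` on the boundary ball `{|x| < r, x_n = 0}` of a function `f` on `B_R^+`, in the sense
of traces (`∞` if `f` has no trace or if its trace is not in `H^k`). -/
def bdrySobolevNorm (d : ℕ) (r R : ℝ) (k : ℕ) (f : EuclideanSpace ℝ (Fin (d + 1)) → ℝ) : ℝ≥0∞ :=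
  if h : ∃ b, IsTrace d R f b then
    sobolevNorm (Metric.ball (0 : EuclideanSpace ℝ (Fin d)) r) k h.choose
  else ∞

/-! ### Riemannian metrics in coordinates -/

/-- A matrix-valued function on `ℝ^n`, thought of as the coefficients `g_ij` of a metric. -/
abbrev MetricCoeff (n : ℕ) : Type := EuclideanSpace ℝ (Fin n) → Matrix (Fin n) (Fin n) ℝ

/-- `g` is a smooth Riemannian metric on an open neighbourhood of `K`. -/
def IsSmoothMetricNear {n : ℕ} (K : Set (EuclideanSpace ℝ (Fin n))) (g : MetricCoeff n) : Prop :=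
  ∃ V, IsOpen V ∧ K ⊆ V ∧ (∀ i j, ContDiffOn ℝ ∞ (fun x => g x i j) V) ∧ ∀ x ∈ V, (g x).PosDef

/-- The Riemannian measure `√(det g) dx` on `V`. -/
def riemVol {n : ℕ} (g : MetricCoeff n) (V : Set (EuclideanSpace ℝ (Fin n))) :
    Measure (EuclideanSpace ℝ (Fin n)) :=
  (volume.restrict V).withDensity fun x => ENNReal.ofReal (√(g x).det)

/-- The Christoffel symbol `Γ^k_ij` of `g`. -/
def christoffel {n : ℕ} (g : MetricCoeff n) (k i j : Fin n) (x : EuclideanSpace ℝ (Fin n)) : ℝ :=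
  (1 / 2) * ∑ l, (g x)⁻¹ k l *
    (pderiv i (fun z => g z j l) x + pderiv j (fun z => g z i l) x - pderiv l (fun z => g z i j) x)

/-- `|∇f|_g`, with weak derivatives on `U`. -/
def gradNorm {n : ℕ} (g : MetricCoeff n) (U : Set (EuclideanSpace ℝ (Fin n)))
    (f : EuclideanSpace ℝ (Fin n) → ℝ) (x : EuclideanSpace ℝ (Fin n)) : ℝ :=
  √(∑ i, ∑ j, (g x)⁻¹ i j * weakPartial U i f x * weakPartial U j f x)

/-- The components `∂_i ∂_j f - Γ^k_ij ∂_k f` of the covariant Hessian `∇²f`. -/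
def hess {n : ℕ} (g : MetricCoeff n) (U : Set (EuclideanSpace ℝ (Fin n)))
    (f : EuclideanSpace ℝ (Fin n) → ℝ) (i j : Fin n) (x : EuclideanSpace ℝ (Fin n)) : ℝ :=
  weakPartial U i (weakPartial U j f) x - ∑ k, christoffel g k i j x * weakPartial U k f x

/-- `|∇²f|_g`. -/
def hessNorm {n : ℕ} (g : MetricCoeff n) (U : Set (EuclideanSpace ℝ (Fin n)))
    (f : EuclideanSpace ℝ (Fin n) → ℝ) (x : EuclideanSpace ℝ (Fin n)) : ℝ :=
  √(∑ i, ∑ j, ∑ k, ∑ l, (g x)⁻¹ i k * (g x)⁻¹ j l * hess g U f i j x * hess g U f k l x)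

/-- The Laplace-Beltrami operator `Δ_g f = (det g)^(-1/2) ∂_i ((det g)^(1/2) g^ij ∂_j f)`, with weak
derivatives on `U`. -/
def laplace {n : ℕ} (g : MetricCoeff n) (U : Set (EuclideanSpace ℝ (Fin n)))
    (f : EuclideanSpace ℝ (Fin n) → ℝ) (x : EuclideanSpace ℝ (Fin n)) : ℝ :=
  (√(g x).det)⁻¹ *
    ∑ i, weakPartial U i (fun z => √(g z).det * ∑ j, (g z)⁻¹ i j * weakPartial U j f z) x

/-- The unit normal `ν` of `g`, outward for `{x_n > 0}`: `ν^i = - g^in / √(g^nn)`. It is defined not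
only on `{x_n = 0}`: everywhere it is the `g`-unit normal of the level sets of `x_n`. -/
def normal {d : ℕ} (g : MetricCoeff (d + 1)) (x : EuclideanSpace ℝ (Fin (d + 1)))
    (i : Fin (d + 1)) : ℝ :=
  - (g x)⁻¹ i (Fin.last d) / √((g x)⁻¹ (Fin.last d) (Fin.last d))

/-- The normal derivative `∂f/∂ν = ν^i ∂_i f`, with weak derivatives on `U`. -/
def normalDeriv {d : ℕ} (g : MetricCoeff (d + 1)) (U : Set (EuclideanSpace ℝ (Fin (d + 1))))
    (f : EuclideanSpace ℝ (Fin (d + 1)) → ℝ) (x : EuclideanSpace ℝ (Fin (d + 1))) : ℝ :=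
  ∑ i, normal g x i * weakPartial U i f x

end BiLaplace

end

/-!
Write `w = √(det g)`, `A^ij = w g^ij` and `v = Δu`. The equation `Δ²u = Wu` is the second order
system `∂_i (A^ij ∂_j u) = w v`, `∂_i (A^ij ∂_j v) = w W u`, and the inequality is a Caccioppoli
estimate for this system with boundary terms. The coefficients, defined near the closed half ball,
are replaced there by smooth functions on the whole space (`exists_smoothModel`); all norms taken
with respect to the metric are comparable to Euclidean ones. If one of the boundary norms is
infinite there is nothing to prove.

*Boundary terms.* Traces are handled by duality. `TraceBound f K` says that the functional
`φ ↦ ∫ (f ∂_n φ + ∂_n f φ)`, which is minus the integral of `f φ` over the flat boundary, is bounded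
by `K` times the `L²` norm of `φ` there. With this notion Green's formula
for two Sobolev functions becomes an inequality, in which the boundary term is at most a constant
times the product of the two trace bounds (`green_inequality`): a one-sided bound against smooth
functions, applied after mollification from inside, gives the `L²` norm of the boundary values of
one factor, and applying it once more gives the bound for the product. The Sobolev norm of a trace
bounds the traces of the tangential derivatives (`traceBoundH_of_bdrySobolevNorm_le`). The normal
field is transversal to the boundary, so `∂_n` is a combination of the normal derivative and
tangential derivatives (`exists_traceBoundH_of_transversal`), and the norms of the four normal
derivatives bound the traces of all derivatives of `u` up to order three
(`exists_traceBoundH_three`), hence also those of `v` and of its first derivatives.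

*Interior terms.* Let `η` be a cutoff supported in the ball of radius 2, `χ` another one that is `1`
on the support of `η`, and `K` a bound for the traces. Put `Y = ‖η² v‖`, `Z = ‖η³ ∇v‖`,
`G = ‖η ∇u‖`, `H = ‖η² ∇²u‖` and `A = M ‖χ u‖ + K`. The powers of `η` are chosen so that every
derivative of a cutoff still carries the weight of the norm it meets. Testing the second equation
with `η⁶ v` and the first with `η² u` gives, up to constants,
`Z² ≤ A Y + Z Y + A²` and `G² ≤ Y A + G A + A²`. Green's formula applied twice to
`∫ η⁴ w v² = ∫ η⁴ v ∂_i (A^ij ∂_j u)` moves both derivatives onto `v`, where the second equation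
turns them into `W u`, and gives `Y² ≤ A² + Z A + G Y`; the bound `M` of `W` enters only through
the product `M ‖χ u‖ ‖χ u‖ ≤ A²`, which is why it appears linearly in the conclusion. The three
inequalities bound `Y`, and then `Z` and `G`, by a multiple of `A` (`le_of_energy_system`). Finally,
exchanging the derivatives in `∫ η⁴ A^ij A^kl ∂_ik u ∂_jl u` by two integrations by parts, and using
that `A ⊗ A` is positive, bounds `H` in terms of `Y`, `G` and `A`; together these are
`exists_caccioppoli`.
-/

namespace BiLaplace

open Filter Topology

/-! ### Partial derivatives of smooth functions -/

section Smooth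

variable {n : ℕ} {φ ψ : EuclideanSpace ℝ (Fin n) → ℝ}

theorem contDiff_pderiv (hφ : ContDiff ℝ ∞ φ) (i : Fin n) : ContDiff ℝ ∞ (pderiv i φ) := by
  have h : ContDiff ℝ ∞ (fderiv ℝ φ) := hφ.fderiv_right (m := ∞) (by simp)
  exact h.clm_apply contDiff_const

theorem hasCompactSupport_pderiv (hφ : HasCompactSupport φ) (i : Fin n) :
    HasCompactSupport (pderiv i φ) := by
  have := hφ.fderiv (𝕜 := ℝ)
  exact this.comp_left (g := fun L : EuclideanSpace ℝ (Fin n) →L[ℝ] ℝ =>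
    L (EuclideanSpace.single i 1)) (by simp)

theorem tsupport_pderiv_subset (i : Fin n) : tsupport (pderiv i φ) ⊆ tsupport φ :=
  (closure_mono (fun x hx => by
    simp only [Function.mem_support, pderiv] at hx ⊢
    intro h; exact hx (by simp [h]))).trans (tsupport_fderiv_subset ℝ (f := φ))

theorem pderiv_mul (hφ : ContDiff ℝ ∞ φ) (hψ : ContDiff ℝ ∞ ψ) (i : Fin n)
    (x : EuclideanSpace ℝ (Fin n)) :
    pderiv i (fun z => φ z * ψ z) x = pderiv i φ x * ψ x + φ x * pderiv i ψ x := by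
  have h1 := (hφ.differentiable (by simp)) x
  have h2 := (hψ.differentiable (by simp)) x
  simp only [pderiv]
  rw [fderiv_fun_mul h1 h2]
  simp; ring

theorem pderiv_comm (hφ : ContDiff ℝ ∞ φ) (i j : Fin n) (x : EuclideanSpace ℝ (Fin n)) :
    pderiv i (pderiv j φ) x = pderiv j (pderiv i φ) x := by
  have hsymm : IsSymmSndFDerivAt ℝ φ x := by
    apply ContDiffAt.isSymmSndFDerivAt (n := ∞) hφ.contDiffAt
    simp only [minSmoothness_of_isRCLikeNormedField]
    exact WithTop.coe_le_coe.2 (le_top : (2 : ℕ∞) ≤ ⊤)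
  have hd : DifferentiableAt ℝ (fderiv ℝ φ) x :=
    ((hφ.fderiv_right (m := ∞) (by simp)).differentiable (by simp)) x
  have key : ∀ i j : Fin n, pderiv i (pderiv j φ) x =
      fderiv ℝ (fderiv ℝ φ) x (EuclideanSpace.single i 1) (EuclideanSpace.single j 1) := by
    intro i j
    have : fderiv ℝ (pderiv j φ) x =
        (fderiv ℝ (fderiv ℝ φ) x).flip (EuclideanSpace.single j 1) := by
      ext v
      change fderiv ℝ (fun y => fderiv ℝ φ y (EuclideanSpace.single j 1)) x v = _
      rw [fderiv_clm_apply hd (by fun_prop)]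
      simp
    simp only [pderiv] at this ⊢
    rw [this]; simp
  rw [key, key]
  exact hsymm _ _

end Smooth

/-! ### Calculus of weak derivatives -/

section Weak

variable {n : ℕ} {U : Set (EuclideanSpace ℝ (Fin n))} {i j : Fin n}
  {f f' h h' : EuclideanSpace ℝ (Fin n) → ℝ}

theorem integrable_mul_of_tsupport_subset (hU : MeasurableSet U) (hf : LocallyIntegrableOn f U)
    {φ : EuclideanSpace ℝ (Fin n) → ℝ} (hφ : Continuous φ) (hc : HasCompactSupport φ)
    (hs : tsupport φ ⊆ U) : Integrable (fun x => f x * φ x) (volume.restrict U) := by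
  have h1 : IntegrableOn f (tsupport φ) :=
    hf.integrableOn_compact_subset hs hc
  have h2 : IntegrableOn (fun x => f x * φ x) (tsupport φ) :=
    h1.mul_continuousOn hφ.continuousOn hc
  refine h2.of_forall_sdiff_eq_zero hU ?_
  intro x hx
  rw [image_eq_zero_of_notMem_tsupport hx.2, mul_zero]

theorem locallyIntegrableOn_congr (hf : LocallyIntegrableOn f U)
    (h : f =ᵐ[volume.restrict U] h') : LocallyIntegrableOn h' U := by
  intro x hx
  obtain ⟨s, hs, hsi⟩ := hf x hx
  refine ⟨s ∩ U, Filter.inter_mem hs self_mem_nhdsWithin, ?_⟩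
  have : IntegrableOn f (s ∩ U) := hsi.mono_set Set.inter_subset_left
  exact this.congr (ae_restrict_of_ae_restrict_of_subset Set.inter_subset_right h)

theorem HasWeakPartial.congr (hw : HasWeakPartial U i f f')
    (h1 : f =ᵐ[volume.restrict U] h) (h2 : f' =ᵐ[volume.restrict U] h') :
    HasWeakPartial U i h h' := by
  refine ⟨locallyIntegrableOn_congr hw.1 h1, locallyIntegrableOn_congr hw.2.1 h2, ?_⟩
  intro φ a b c
  have := hw.2.2 φ a b c
  have e1 : ∫ x in U, f x * pderiv i φ x = ∫ x in U, h x * pderiv i φ x :=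
    integral_congr_ae (h1.mono fun x hx => by simp only [hx])
  have e2 : ∫ x in U, f' x * φ x = ∫ x in U, h' x * φ x :=
    integral_congr_ae (h2.mono fun x hx => by simp only [hx])
  rw [← e1, ← e2, this]

theorem HasWeakPartial.unique (hU : IsOpen U) (h1 : HasWeakPartial U i f f')
    (h2 : HasWeakPartial U i f h') : f' =ᵐ[volume.restrict U] h' := by
  have := hU.ae_eq_zero_of_integral_contDiff_smul_eq_zero (μ := volume)
    (f := fun x => f' x - h' x) (h1.2.1.sub h2.2.1) (by
      intro φ hφ hc hs
      have e1 := h1.2.2 φ hφ hc hs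
      have e2 := h2.2.2 φ hφ hc hs
      have i1 := integrable_mul_of_tsupport_subset hU.measurableSet h1.2.1 hφ.continuous hc hs
      have i2 := integrable_mul_of_tsupport_subset hU.measurableSet h2.2.1 hφ.continuous hc hs
      rw [← setIntegral_eq_integral_of_forall_compl_eq_zero (s := U)]
      · have : ∀ x, φ x • (f' x - h' x) = f' x * φ x - h' x * φ x := fun x => by
          simp; ring
        simp only [this]
        rw [integral_sub i1 i2]; linarith
      · intro x hx
        rw [image_eq_zero_of_notMem_tsupport (fun hh => hx (hs hh)), zero_smul])
  rw [Filter.EventuallyEq, ae_restrict_iff' hU.measurableSet]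
  filter_upwards [this] with x hx hxU
  linarith [hx hxU]

theorem weakPartial_spec (hw : ∃ f', HasWeakPartial U i f f') :
    HasWeakPartial U i f (weakPartial U i f) := by
  unfold weakPartial
  rw [dif_pos hw]
  exact hw.choose_spec

theorem HasWeakPartial.weakPartial_ae_eq (hU : IsOpen U) (hw : HasWeakPartial U i f f') :
    weakPartial U i f =ᵐ[volume.restrict U] f' :=
  (weakPartial_spec ⟨f', hw⟩).unique hU hw

/-- The chosen weak derivative depends only on the almost everywhere class of the function, so
there is an honest equality here. -/
theorem weakPartial_congr (h1 : f =ᵐ[volume.restrict U] h) :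
    weakPartial U i f = weakPartial U i h := by
  have : HasWeakPartial U i f = HasWeakPartial U i h := by
    funext k
    exact propext ⟨fun hw => hw.congr h1 (ae_eq_refl _),
      fun hw => hw.congr h1.symm (ae_eq_refl _)⟩
  unfold weakPartial
  by_cases hh : ∃ f', HasWeakPartial U i f f'
  · have hh' : ∃ f', HasWeakPartial U i h f' := this ▸ hh
    rw [dif_pos hh, dif_pos hh']
    congr 1
  · have hh' : ¬ ∃ f', HasWeakPartial U i h f' := this ▸ hh
    rw [dif_neg hh, dif_neg hh']

theorem HasWeakPartial.add (hU : MeasurableSet U) (h1 : HasWeakPartial U i f f')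
    (h2 : HasWeakPartial U i h h') :
    HasWeakPartial U i (fun x => f x + h x) (fun x => f' x + h' x) := by
  refine ⟨h1.1.add h2.1, h1.2.1.add h2.2.1, ?_⟩
  intro φ hφ hc hs
  have e1 := h1.2.2 φ hφ hc hs
  have e2 := h2.2.2 φ hφ hc hs
  have hs' := (tsupport_pderiv_subset (φ := φ) i).trans hs
  have i1 := integrable_mul_of_tsupport_subset hU h1.2.1 hφ.continuous hc hs
  have i2 := integrable_mul_of_tsupport_subset hU h2.2.1 hφ.continuous hc hs
  have i3 := integrable_mul_of_tsupport_subset hU h1.1 (contDiff_pderiv hφ i).continuous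
    (hasCompactSupport_pderiv hc i) hs'
  have i4 := integrable_mul_of_tsupport_subset hU h2.1 (contDiff_pderiv hφ i).continuous
    (hasCompactSupport_pderiv hc i) hs'
  simp only [add_mul]
  rw [integral_add i3 i4, integral_add i1 i2, e1, e2]; ring

theorem hasWeakPartial_zero : HasWeakPartial U i (fun _ => 0) (fun _ => 0) :=
  ⟨locallyIntegrable_zero.locallyIntegrableOn _, locallyIntegrable_zero.locallyIntegrableOn _,
    fun φ _ _ _ => by simp⟩

theorem locallyIntegrableOn_smooth_mul (hU : IsOpen U) (hf : LocallyIntegrableOn f U)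
    {a : EuclideanSpace ℝ (Fin n) → ℝ} (ha : Continuous a) :
    LocallyIntegrableOn (fun x => a x * f x) U :=
  hf.continuousOn_mul ha.continuousOn hU.isLocallyClosed

theorem HasWeakPartial.smooth_mul (hU : IsOpen U) (h1 : HasWeakPartial U i f f')
    {a : EuclideanSpace ℝ (Fin n) → ℝ} (ha : ContDiff ℝ ∞ a) :
    HasWeakPartial U i (fun x => a x * f x) (fun x => pderiv i a x * f x + a x * f' x) := by
  refine ⟨locallyIntegrableOn_smooth_mul hU h1.1 ha.continuous,
    (locallyIntegrableOn_smooth_mul hU h1.1 (contDiff_pderiv ha i).continuous).add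
    (locallyIntegrableOn_smooth_mul hU h1.2.1 ha.continuous), ?_⟩
  intro φ hφ hc hs
  have hsa : tsupport (fun x => a x * φ x) ⊆ U := (tsupport_mul_subset_right).trans hs
  have hca : HasCompactSupport (fun x => a x * φ x) := hc.mul_left
  have hsd := (tsupport_pderiv_subset (φ := φ) i).trans hs
  have e1 := h1.2.2 (fun x => a x * φ x) (ha.mul hφ) hca hsa
  have i1 := integrable_mul_of_tsupport_subset hU.measurableSet
    (locallyIntegrableOn_smooth_mul hU h1.1 (contDiff_pderiv ha i).continuous) hφ.continuous hc hs
  have i2 := integrable_mul_of_tsupport_subset hU.measurableSet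
    (locallyIntegrableOn_smooth_mul hU h1.2.1 ha.continuous) hφ.continuous hc hs
  have i3 := integrable_mul_of_tsupport_subset hU.measurableSet
    (locallyIntegrableOn_smooth_mul hU h1.1 ha.continuous) (contDiff_pderiv hφ i).continuous
    (hasCompactSupport_pderiv hc i) hsd
  simp only [pderiv_mul ha hφ] at e1
  have e2 : ∫ x in U, f x * (pderiv i a x * φ x + a x * pderiv i φ x) =
      (∫ x in U, pderiv i a x * f x * φ x) + ∫ x in U, a x * f x * pderiv i φ x := by
    rw [← integral_add i1 i3]; congr 1; funext x; ring
  have e3 : ∫ x in U, f' x * (a x * φ x) = ∫ x in U, a x * f' x * φ x := by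
    congr 1; funext x; ring
  simp only [add_mul]
  rw [integral_add i1 i2]
  rw [e2, e3] at e1
  linarith

/-- Weak partial derivatives commute. -/
theorem HasWeakPartial.comm (h1 : HasWeakPartial U j f f') (h2 : HasWeakPartial U i f h)
    (h3 : HasWeakPartial U i f' h') : HasWeakPartial U j h h' := by
  refine ⟨h2.2.1, h3.2.1, ?_⟩
  intro φ hφ hc hs
  have e3 := h3.2.2 φ hφ hc hs
  have e1 := h1.2.2 (pderiv i φ) (contDiff_pderiv hφ i) (hasCompactSupport_pderiv hc i)
    ((tsupport_pderiv_subset i).trans hs)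
  have e2 := h2.2.2 (pderiv j φ) (contDiff_pderiv hφ j) (hasCompactSupport_pderiv hc j)
    ((tsupport_pderiv_subset j).trans hs)
  simp only [pderiv_comm hφ i j] at e2
  linarith

end Weak

/-! ### Sobolev functions on the half ball of radius 3, up to the flat boundary -/

section Sobolev

variable {d : ℕ}

/-- The weak partial derivative on the half ball of radius 3. -/
noncomputable abbrev dW (i : Fin (d + 1)) (f : EuclideanSpace ℝ (Fin (d + 1)) → ℝ) :
    EuclideanSpace ℝ (Fin (d + 1)) → ℝ :=
  weakPartial (halfBall d 3) i f

/-- Membership in `H^k` of the half balls of radius less than 3. -/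
abbrev MemH (k : ℕ) (f : EuclideanSpace ℝ (Fin (d + 1)) → ℝ) : Prop := MemHUpToFlat d 3 k f

/-- Lebesgue measure on the half ball of radius 3. -/
noncomputable abbrev hbMeasure (d : ℕ) : Measure (EuclideanSpace ℝ (Fin (d + 1))) :=
  volume.restrict (halfBall d 3)

theorem isOpen_halfBall (r : ℝ) : IsOpen (halfBall d r) := by
  apply IsOpen.inter
  · exact isOpen_lt continuous_norm continuous_const
  · exact isOpen_lt continuous_const (EuclideanSpace.proj (𝕜 := ℝ) (Fin.last d)).continuous

theorem measurableSet_halfBall (r : ℝ) : MeasurableSet (halfBall d r) :=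
  (isOpen_halfBall r).measurableSet

theorem halfBall_subset {r s : ℝ} (h : r ≤ s) : halfBall d r ⊆ halfBall d s :=
  fun _ hx => ⟨hx.1.trans_le h, hx.2⟩

theorem ae_halfBall_mono {r s : ℝ} (h : r ≤ s) {p : EuclideanSpace ℝ (Fin (d + 1)) → Prop}
    (hp : ∀ᵐ x ∂volume.restrict (halfBall d s), p x) :
    ∀ᵐ x ∂volume.restrict (halfBall d r), p x :=
  ae_restrict_of_ae_restrict_of_subset (halfBall_subset h) hp

variable {k : ℕ} {i j : Fin (d + 1)} {f h a : EuclideanSpace ℝ (Fin (d + 1)) → ℝ}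

theorem MemH.memLp : ∀ {k : ℕ} {f : EuclideanSpace ℝ (Fin (d + 1)) → ℝ}, MemH k f →
    ∀ {r : ℝ}, r < 3 → MemLp f 2 (volume.restrict (halfBall d r))
  | 0, _, hf, _, hr => hf _ hr
  | _ + 1, _, hf, _, hr => hf.1 _ hr

theorem MemH.congr (hf : MemH k f) (hfh : f =ᵐ[hbMeasure d] h) : MemH k h := by
  have h1 : ∀ r < 3, MemLp h 2 (volume.restrict (halfBall d r)) := fun r hr =>
    (hf.memLp hr).ae_eq (ae_halfBall_mono hr.le hfh)
  cases k with
  | zero => exact h1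
  | succ k =>
    refine ⟨h1, fun i => ?_⟩
    obtain ⟨f', hw, hf'⟩ := hf.2 i
    exact ⟨f', hw.congr hfh (ae_eq_refl _), hf'⟩

theorem MemH.pred : ∀ {k : ℕ} {f : EuclideanSpace ℝ (Fin (d + 1)) → ℝ}, MemH (k + 1) f → MemH k f
  | 0, _, hf => hf.1
  | _ + 1, _, hf => ⟨hf.1, fun i => by
      obtain ⟨f', hw, hf'⟩ := hf.2 i
      exact ⟨f', hw, MemH.pred hf'⟩⟩

theorem MemH.mono {k l : ℕ} (hf : MemH k f) (hl : l ≤ k) : MemH l f := by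
  induction hl with
  | refl => exact hf
  | step _ ih => exact ih hf.pred

theorem MemH.hasWeakPartial (hf : MemH (k + 1) f) (i : Fin (d + 1)) :
    HasWeakPartial (halfBall d 3) i f (dW i f) := by
  obtain ⟨f', hw, -⟩ := hf.2 i
  exact weakPartial_spec ⟨f', hw⟩

theorem MemH.deriv (hf : MemH (k + 1) f) (i : Fin (d + 1)) : MemH k (dW i f) := by
  obtain ⟨f', hw, hf'⟩ := hf.2 i
  exact MemH.congr hf' (hw.weakPartial_ae_eq (isOpen_halfBall 3)).symm

theorem MemH.of_hasWeakPartial (hf : ∀ r < 3, MemLp f 2 (volume.restrict (halfBall d r)))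
    {f' : Fin (d + 1) → EuclideanSpace ℝ (Fin (d + 1)) → ℝ}
    (hw : ∀ i, HasWeakPartial (halfBall d 3) i f (f' i)) (hf' : ∀ i, MemH k (f' i)) :
    MemH (k + 1) f := ⟨hf, fun i => ⟨f' i, hw i, hf' i⟩⟩

theorem dW_ae_eq_of_ae_eq (hfh : f =ᵐ[hbMeasure d] h) (i : Fin (d + 1)) : dW i f = dW i h :=
  weakPartial_congr hfh

theorem MemH.add : ∀ {k : ℕ} {f h : EuclideanSpace ℝ (Fin (d + 1)) → ℝ}, MemH k f → MemH k h →
    MemH k (fun x => f x + h x)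
  | 0, _, _, hf, hh => fun r hr => (hf r hr).add (hh r hr)
  | _ + 1, _, _, hf, hh => MemH.of_hasWeakPartial (fun r hr => (hf.1 r hr).add (hh.1 r hr))
      (fun i => (hf.hasWeakPartial i).add (measurableSet_halfBall 3) (hh.hasWeakPartial i))
      (fun i => (hf.deriv i).add (hh.deriv i))

theorem memLp_continuous_mul {r : ℝ} (ha : Continuous a)
    (hf : MemLp f 2 (volume.restrict (halfBall d r))) :
    MemLp (fun x => a x * f x) 2 (volume.restrict (halfBall d r)) := by
  obtain ⟨C, hC⟩ :=
    (isCompact_closedBall (0 : EuclideanSpace ℝ (Fin (d + 1))) r).exists_bound_of_continuousOn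
    ha.continuousOn
  refine MemLp.of_le_mul (c := C) hf (ha.aestronglyMeasurable.mul hf.1) ?_
  filter_upwards [ae_restrict_mem (measurableSet_halfBall r)] with x hx
  rw [norm_mul]
  exact mul_le_mul_of_nonneg_right (hC x (by simpa using hx.1.le)) (norm_nonneg _)

theorem MemH.smooth_mul : ∀ {k : ℕ} {f a : EuclideanSpace ℝ (Fin (d + 1)) → ℝ}, ContDiff ℝ ∞ a →
    MemH k f → MemH k (fun x => a x * f x)
  | 0, _, _, ha, hf => fun r hr => memLp_continuous_mul ha.continuous (hf r hr)
  | _ + 1, _, _, ha, hf => MemH.of_hasWeakPartial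
      (fun r hr => memLp_continuous_mul ha.continuous (hf.1 r hr))
      (fun i => (hf.hasWeakPartial i).smooth_mul (isOpen_halfBall 3) ha)
      (fun i => (MemH.smooth_mul (contDiff_pderiv ha i) hf.pred).add
        (MemH.smooth_mul ha (hf.deriv i)))

theorem memH_zero : ∀ {k : ℕ}, MemH k (fun _ : EuclideanSpace ℝ (Fin (d + 1)) => (0 : ℝ))
  | 0 => fun _ _ => MemLp.zero
  | _ + 1 => MemH.of_hasWeakPartial (fun _ _ => MemLp.zero) (fun _ => hasWeakPartial_zero)
      (fun _ => memH_zero)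

theorem MemH.sum {ι : Type*} (s : Finset ι) {F : ι → EuclideanSpace ℝ (Fin (d + 1)) → ℝ}
    (hF : ∀ m ∈ s, MemH k (F m)) : MemH k (fun x => ∑ m ∈ s, F m x) := by
  classical
  induction s using Finset.induction_on with
  | empty => simpa using memH_zero
  | insert m s hm ih =>
    simp only [Finset.sum_insert hm]
    exact (hF m (by simp)).add (ih fun l hl => hF l (by simp [hl]))

theorem dW_add (hf : MemH 1 f) (hh : MemH 1 h) (i : Fin (d + 1)) :
    dW i (fun x => f x + h x) =ᵐ[hbMeasure d] fun x => dW i f x + dW i h x :=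
  ((hf.hasWeakPartial i).add (measurableSet_halfBall 3)
    (hh.hasWeakPartial i)).weakPartial_ae_eq (isOpen_halfBall 3)

theorem dW_smooth_mul (ha : ContDiff ℝ ∞ a) (hf : MemH 1 f) (i : Fin (d + 1)) :
    dW i (fun x => a x * f x) =ᵐ[hbMeasure d] fun x => pderiv i a x * f x + a x * dW i f x :=
  ((hf.hasWeakPartial i).smooth_mul (isOpen_halfBall 3) ha).weakPartial_ae_eq (isOpen_halfBall 3)

theorem dW_sum {ι : Type*} (s : Finset ι) {F : ι → EuclideanSpace ℝ (Fin (d + 1)) → ℝ}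
    (hF : ∀ m ∈ s, MemH 1 (F m)) (i : Fin (d + 1)) :
    dW i (fun x => ∑ m ∈ s, F m x) =ᵐ[hbMeasure d] fun x => ∑ m ∈ s, dW i (F m) x := by
  classical
  induction s using Finset.induction_on with
  | empty =>
    simpa using (hasWeakPartial_zero (U := halfBall d 3) (i := i)).weakPartial_ae_eq
      (isOpen_halfBall 3)
  | insert m s hm ih =>
    simp only [Finset.sum_insert hm]
    have h1 := dW_add (hF m (by simp)) (MemH.sum s fun l hl => hF l (by simp [hl])) i
    filter_upwards [h1, ih fun l hl => hF l (by simp [hl])] with x hx hx'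
    rw [hx, hx']

theorem dW_comm (hf : MemH 2 f) (i j : Fin (d + 1)) :
    dW i (dW j f) =ᵐ[hbMeasure d] dW j (dW i f) :=
  (((hf.hasWeakPartial j).comm (hf.hasWeakPartial i)
    ((hf.deriv j).hasWeakPartial i)).weakPartial_ae_eq (isOpen_halfBall 3)).symm

/-- A cutoff supported in the open ball of radius 3 turns local square integrability up to the
flat boundary into square integrability. -/
theorem MemH.memLp_cutoff_mul (hf : MemH k f) (ha : Continuous a)
    (hs : tsupport a ⊆ Metric.ball 0 3) : MemLp (fun x => a x * f x) 2 (hbMeasure d) := by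
  obtain ⟨r, hr, hsr⟩ := exists_lt_subset_ball (isClosed_tsupport a) hs
  have h1 := memLp_continuous_mul ha (hf.memLp hr)
  have h2 : MemLp ((halfBall d r).indicator fun x => a x * f x) 2 volume :=
    (memLp_indicator_iff_restrict (measurableSet_halfBall r)).2 h1
  refine (h2.mono_measure Measure.restrict_le_self).ae_eq ?_
  filter_upwards [ae_restrict_mem (measurableSet_halfBall 3)] with x hx
  by_cases hxr : x ∈ halfBall d r
  · simp [hxr]
  · rw [Set.indicator_of_notMem hxr, image_eq_zero_of_notMem_tsupport (f := a), zero_mul]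
    intro hxs
    exact hxr ⟨by simpa using hsr hxs, hx.2⟩

end Sobolev

/-! ### Smooth approximation up to the flat boundary -/

theorem tendsto_integral_mul_of_tendsto_eLpNorm {α : Type*} [MeasurableSpace α] {ν : Measure α}
    {A B : α → ℝ} {a b : ℕ → α → ℝ} (hA : MemLp A 2 ν) (hB : MemLp B 2 ν)
    (ha : ∀ m, MemLp (a m) 2 ν) (hb : ∀ m, MemLp (b m) 2 ν)
    (hla : Tendsto (fun m => eLpNorm (fun x => a m x - A x) 2 ν) atTop (𝓝 0))
    (hlb : Tendsto (fun m => eLpNorm (fun x => b m x - B x) 2 ν) atTop (𝓝 0)) :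
    Tendsto (fun m => ∫ x, a m x * b m x ∂ν) atTop (𝓝 (∫ x, A x * B x ∂ν)) := by
  have h1 : Tendsto (fun m => (ha m).toLp (a m)) atTop (𝓝 (hA.toLp A)) :=
    (Lp.tendsto_Lp_iff_tendsto_eLpNorm'' _ ha _ hA).2 hla
  have h2 : Tendsto (fun m => (hb m).toLp (b m)) atTop (𝓝 (hB.toLp B)) :=
    (Lp.tendsto_Lp_iff_tendsto_eLpNorm'' _ hb _ hB).2 hlb
  have key : ∀ {f h : α → ℝ} (hf : MemLp f 2 ν) (hh : MemLp h 2 ν),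
      inner ℝ (hf.toLp f) (hh.toLp h) = ∫ x, f x * h x ∂ν := by
    intro f h hf hh
    rw [L2.inner_def]
    apply integral_congr_ae
    filter_upwards [hf.coeFn_toLp, hh.coeFn_toLp] with x h1 h2
    rw [h1, h2]
    simp [mul_comm]
  have h3 := h1.inner (𝕜 := ℝ) h2
  simpa only [key] using h3

variable {d : ℕ}

/-- The open half space `{x_n > 0}`. -/
def halfSpace (d : ℕ) : Set (EuclideanSpace ℝ (Fin (d + 1))) := {x | 0 < x (Fin.last d)}

theorem measurableSet_halfSpace : MeasurableSet (halfSpace d) :=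
  (isOpen_lt continuous_const (EuclideanSpace.proj (𝕜 := ℝ) (Fin.last d)).continuous).measurableSet

theorem continuous_bdryPt : Continuous (bdryPt : EuclideanSpace ℝ (Fin d) → _) := by
  unfold bdryPt
  apply (PiLp.continuous_toLp 2 _).comp
  apply continuous_pi
  intro i
  refine Fin.lastCases ?_ (fun j => ?_) i
  · simpa using continuous_const
  · simpa using (EuclideanSpace.proj (𝕜 := ℝ) j).continuous

theorem norm_bdryPt (y : EuclideanSpace ℝ (Fin d)) : ‖bdryPt y‖ = ‖y‖ := by
  simp [EuclideanSpace.norm_eq, bdryPt, Fin.sum_univ_castSucc]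

theorem isometry_bdryPt : Isometry (bdryPt : EuclideanSpace ℝ (Fin d) → _) := by
  refine Isometry.of_dist_eq fun x y => ?_
  simp [EuclideanSpace.dist_eq, bdryPt, Fin.sum_univ_castSucc]

theorem hasCompactSupport_comp_bdryPt {φ : EuclideanSpace ℝ (Fin (d + 1)) → ℝ}
    (hc : HasCompactSupport φ) :
    HasCompactSupport (fun y : EuclideanSpace ℝ (Fin d) => φ (bdryPt y)) :=
  hc.comp_isClosedEmbedding isometry_bdryPt.isClosedEmbedding

/-- The fundamental theorem of calculus in the normal direction. -/
theorem integral_halfSpace_pderiv_last {φ : EuclideanSpace ℝ (Fin (d + 1)) → ℝ}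
    (hφ : ContDiff ℝ ∞ φ) (hc : HasCompactSupport φ) :
    ∫ x in halfSpace d, pderiv (Fin.last d) φ x = - ∫ y, φ (bdryPt y) := by
  -- coordinates `(t, y)` with `t` the last one
  let P : ℝ → (Fin d → ℝ) → EuclideanSpace ℝ (Fin (d + 1)) := fun t y =>
    WithLp.toLp 2 ((Fin.last d).insertNth (α := fun _ => ℝ) t y)
  have hchange : ∀ F : EuclideanSpace ℝ (Fin (d + 1)) → ℝ,
      ∫ x, F x = ∫ z : ℝ × (Fin d → ℝ), F (P z.1 z.2) := by
    intro F
    rw [← (PiLp.volume_preserving_toLp (Fin (d + 1))).integral_comp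
      (MeasurableEquiv.toLp 2 (Fin (d + 1) → ℝ)).measurableEmbedding,
      ← ((volume_preserving_piFinSuccAbove (fun _ : Fin (d + 1) => ℝ) (Fin.last d)).symm
        _).integral_comp (MeasurableEquiv.measurableEmbedding _)]
    rfl
  have hmem : ∀ t y, P t y ∈ halfSpace d ↔ 0 < t := by
    intro t y; simp [P, halfSpace]
  have hP0 : ∀ y : EuclideanSpace ℝ (Fin d), P 0 (WithLp.ofLp y) = bdryPt y := by
    intro y; simp [P, bdryPt]
  have hcl : ∀ y, IsClosedEmbedding fun t => P t y := by
    intro y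
    refine Isometry.isClosedEmbedding (Isometry.of_dist_eq fun s t => ?_)
    simp [EuclideanSpace.dist_eq, P, Fin.sum_univ_castSucc, Real.dist_eq, Real.sqrt_sq_eq_abs]
  have hderiv : ∀ y t, HasDerivAt (fun t => φ (P t y)) (pderiv (Fin.last d) φ (P t y)) t := by
    intro y t
    have h1 : HasDerivAt (fun t => P t y) (EuclideanSpace.single (Fin.last d) 1) t := by
      have : (fun t => P t y) =
          fun t => P 0 y + t • EuclideanSpace.single (Fin.last d) (1 : ℝ) := by
        funext t
        ext i
        refine Fin.lastCases ?_ (fun j => ?_) i <;> simp [P]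
      rw [this]
      simpa using ((hasDerivAt_id t).smul_const
        (EuclideanSpace.single (Fin.last d) (1 : ℝ))).const_add (P 0 y)
    have h2 := ((hφ.differentiable (by simp)) (P t y)).hasFDerivAt
    exact h2.comp_hasDerivAt t h1
  have hint : Integrable ((halfSpace d).indicator (pderiv (Fin.last d) φ)) :=
    ((contDiff_pderiv hφ _).continuous.integrable_of_hasCompactSupport
      (hasCompactSupport_pderiv hc _)).indicator measurableSet_halfSpace
  have hint2 : Integrable (fun z : ℝ × (Fin d → ℝ) =>
      (halfSpace d).indicator (pderiv (Fin.last d) φ) (P z.1 z.2)) := by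
    have := ((PiLp.volume_preserving_toLp (Fin (d + 1))).integrable_comp_emb
      (MeasurableEquiv.toLp 2 (Fin (d + 1) → ℝ)).measurableEmbedding).2 hint
    exact (((volume_preserving_piFinSuccAbove (fun _ : Fin (d + 1) => ℝ) (Fin.last d)).symm
        _).integrable_comp_emb (MeasurableEquiv.measurableEmbedding _)).2 this
  rw [← integral_indicator measurableSet_halfSpace, hchange]
  rw [Measure.volume_eq_prod, integral_prod_symm _ hint2]
  have hinner : ∀ y,
      ∫ t, (halfSpace d).indicator (pderiv (Fin.last d) φ) (P t y) = - φ (P 0 y) := by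
    intro y
    have e1 : (fun t => (halfSpace d).indicator (pderiv (Fin.last d) φ) (P t y)) =
        (Set.Ioi (0 : ℝ)).indicator fun t => pderiv (Fin.last d) φ (P t y) := by
      funext t
      by_cases ht : 0 < t
      · rw [Set.indicator_of_mem ((hmem t y).2 ht), Set.indicator_of_mem (by simpa using ht)]
      · rw [Set.indicator_of_notMem (fun h => ht ((hmem t y).1 h)),
          Set.indicator_of_notMem (by simpa using ht)]
    rw [e1, integral_indicator measurableSet_Ioi]
    have hcs : HasCompactSupport fun t => φ (P t y) := hc.comp_isClosedEmbedding (hcl y)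
    have hcd : HasCompactSupport fun t => pderiv (Fin.last d) φ (P t y) :=
      (hasCompactSupport_pderiv hc _).comp_isClosedEmbedding (hcl y)
    have hi : IntegrableOn (fun t => pderiv (Fin.last d) φ (P t y)) (Set.Ioi 0) :=
      (((contDiff_pderiv hφ _).continuous.comp
        (hcl y).continuous).integrable_of_hasCompactSupport hcd).integrableOn
    have hlim : Tendsto (fun t => φ (P t y)) atTop (𝓝 0) :=
      hcs.is_zero_at_infty.mono_left atTop_le_cocompact
    rw [integral_Ioi_of_hasDerivAt_of_tendsto (hderiv y 0).continuousAt.continuousWithinAt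
      (fun t _ => hderiv y t) hi hlim]
    simp
  simp only [hinner]
  rw [integral_neg,
    ← (EuclideanSpace.volume_preserving_symm_measurableEquiv_toLp (Fin d)).integral_comp
      (MeasurableEquiv.measurableEmbedding _)]
  congr 2
  funext y
  exact congrArg φ (hP0 y)

theorem eLpNorm_two_sq {α : Type*} [MeasurableSpace α] {ν : Measure α} (f : α → ℝ) :
    eLpNorm f 2 ν ^ 2 = ∫⁻ x, ‖f x‖ₑ ^ 2 ∂ν := by
  have := eLpNorm_nnreal_pow_eq_lintegral (f := f) (μ := ν) (p := 2) (by norm_num)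
  norm_num at this
  exact_mod_cast this

section Mollify

variable {d : ℕ}

/-- Translations are continuous in `L^2`. -/
theorem tendsto_eLpNorm_translate_sub {F : EuclideanSpace ℝ (Fin d) → ℝ}
    (hF : MemLp F 2 volume) :
    Tendsto (fun w => eLpNorm (fun x => F (x - w) - F x) 2 volume) (𝓝 0) (𝓝 0) := by
  let g : EuclideanSpace ℝ (Fin d) → C(EuclideanSpace ℝ (Fin d), EuclideanSpace ℝ (Fin d)) :=
    (ContinuousMap.mk (fun p : EuclideanSpace ℝ (Fin d) × EuclideanSpace ℝ (Fin d) => p.2 - p.1)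
      (by fun_prop)).curry
  have hg : Continuous g := ContinuousMap.continuous _
  have hmp : ∀ w, MeasurePreserving (g w) volume volume := fun w => measurePreserving_sub_right _ w
  have h1 := Tendsto.compMeasurePreservingLp (l := 𝓝 (0 : EuclideanSpace ℝ (Fin d)))
    (tendsto_const_nhds (x := hF.toLp F)) (hg.tendsto 0) hmp (hmp 0) (by norm_num)
  simp only [Lp.toLp_compMeasurePreserving] at h1
  have h2 := (Lp.tendsto_Lp_iff_tendsto_eLpNorm'' _ (fun w => hF.comp_measurePreserving (hmp w)) _
    (hF.comp_measurePreserving (hmp 0))).1 h1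
  refine h2.congr fun w => ?_
  congr 1
  funext x
  simp [g]

/-- The convolution `∫ F(t) ρ(x - t) dt` of a function with a mollifier. -/
noncomputable def mollify (F ρ : EuclideanSpace ℝ (Fin d) → ℝ) : EuclideanSpace ℝ (Fin d) → ℝ :=
  convolution F ρ (ContinuousLinearMap.mul ℝ ℝ) volume

theorem mollify_apply (F ρ : EuclideanSpace ℝ (Fin d) → ℝ) (x : EuclideanSpace ℝ (Fin d)) :
    mollify F ρ x = ∫ t, F t * ρ (x - t) := rfl

variable {F ρ : EuclideanSpace ℝ (Fin d) → ℝ}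

/-- Mollification is an average of translations, so it moves a function in `L^2` by at most as much
as these translations do. -/
theorem eLpNorm_mollify_sub_le (hF : MemLp F 2 volume) (hρ : Continuous ρ)
    (hc : HasCompactSupport ρ) (hρ0 : ∀ w, 0 ≤ ρ w) (hρ1 : ∫ w, ρ w = 1) {δ : ℝ≥0∞}
    (hδ : ∀ w, ρ w ≠ 0 → eLpNorm (fun x => F (x - w) - F x) 2 volume ≤ δ) :
    eLpNorm (fun x => mollify F ρ x - F x) 2 volume ≤ δ := by
  have hloc : LocallyIntegrable F := hF.locallyIntegrable (by norm_num)
  have hi : Integrable ρ := hρ.integrable_of_hasCompactSupport hc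
  let ν : Measure (EuclideanSpace ℝ (Fin d)) :=
    volume.withDensity fun w => ENNReal.ofReal (ρ w)
  have hmeas : Measurable fun w => ENNReal.ofReal (ρ w) := hρ.measurable.ennreal_ofReal
  have hν : IsProbabilityMeasure ν := by
    constructor
    simp only [ν]
    rw [withDensity_apply _ MeasurableSet.univ, Measure.restrict_univ,
      ← ofReal_integral_eq_lintegral_ofReal hi (ae_of_all _ hρ0), hρ1, ENNReal.ofReal_one]
  have hac : ν ≪ volume := withDensity_absolutelyContinuous _ _
  have hint : ∀ x, Integrable (fun w => F (x - w)) ν := by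
    intro x
    have h1 : Integrable (fun t => F t * ρ (x - t)) :=
      (hc.convolutionExists_right (ContinuousLinearMap.mul ℝ ℝ) hloc hρ) x
    have h2 : Integrable (fun w => F (x - w) * ρ w) := by
      simpa using h1.comp_sub_left x
    rw [integrable_withDensity_iff_integrable_smul' hmeas (by simp)]
    refine h2.congr (ae_of_all _ fun w => ?_)
    simp [ENNReal.toReal_ofReal (hρ0 w), mul_comm]
  have hval : ∀ x, mollify F ρ x - F x = ∫ w, (F (x - w) - F x) ∂ν := by
    intro x
    rw [integral_sub (hint x) (integrable_const _), integral_const]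
    simp only [probReal_univ, smul_eq_mul, one_mul]
    congr 1
    rw [mollify_apply, ← integral_sub_left_eq_self _ volume x]
    simp only [ν]
    rw [integral_withDensity_eq_integral_toReal_smul hmeas (by simp)]
    congr 1
    funext w
    simp [ENNReal.toReal_ofReal (hρ0 w), mul_comm]
  have hpt : ∀ x, ‖mollify F ρ x - F x‖ₑ ^ 2 ≤ ∫⁻ w, ‖F (x - w) - F x‖ₑ ^ 2 ∂ν := by
    intro x
    rw [hval x, ← eLpNorm_two_sq]
    gcongr
    refine (enorm_integral_le_lintegral_enorm _).trans ?_
    rw [← eLpNorm_one_eq_lintegral_enorm]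
    exact eLpNorm_le_eLpNorm_of_exponent_le (by norm_num)
      ((hint x).1.sub aestronglyMeasurable_const)
  have haem : AEMeasurable (Function.uncurry fun x w => ‖F (x - w) - F x‖ₑ ^ 2)
      (volume.prod ν) := by
    have hacp : (volume : Measure (EuclideanSpace ℝ (Fin d))).prod ν ≪ volume.prod volume :=
      Measure.AbsolutelyContinuous.rfl.prod hac
    have h1 : AEStronglyMeasurable (fun p : EuclideanSpace ℝ (Fin d) × EuclideanSpace ℝ (Fin d) =>
        F (p.1 - p.2)) (volume.prod volume) :=
      hF.1.comp_quasiMeasurePreserving (quasiMeasurePreserving_sub_of_right_invariant _ _)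
    have h2 : AEStronglyMeasurable (fun p : EuclideanSpace ℝ (Fin d) × EuclideanSpace ℝ (Fin d) =>
        F p.1) (volume.prod volume) :=
      hF.1.comp_quasiMeasurePreserving Measure.quasiMeasurePreserving_fst
    exact (((h1.sub h2).mono_ac hacp).enorm.pow_const 2)
  have hsq : eLpNorm (fun x => mollify F ρ x - F x) 2 volume ^ 2 ≤ δ ^ 2 := by
    rw [eLpNorm_two_sq]
    calc ∫⁻ x, ‖mollify F ρ x - F x‖ₑ ^ 2 ≤ ∫⁻ x, ∫⁻ w, ‖F (x - w) - F x‖ₑ ^ 2 ∂ν :=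
          lintegral_mono hpt
      _ = ∫⁻ w, (∫⁻ x, ‖F (x - w) - F x‖ₑ ^ 2) ∂ν := by
          rw [lintegral_lintegral_swap haem]
      _ ≤ ∫⁻ _, δ ^ 2 ∂ν := by
          apply lintegral_mono_ae
          have : ∀ᵐ w ∂ν, ENNReal.ofReal (ρ w) ≠ 0 := by
            simp only [ν]
            rw [ae_withDensity_iff hmeas]
            exact ae_of_all _ fun _ h => h
          filter_upwards [this] with w hw
          rw [← eLpNorm_two_sq]
          gcongr
          exact hδ w (fun h => hw (by simp [h]))
      _ = δ ^ 2 := by simp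
  by_contra! hlt
  exact absurd hsq (not_le.2 (ENNReal.pow_lt_pow_left two_ne_zero hlt))

theorem contDiff_mollify (hF : LocallyIntegrable F) (hρ : ContDiff ℝ ∞ ρ)
    (hc : HasCompactSupport ρ) : ContDiff ℝ ∞ (mollify F ρ) :=
  hc.contDiff_convolution_right _ hF hρ

theorem pderiv_mollify (hF : LocallyIntegrable F) (hρ : ContDiff ℝ ∞ ρ)
    (hc : HasCompactSupport ρ) (i : Fin d) (x : EuclideanSpace ℝ (Fin d)) :
    pderiv i (mollify F ρ) x = ∫ t, F t * pderiv i ρ (x - t) := by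
  have h1 := hc.hasFDerivAt_convolution_right (ContinuousLinearMap.mul ℝ ℝ) hF
    (hρ.of_le (by exact WithTop.coe_le_coe.2 (le_top : (1 : ℕ∞) ≤ ⊤))) x
  unfold pderiv mollify
  rw [h1.fderiv, convolution_precompR_apply _ hF (hc.fderiv ℝ)
    (hρ.continuous_fderiv (by simp))]
  rfl

end Mollify

/-- Functions on the half space with weak derivatives in `L^2` are approximated, together with these
derivatives, by functions smooth up to the boundary: the mollifier is supported in `{x_n < 0}`, so
that only values inside the half space are averaged. -/
theorem exists_smooth_approx {d : ℕ} {F : EuclideanSpace ℝ (Fin (d + 1)) → ℝ}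
    {G : Fin (d + 1) → EuclideanSpace ℝ (Fin (d + 1)) → ℝ} (hF : MemLp F 2 volume)
    (hG : ∀ i, MemLp (G i) 2 volume) {r R : ℝ} (hrR : r < R) (hsupp : ∀ x, r ≤ ‖x‖ → F x = 0)
    (hw : ∀ i, ∀ φ : EuclideanSpace ℝ (Fin (d + 1)) → ℝ, ContDiff ℝ ∞ φ → HasCompactSupport φ →
      tsupport φ ⊆ halfSpace d → ∫ x, F x * pderiv i φ x = - ∫ x, G i x * φ x)
    {δ : ℝ≥0∞} (hδ : 0 < δ) :
    ∃ φ : EuclideanSpace ℝ (Fin (d + 1)) → ℝ, ContDiff ℝ ∞ φ ∧ HasCompactSupport φ ∧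
      tsupport φ ⊆ Metric.ball 0 R ∧ eLpNorm (fun x => φ x - F x) 2 volume ≤ δ ∧
      ∀ i, eLpNorm (fun x => pderiv i φ x - G i x) 2 (volume.restrict (halfSpace d)) ≤ δ := by
  have hev : ∀ᶠ w in 𝓝 (0 : EuclideanSpace ℝ (Fin (d + 1))),
      eLpNorm (fun x => F (x - w) - F x) 2 volume ≤ δ ∧
      ∀ i, eLpNorm (fun x => G i (x - w) - G i x) 2 volume ≤ δ :=
    ((tendsto_eLpNorm_translate_sub hF).eventually (ge_mem_nhds hδ)).and
      (eventually_all.2 fun i =>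
        (tendsto_eLpNorm_translate_sub (hG i)).eventually (ge_mem_nhds hδ))
  obtain ⟨ε, hε, hball⟩ := Metric.eventually_nhds_iff.1 hev
  obtain ⟨s, hs0, hsε, hsR⟩ : ∃ s : ℝ, 0 < s ∧ 2 * s < ε ∧ r + 2 * s < R := by
    refine ⟨min ε (R - r) / 4, by have := lt_min hε (sub_pos.2 hrR); linarith, ?_, ?_⟩
    · have := min_le_left ε (R - r); linarith
    · have := min_le_right ε (R - r); linarith
  let c : EuclideanSpace ℝ (Fin (d + 1)) := EuclideanSpace.single (Fin.last d) (-s)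
  let f : ContDiffBump c := ⟨s / 4, s / 2, by linarith, by linarith⟩
  let ρ := f.normed volume
  have hρ : ContDiff ℝ ∞ ρ := f.contDiff_normed
  have hρc : HasCompactSupport ρ := f.hasCompactSupport_normed
  have hcn : ‖c‖ = s := by simp [c, abs_of_pos hs0]
  have hsm : ∀ w, w ∈ Metric.closedBall c (s / 2) → ‖w‖ < 2 * s ∧ w (Fin.last d) < 0 := by
    intro w hw
    rw [mem_closedBall_iff_norm] at hw
    constructor
    · have := norm_add_le (w - c) c
      rw [sub_add_cancel] at this
      linarith
    · have h1 := (PiLp.norm_apply_le (w - c) (Fin.last d)).trans hw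
      have h2 : (w - c) (Fin.last d) = w (Fin.last d) + s := by simp [c]
      rw [h2, Real.norm_eq_abs] at h1
      have := (abs_le.1 h1).2
      linarith
  have hρs : ∀ w, ρ w ≠ 0 → w ∈ Metric.closedBall c (s / 2) := by
    intro w hw
    have : w ∈ Function.support (f.normed volume) := hw
    rw [f.support_normed_eq] at this
    exact Metric.ball_subset_closedBall this
  have hmoll : ∀ H : EuclideanSpace ℝ (Fin (d + 1)) → ℝ, MemLp H 2 volume →
      (∀ w, dist w 0 < ε → eLpNorm (fun x => H (x - w) - H x) 2 volume ≤ δ) →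
      eLpNorm (fun x => mollify H ρ x - H x) 2 volume ≤ δ := by
    intro H hH hHw
    refine eLpNorm_mollify_sub_le hH hρ.continuous hρc f.nonneg_normed f.integral_normed ?_
    intro w hw
    apply hHw
    rw [dist_zero_right]
    linarith [(hsm w (hρs w hw)).1]
  have hFl : LocallyIntegrable F := hF.locallyIntegrable (by norm_num)
  have hts : tsupport (mollify F ρ) ⊆ Metric.closedBall 0 (r + 2 * s) := by
    refine closure_minimal (fun x hx => ?_) Metric.isClosed_closedBall
    by_contra hcon
    apply hx
    rw [mollify_apply]
    refine integral_eq_zero_of_ae (ae_of_all _ fun t => ?_)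
    rcases le_or_gt r ‖t‖ with h | h
    · simp [hsupp t h]
    · have : ρ (x - t) = 0 := by
        by_contra h0
        have h1 := (hsm _ (hρs _ h0)).1
        have h2 := norm_add_le (x - t) t
        rw [sub_add_cancel] at h2
        apply hcon
        rw [mem_closedBall_zero_iff]; linarith
      simp [this]
  refine ⟨mollify F ρ, contDiff_mollify hFl hρ hρc,
    (isCompact_closedBall _ _).of_isClosed_subset (isClosed_tsupport _) hts,
    hts.trans (Metric.closedBall_subset_ball hsR), hmoll F hF fun w h => (hball h).1, fun i => ?_⟩
  have hd : ∀ x ∈ halfSpace d, pderiv i (mollify F ρ) x = mollify (G i) ρ x := by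
    intro x hx
    rw [pderiv_mollify hFl hρ hρc, mollify_apply]
    have hψ : ContDiff ℝ ∞ fun t => ρ (x - t) := hρ.comp (contDiff_const.sub contDiff_id)
    have hψc : HasCompactSupport fun t => ρ (x - t) := hρc.comp_homeomorph (Homeomorph.subLeft x)
    have hψs : tsupport (fun t => ρ (x - t)) ⊆ halfSpace d := by
      have h1 : tsupport (fun t => ρ (x - t)) ⊆
          (fun t => x - t) ⁻¹' Metric.closedBall c (s / 2) :=
        closure_minimal (fun t ht => hρs _ ht)
          (Metric.isClosed_closedBall.preimage (continuous_const.sub continuous_id))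
      intro t ht
      have h2 := (hsm _ (h1 ht)).2
      have h3 : 0 < x (Fin.last d) := hx
      simp only [PiLp.sub_apply] at h2
      change 0 < t (Fin.last d)
      linarith
    have hψd : ∀ t, pderiv i (fun t => ρ (x - t)) t = - pderiv i ρ (x - t) := by
      intro t
      have h1 := ((hρ.differentiable (by simp)) (x - t)).hasFDerivAt.comp t
        ((hasFDerivAt_id t).const_sub x)
      unfold pderiv
      erw [h1.fderiv]
      simp
    have := hw i _ hψ hψc hψs
    simp only [hψd, mul_neg, integral_neg, neg_inj] at this
    exact this
  calc eLpNorm (fun x => pderiv i (mollify F ρ) x - G i x) 2 (volume.restrict (halfSpace d))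
      = eLpNorm (fun x => mollify (G i) ρ x - G i x) 2 (volume.restrict (halfSpace d)) := by
        refine eLpNorm_congr_ae ?_
        filter_upwards [ae_restrict_mem measurableSet_halfSpace] with x hx
        rw [hd x hx]
    _ ≤ eLpNorm (fun x => mollify (G i) ρ x - G i x) 2 volume :=
        eLpNorm_mono_measure _ Measure.restrict_le_self
    _ ≤ δ := hmoll (G i) (hG i) fun w h => (hball h).2 i

/-! ### Green's formula as an inequality -/

section Green

variable {d : ℕ}

/-- The `L^2` norm of `φ` on the hyperplane `{x_n = 0}`. -/
noncomputable def bdryNorm (φ : EuclideanSpace ℝ (Fin (d + 1)) → ℝ) : ℝ :=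
  √(∫ y : EuclideanSpace ℝ (Fin d), φ (bdryPt y) ^ 2)

theorem bdryNorm_nonneg (φ : EuclideanSpace ℝ (Fin (d + 1)) → ℝ) : 0 ≤ bdryNorm φ :=
  Real.sqrt_nonneg _

theorem integrable_sq_bdryPt {φ : EuclideanSpace ℝ (Fin (d + 1)) → ℝ} (hφ : Continuous φ)
    (hc : HasCompactSupport φ) :
    Integrable fun y : EuclideanSpace ℝ (Fin d) => φ (bdryPt y) ^ 2 := by
  have h1 : HasCompactSupport fun y : EuclideanSpace ℝ (Fin d) => φ (bdryPt y) ^ 2 :=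
    (hasCompactSupport_comp_bdryPt hc).comp_left (g := fun t : ℝ => t ^ 2) (by simp)
  exact ((hφ.comp continuous_bdryPt).pow 2).integrable_of_hasCompactSupport h1

theorem bdryNorm_mul_le {φ a : EuclideanSpace ℝ (Fin (d + 1)) → ℝ} (hφ : Continuous φ)
    (hc : HasCompactSupport φ) (ha : Continuous a) {S : ℝ}
    (hS : ∀ x, φ x ≠ 0 → |a x| ≤ S) (hS0 : 0 ≤ S) :
    bdryNorm (fun x => a x * φ x) ≤ S * bdryNorm φ := by
  unfold bdryNorm
  rw [← Real.sqrt_sq hS0, ← Real.sqrt_mul (sq_nonneg _), ← integral_const_mul]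
  apply Real.sqrt_le_sqrt
  apply integral_mono
  · exact integrable_sq_bdryPt (ha.mul hφ) hc.mul_left
  · exact (integrable_sq_bdryPt hφ hc).const_mul _
  · intro y
    simp only [mul_pow]
    by_cases h : φ (bdryPt y) = 0
    · simp [h]
    · exact mul_le_mul_of_nonneg_right (sq_le_sq' (abs_le.1 (hS _ h)).1 (abs_le.1 (hS _ h)).2)
        (sq_nonneg _)

theorem bdryNorm_sq_eq {φ : EuclideanSpace ℝ (Fin (d + 1)) → ℝ} (hφ : ContDiff ℝ ∞ φ)
    (hc : HasCompactSupport φ) :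
    bdryNorm φ ^ 2 = - (2 * ∫ x in halfSpace d, φ x * pderiv (Fin.last d) φ x) := by
  unfold bdryNorm
  rw [Real.sq_sqrt (integral_nonneg fun y => sq_nonneg _)]
  have h1 := integral_halfSpace_pderiv_last (hφ.mul hφ) (hc.mul_left (f := φ))
  simp only [pderiv_mul hφ hφ] at h1
  rw [← integral_const_mul]
  have h2 : ∫ y : EuclideanSpace ℝ (Fin d), φ (bdryPt y) ^ 2 =
      ∫ y : EuclideanSpace ℝ (Fin d), φ (bdryPt y) * φ (bdryPt y) := by simp only [sq]
  rw [h2, ← neg_eq_iff_eq_neg, ← h1]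
  congr 1
  funext x; ring

/-- The bilinear form of Green's formula is bounded by the trace norm of one factor and by the
value of the form on the square of the other. -/
theorem abs_integral_halfSpace_le_sqrt {F H : EuclideanSpace ℝ (Fin (d + 1)) → ℝ}
    {G K : Fin (d + 1) → EuclideanSpace ℝ (Fin (d + 1)) → ℝ} (hF : MemLp F 2 volume)
    (hG : ∀ i, MemLp (G i) 2 volume) (hH : MemLp H 2 volume) (hK : ∀ i, MemLp (K i) 2 volume)
    {r R : ℝ} (hrR : r < R) (hsupp : ∀ x, r ≤ ‖x‖ → H x = 0)
    (hw : ∀ i, ∀ φ : EuclideanSpace ℝ (Fin (d + 1)) → ℝ, ContDiff ℝ ∞ φ → HasCompactSupport φ →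
      tsupport φ ⊆ halfSpace d → ∫ x, H x * pderiv i φ x = - ∫ x, K i x * φ x)
    {B : ℝ}
    (hB : ∀ i, ∀ φ : EuclideanSpace ℝ (Fin (d + 1)) → ℝ, ContDiff ℝ ∞ φ → HasCompactSupport φ →
      tsupport φ ⊆ Metric.ball 0 R →
      |∫ x in halfSpace d, (F x * pderiv i φ x + G i x * φ x)| ≤ B * bdryNorm φ)
    (i : Fin (d + 1)) :
    |∫ x in halfSpace d, (F x * K i x + G i x * H x)| ≤
      B * √(2 * |∫ x in halfSpace d, H x * K (Fin.last d) x|) := by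
  have hex : ∀ m : ℕ, ∃ φ : EuclideanSpace ℝ (Fin (d + 1)) → ℝ, ContDiff ℝ ∞ φ ∧
      HasCompactSupport φ ∧ tsupport φ ⊆ Metric.ball 0 R ∧
      eLpNorm (fun x => φ x - H x) 2 volume ≤ (m : ℝ≥0∞)⁻¹ ∧
      ∀ i, eLpNorm (fun x => pderiv i φ x - K i x) 2 (volume.restrict (halfSpace d)) ≤
        (m : ℝ≥0∞)⁻¹ := fun m =>
    exists_smooth_approx hH hK hrR hsupp hw (by simp)
  choose φ hφ hφc hφs hφ1 hφ2 using hex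
  set D : Measure (EuclideanSpace ℝ (Fin (d + 1))) := volume.restrict (halfSpace d)
  have hD : D ≤ volume := Measure.restrict_le_self
  have l1 : Tendsto (fun m => eLpNorm (fun x => φ m x - H x) 2 D) atTop (𝓝 0) :=
    tendsto_of_tendsto_of_tendsto_of_le_of_le tendsto_const_nhds
      ENNReal.tendsto_inv_nat_nhds_zero (fun _ => zero_le)
      (fun m => (eLpNorm_mono_measure _ hD).trans (hφ1 m))
  have l2 : ∀ i, Tendsto (fun m => eLpNorm (fun x => pderiv i (φ m) x - K i x) 2 D) atTop (𝓝 0) :=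
    fun i => tendsto_of_tendsto_of_tendsto_of_le_of_le tendsto_const_nhds
      ENNReal.tendsto_inv_nat_nhds_zero (fun _ => zero_le) (fun m => hφ2 m i)
  have m1 : ∀ m, MemLp (φ m) 2 D := fun m =>
    ((hφ m).continuous.memLp_of_hasCompactSupport (hφc m)).mono_measure hD
  have m2 : ∀ i m, MemLp (pderiv i (φ m)) 2 D := fun i m =>
    ((contDiff_pderiv (hφ m) i).continuous.memLp_of_hasCompactSupport
      (hasCompactSupport_pderiv (hφc m) i)).mono_measure hD
  have c0 : ∀ A : EuclideanSpace ℝ (Fin (d + 1)) → ℝ,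
      Tendsto (fun _ : ℕ => eLpNorm (fun x => A x - A x) 2 D) atTop (𝓝 0) := by
    intro A; simp
  have hmul : ∀ {f h : EuclideanSpace ℝ (Fin (d + 1)) → ℝ}, MemLp f 2 D → MemLp h 2 D →
      Integrable (fun x => f x * h x) D := fun hf hh => hf.integrable_mul hh
  have hFD := hF.mono_measure hD
  have hHD := hH.mono_measure hD
  have hGD := fun i => (hG i).mono_measure hD
  have hKD := fun i => (hK i).mono_measure hD
  have t1 := tendsto_integral_mul_of_tendsto_eLpNorm hFD (hKD i) (fun _ => hFD) (m2 i) (c0 F) (l2 i)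
  have t2 := tendsto_integral_mul_of_tendsto_eLpNorm (hGD i) hHD (fun _ => hGD i) m1 (c0 (G i)) l1
  have t3 := tendsto_integral_mul_of_tendsto_eLpNorm hHD (hKD (Fin.last d)) m1 (m2 (Fin.last d))
    l1 (l2 (Fin.last d))
  have t4 := (t1.add t2).abs
  rw [← integral_add (hmul hFD (hKD i)) (hmul (hGD i) hHD)] at t4
  have t5 : Tendsto (fun m => B * √(2 * |∫ x, φ m x * pderiv (Fin.last d) (φ m) x ∂D|)) atTop
      (𝓝 (B * √(2 * |∫ x, H x * K (Fin.last d) x ∂D|))) :=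
    ((t3.abs.const_mul 2).sqrt).const_mul B
  refine le_of_tendsto_of_tendsto' t4 t5 fun m => ?_
  rw [← integral_add (hmul hFD (m2 i m)) (hmul (hGD i) (m1 m))]
  refine (hB i (φ m) (hφ m) (hφc m) (hφs m)).trans (le_of_eq ?_)
  congr 1
  have h1 := bdryNorm_sq_eq (hφ m) (hφc m)
  rw [← Real.sqrt_sq (bdryNorm_nonneg (φ m))]
  congr 1
  have h2 : 0 ≤ bdryNorm (φ m) ^ 2 := sq_nonneg _
  rw [h1] at h2 ⊢
  rw [abs_of_nonpos (by linarith)]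
  ring

/-- If the traces of `F` and `H` are bounded in `L^2`, so is the bilinear form of Green's formula.
Applying the one-sided bound to the pair `(H, H)` first removes the self-interaction of `H`. -/
theorem abs_integral_halfSpace_le {F H : EuclideanSpace ℝ (Fin (d + 1)) → ℝ}
    {G K : Fin (d + 1) → EuclideanSpace ℝ (Fin (d + 1)) → ℝ} (hF : MemLp F 2 volume)
    (hG : ∀ i, MemLp (G i) 2 volume) (hH : MemLp H 2 volume) (hK : ∀ i, MemLp (K i) 2 volume)
    {r R : ℝ} (hrR : r < R) (hsupp : ∀ x, r ≤ ‖x‖ → H x = 0)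
    (hw : ∀ i, ∀ φ : EuclideanSpace ℝ (Fin (d + 1)) → ℝ, ContDiff ℝ ∞ φ → HasCompactSupport φ →
      tsupport φ ⊆ halfSpace d → ∫ x, H x * pderiv i φ x = - ∫ x, K i x * φ x)
    {B B' : ℝ} (hB0 : 0 ≤ B) (hB0' : 0 ≤ B')
    (hB : ∀ i, ∀ φ : EuclideanSpace ℝ (Fin (d + 1)) → ℝ, ContDiff ℝ ∞ φ → HasCompactSupport φ →
      tsupport φ ⊆ Metric.ball 0 R →
      |∫ x in halfSpace d, (F x * pderiv i φ x + G i x * φ x)| ≤ B * bdryNorm φ)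
    (hB' : ∀ i, ∀ φ : EuclideanSpace ℝ (Fin (d + 1)) → ℝ, ContDiff ℝ ∞ φ → HasCompactSupport φ →
      tsupport φ ⊆ Metric.ball 0 R →
      |∫ x in halfSpace d, (H x * pderiv i φ x + K i x * φ x)| ≤ B' * bdryNorm φ)
    (i : Fin (d + 1)) :
    |∫ x in halfSpace d, (F x * K i x + G i x * H x)| ≤ B * B' := by
  have h1 := abs_integral_halfSpace_le_sqrt hF hG hH hK hrR hsupp hw hB i
  have h2 := abs_integral_halfSpace_le_sqrt hH hK hH hK hrR hsupp hw hB' (Fin.last d)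
  refine h1.trans (mul_le_mul_of_nonneg_left ?_ hB0)
  have h3 : ∫ x in halfSpace d, (H x * K (Fin.last d) x + K (Fin.last d) x * H x) =
      2 * ∫ x in halfSpace d, H x * K (Fin.last d) x := by
    rw [← integral_const_mul]; congr 1; funext x; ring
  rw [h3, abs_mul, abs_two] at h2
  set q := 2 * |∫ x in halfSpace d, H x * K (Fin.last d) x| with hq
  have hq0 : 0 ≤ q := by positivity
  rcases hq0.eq_or_lt with h | h
  · rw [← h]; simpa using hB0'
  · have h4 : √q * √q ≤ B' * √q := by rw [Real.mul_self_sqrt hq0]; exact h2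
    exact le_of_mul_le_mul_right h4 (Real.sqrt_pos.2 h)

variable {k : ℕ} {f h : EuclideanSpace ℝ (Fin (d + 1)) → ℝ}

instance : IsFiniteMeasure (hbMeasure d) := by
  refine ⟨?_⟩
  rw [Measure.restrict_apply_univ]
  refine (measure_mono (t := Metric.ball 0 3) fun x hx => ?_).trans_lt measure_ball_lt_top
  simpa using hx.1

theorem MemH.integrable_cutoff_mul (hf : MemH k f) {a : EuclideanSpace ℝ (Fin (d + 1)) → ℝ}
    (ha : Continuous a) (hs : tsupport a ⊆ Metric.ball 0 3) :
    Integrable (fun x => a x * f x) (hbMeasure d) :=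
  (hf.memLp_cutoff_mul ha hs).integrable (by norm_num)

/-- Tangential integration by parts needs no boundary term. -/
theorem MemH.integral_tangential (hf : MemH 1 f) {i : Fin (d + 1)} (hi : i ≠ Fin.last d)
    {φ : EuclideanSpace ℝ (Fin (d + 1)) → ℝ} (hφ : ContDiff ℝ ∞ φ) (hc : HasCompactSupport φ)
    (hs : tsupport φ ⊆ Metric.ball 0 3) :
    ∫ x in halfBall d 3, (f x * pderiv i φ x + dW i f x * φ x) = 0 := by
  -- cutoffs vanishing near the flat boundary and independent of the tangential variables
  let θ : ℕ → EuclideanSpace ℝ (Fin (d + 1)) → ℝ := fun m x =>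
    Real.smoothTransition (m * x (Fin.last d) - 1)
  have hlast : ContDiff ℝ ∞ fun x : EuclideanSpace ℝ (Fin (d + 1)) => x (Fin.last d) :=
    (EuclideanSpace.proj (𝕜 := ℝ) (Fin.last d)).contDiff
  have hθ : ∀ m, ContDiff ℝ ∞ (θ m) := fun m =>
    Real.smoothTransition.contDiff.comp ((contDiff_const.mul hlast).sub contDiff_const)
  have hθd : ∀ m x, pderiv i (θ m) x = 0 := by
    intro m x
    have h1 : HasFDerivAt (fun x : EuclideanSpace ℝ (Fin (d + 1)) => (m : ℝ) * x (Fin.last d) - 1)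
        ((m : ℝ) • (EuclideanSpace.proj (𝕜 := ℝ) (Fin.last d))) x :=
      ((EuclideanSpace.proj (𝕜 := ℝ) (Fin.last d)).hasFDerivAt.const_mul (m : ℝ)).sub_const 1
    have h2 := ((Real.smoothTransition.contDiff (n := ⊤)).differentiable (by simp)
      ((m : ℝ) * x (Fin.last d) - 1)).hasFDerivAt.comp x h1
    unfold pderiv
    erw [h2.fderiv]
    simp [hi]
  have hθ1 : ∀ m x, |θ m x| ≤ 1 := fun m x => by
    rw [abs_of_nonneg (Real.smoothTransition.nonneg _)]
    exact Real.smoothTransition.le_one _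
  have hθs : ∀ m, tsupport (fun x => θ m x * φ x) ⊆ halfBall d 3 := by
    intro m x hx
    have hx1 : x ∈ tsupport φ := tsupport_mul_subset_right hx
    have hx2 : x ∈ tsupport (θ m) := tsupport_mul_subset_left hx
    refine ⟨by simpa using hs hx1, ?_⟩
    have hcl : tsupport (θ m) ⊆ {x | 1 ≤ m * x (Fin.last d)} := by
      refine closure_minimal (fun z hz => ?_)
        (isClosed_le continuous_const (continuous_const.mul hlast.continuous))
      by_contra hcon
      simp only [Set.mem_ofPred_eq, not_le] at hcon
      exact hz (Real.smoothTransition.zero_of_nonpos (by linarith))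
    have h1 : (1 : ℝ) ≤ m * x (Fin.last d) := hcl hx2
    by_contra hcon
    have : (m : ℝ) * x (Fin.last d) ≤ 0 :=
      mul_nonpos_of_nonneg_of_nonpos (Nat.cast_nonneg m) (not_lt.1 hcon)
    linarith
  have i1 : Integrable (fun x => pderiv i φ x * f x) (hbMeasure d) :=
    hf.integrable_cutoff_mul (contDiff_pderiv hφ i).continuous
      ((tsupport_pderiv_subset i).trans hs)
  have i2 : Integrable (fun x => φ x * dW i f x) (hbMeasure d) :=
    (hf.deriv i).integrable_cutoff_mul hφ.continuous hs
  have hzero : ∀ m, ∫ x in halfBall d 3, θ m x * (f x * pderiv i φ x + dW i f x * φ x) = 0 := by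
    intro m
    have h1 := (hf.hasWeakPartial i).2.2 _ ((hθ m).mul hφ) (hc.mul_left) (hθs m)
    simp only [pderiv_mul (hθ m) hφ, hθd, zero_mul, zero_add] at h1
    have j1 : Integrable (fun x => f x * (θ m x * pderiv i φ x)) (hbMeasure d) := by
      refine (i1.bdd_mul (c := 1) (hθ m).continuous.aestronglyMeasurable
        (ae_of_all _ (hθ1 m))).congr (ae_of_all _ fun x => ?_)
      simp only; ring
    have j2 : Integrable (fun x => dW i f x * (θ m x * φ x)) (hbMeasure d) := by
      refine (i2.bdd_mul (c := 1) (hθ m).continuous.aestronglyMeasurable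
        (ae_of_all _ (hθ1 m))).congr (ae_of_all _ fun x => ?_)
      simp only; ring
    have h2 : ∀ x, θ m x * (f x * pderiv i φ x + dW i f x * φ x) =
        f x * (θ m x * pderiv i φ x) + dW i f x * (θ m x * φ x) := fun x => by ring
    simp only [h2]
    rw [integral_add j1 j2, h1]
    ring
  have i3 : Integrable (fun x => f x * pderiv i φ x + dW i f x * φ x) (hbMeasure d) :=
    (i1.add i2).congr (ae_of_all _ fun x => by simp only [Pi.add_apply]; ring)
  have hlim : Tendsto (fun m => ∫ x in halfBall d 3,
      θ m x * (f x * pderiv i φ x + dW i f x * φ x)) atTop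
      (𝓝 (∫ x in halfBall d 3, (f x * pderiv i φ x + dW i f x * φ x))) := by
    refine tendsto_integral_of_dominated_convergence
      (fun x => ‖f x * pderiv i φ x + dW i f x * φ x‖)
      (fun m => (hθ m).continuous.aestronglyMeasurable.mul i3.1) i3.norm (fun m => ?_) ?_
    · refine ae_of_all _ fun x => ?_
      rw [norm_mul]
      exact mul_le_of_le_one_left (norm_nonneg _) (hθ1 m x)
    · filter_upwards [ae_restrict_mem (measurableSet_halfBall 3)] with x hx
      have hx2 : 0 < x (Fin.last d) := hx.2
      obtain ⟨m₀, hm₀⟩ := exists_nat_ge (2 / x (Fin.last d))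
      refine tendsto_const_nhds.congr' ?_
      filter_upwards [eventually_ge_atTop m₀] with m hm
      have h1 : (2 : ℝ) ≤ m * x (Fin.last d) := by
        rw [← div_le_iff₀ hx2]
        exact hm₀.trans (by exact_mod_cast hm)
      have h2 : θ m x = 1 := Real.smoothTransition.one_of_one_le (by linarith)
      rw [h2, one_mul]
  simp only [hzero] at hlim
  exact (tendsto_nhds_unique tendsto_const_nhds hlim).symm

/-- A bound `K` for the `L^2` norm of the trace of `f` on the flat boundary ball of radius 2, stated
by duality: the boundary term in Green's formula for `f` and a test function `φ` is at most
`K ‖φ‖`. In this form it is stable under products and derivatives without a trace having to be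
exhibited. -/
def TraceBound (f : EuclideanSpace ℝ (Fin (d + 1)) → ℝ) (K : ℝ) : Prop :=
  0 ≤ K ∧ ∀ φ : EuclideanSpace ℝ (Fin (d + 1)) → ℝ, ContDiff ℝ ∞ φ → HasCompactSupport φ →
    tsupport φ ⊆ Metric.ball 0 2 →
    |∫ x in halfBall d 3, (f x * pderiv (Fin.last d) φ x + dW (Fin.last d) f x * φ x)| ≤
      K * bdryNorm φ

theorem TraceBound.abs_integral_le {K : ℝ} (hK : TraceBound f K) (hf : MemH 1 f) (i : Fin (d + 1))
    {φ : EuclideanSpace ℝ (Fin (d + 1)) → ℝ} (hφ : ContDiff ℝ ∞ φ) (hc : HasCompactSupport φ)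
    (hs : tsupport φ ⊆ Metric.ball 0 2) :
    |∫ x in halfBall d 3, (f x * pderiv i φ x + dW i f x * φ x)| ≤ K * bdryNorm φ := by
  by_cases hi : i = Fin.last d
  · subst hi
    exact hK.2 φ hφ hc hs
  · rw [hf.integral_tangential hi hφ hc (hs.trans (Metric.ball_subset_ball (by norm_num))),
      abs_zero]
    exact mul_nonneg hK.1 (bdryNorm_nonneg φ)

end Green

section GreenSobolev

variable {d : ℕ} {k : ℕ} {f h : EuclideanSpace ℝ (Fin (d + 1)) → ℝ}

theorem exists_abs_le_of_hasCompactSupport {a : EuclideanSpace ℝ (Fin (d + 1)) → ℝ}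
    (ha : Continuous a) (hc : HasCompactSupport a) : ∃ S, 0 ≤ S ∧ ∀ x, |a x| ≤ S := by
  obtain ⟨S, hS⟩ := hc.exists_bound_of_continuous ha
  exact ⟨S, (norm_nonneg _).trans (hS 0), hS⟩

theorem integral_halfSpace_indicator (q : EuclideanSpace ℝ (Fin (d + 1)) → ℝ) :
    ∫ x in halfSpace d, (halfBall d 3).indicator q x = ∫ x in halfBall d 3, q x := by
  rw [setIntegral_indicator (measurableSet_halfBall 3)]
  congr 2
  exact Set.inter_eq_right.2 fun x hx => hx.2

/-- Multiplying by a cutoff and extending by zero turns a Sobolev function on the half ball into one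
on the half space. -/
theorem MemH.integral_indicator_cutoff (hf : MemH 1 f)
    {ζ φ : EuclideanSpace ℝ (Fin (d + 1)) → ℝ} (hζ : ContDiff ℝ ∞ ζ)
    (hζs : tsupport ζ ⊆ Metric.ball 0 3) (i : Fin (d + 1))
    (hφ : ContDiff ℝ ∞ φ) (hc : HasCompactSupport φ) (hs : tsupport φ ⊆ halfSpace d) :
    ∫ x, (halfBall d 3).indicator (fun x => ζ x * f x) x * pderiv i φ x =
      - ∫ x, (halfBall d 3).indicator (fun x => pderiv i ζ x * f x + ζ x * dW i f x) x * φ x := by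
  have hs' : tsupport (fun x => ζ x * φ x) ⊆ halfBall d 3 := fun x hx =>
    ⟨by simpa using hζs (tsupport_mul_subset_left hx), hs (tsupport_mul_subset_right hx)⟩
  have h1 := (hf.hasWeakPartial i).2.2 _ (hζ.mul hφ) hc.mul_left hs'
  simp only [pderiv_mul hζ hφ] at h1
  have e : ∀ q p : EuclideanSpace ℝ (Fin (d + 1)) → ℝ,
      ∫ x, (halfBall d 3).indicator q x * p x = ∫ x in halfBall d 3, q x * p x := by
    intro q p
    rw [← integral_indicator (measurableSet_halfBall 3)]
    simp only [Set.indicator_mul_left]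
  rw [e, e]
  have hle : ∀ {a b : EuclideanSpace ℝ (Fin (d + 1)) → ℝ}, tsupport a ⊆ Metric.ball 0 3 →
      tsupport (fun x => a x * b x) ⊆ Metric.ball 0 3 := fun ha =>
    (tsupport_mul_subset_left).trans ha
  have hζ's := (tsupport_pderiv_subset i).trans hζs
  have i1 := hf.integrable_cutoff_mul
    ((contDiff_pderiv hζ i).mul hφ).continuous (hle (b := φ) hζ's)
  have i2 := hf.integrable_cutoff_mul
    (hζ.mul (contDiff_pderiv hφ i)).continuous (hle (b := pderiv i φ) hζs)
  have i3 := (hf.deriv i).integrable_cutoff_mul (hζ.mul hφ).continuous (hle (b := φ) hζs)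
  have e1 : ∫ x in halfBall d 3, f x * (pderiv i ζ x * φ x + ζ x * pderiv i φ x) =
      (∫ x in halfBall d 3, pderiv i ζ x * φ x * f x) +
        ∫ x in halfBall d 3, ζ x * pderiv i φ x * f x := by
    rw [← integral_add i1 i2]; congr 1; funext x; ring
  have e2 : ∫ x in halfBall d 3, (pderiv i ζ x * f x + ζ x * dW i f x) * φ x =
      (∫ x in halfBall d 3, pderiv i ζ x * φ x * f x) +
        ∫ x in halfBall d 3, ζ x * φ x * dW i f x := by
    rw [← integral_add i1 i3]; congr 1; funext x; ring
  have e3 : ∫ x in halfBall d 3, dW i f x * (ζ x * φ x) =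
      ∫ x in halfBall d 3, ζ x * φ x * dW i f x := by
    congr 1; funext x; ring
  have e4 : ∫ x in halfBall d 3, ζ x * f x * pderiv i φ x =
      ∫ x in halfBall d 3, ζ x * pderiv i φ x * f x := by
    congr 1; funext x; ring
  rw [e1, e3] at h1
  rw [e2, e4]
  linarith

theorem memLp_indicator_cutoff (hf : MemH k f) {ζ : EuclideanSpace ℝ (Fin (d + 1)) → ℝ}
    (hζ : Continuous ζ) (hζs : tsupport ζ ⊆ Metric.ball 0 3) :
    MemLp ((halfBall d 3).indicator fun x => ζ x * f x) 2 volume :=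
  (memLp_indicator_iff_restrict (measurableSet_halfBall 3)).2 (hf.memLp_cutoff_mul hζ hζs)

theorem memLp_indicator_cutoff_deriv (hf : MemH 1 f) {ζ : EuclideanSpace ℝ (Fin (d + 1)) → ℝ}
    (hζ : ContDiff ℝ ∞ ζ) (hζs : tsupport ζ ⊆ Metric.ball 0 3) (i : Fin (d + 1)) :
    MemLp ((halfBall d 3).indicator fun x => pderiv i ζ x * f x + ζ x * dW i f x) 2 volume :=
  (memLp_indicator_iff_restrict (measurableSet_halfBall 3)).2
    ((hf.memLp_cutoff_mul (contDiff_pderiv hζ i).continuous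
      ((tsupport_pderiv_subset i).trans hζs)).add
      ((hf.deriv i).memLp_cutoff_mul hζ.continuous hζs))

theorem TraceBound.abs_integral_cutoff_le {K : ℝ} (hK : TraceBound f K) (hf : MemH 1 f)
    {ζ φ : EuclideanSpace ℝ (Fin (d + 1)) → ℝ} (hζ : ContDiff ℝ ∞ ζ)
    (hζs : tsupport ζ ⊆ Metric.ball 0 2) {S : ℝ} (hS0 : 0 ≤ S) (hS : ∀ x, |ζ x| ≤ S)
    (i : Fin (d + 1)) (hφ : ContDiff ℝ ∞ φ) (hc : HasCompactSupport φ) :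
    |∫ x in halfSpace d, ((halfBall d 3).indicator (fun x => ζ x * f x) x * pderiv i φ x +
      (halfBall d 3).indicator (fun x => pderiv i ζ x * f x + ζ x * dW i f x) x * φ x)| ≤
      (K * S) * bdryNorm φ := by
  have e : ∀ x, (halfBall d 3).indicator (fun x => ζ x * f x) x * pderiv i φ x +
      (halfBall d 3).indicator (fun x => pderiv i ζ x * f x + ζ x * dW i f x) x * φ x =
      (halfBall d 3).indicator (fun x => f x * pderiv i (fun z => ζ z * φ z) x +
        dW i f x * (ζ x * φ x)) x := by
    intro x
    by_cases hx : x ∈ halfBall d 3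
    · simp only [Set.indicator_of_mem hx, pderiv_mul hζ hφ]; ring
    · simp [Set.indicator_of_notMem hx]
  simp only [e]
  rw [integral_halfSpace_indicator]
  refine (hK.abs_integral_le hf i (hζ.mul hφ) hc.mul_left
    ((tsupport_mul_subset_left).trans hζs)).trans ?_
  rw [mul_assoc]
  exact mul_le_mul_of_nonneg_left
    (bdryNorm_mul_le hφ.continuous hc hζ.continuous (fun x _ => hS x) hS0) hK.1

/-- Green's formula for the product of two Sobolev functions with a cutoff, with the boundary term
estimated by the trace norms. -/
theorem green_inequality {ζ : EuclideanSpace ℝ (Fin (d + 1)) → ℝ} (hζ : ContDiff ℝ ∞ ζ)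
    (hζs : tsupport ζ ⊆ Metric.ball 0 2) :
    ∃ C, 0 ≤ C ∧ ∀ (f h : EuclideanSpace ℝ (Fin (d + 1)) → ℝ) (Kf Kh : ℝ), MemH 1 f → MemH 1 h →
      TraceBound f Kf → TraceBound h Kh → ∀ i,
      |∫ x in halfBall d 3, (ζ x * (dW i f x * h x + f x * dW i h x) + pderiv i ζ x * (f x * h x))|
        ≤ C * (Kf * Kh) := by
  obtain ⟨r₀, hr₀, hζr₀⟩ := exists_lt_subset_ball (isClosed_tsupport ζ) hζs
  set r := max r₀ 1 with hr
  have hr2 : r < 2 := max_lt hr₀ (by norm_num)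
  have hr1 : 1 ≤ r := le_max_right _ _
  have hζr : tsupport ζ ⊆ Metric.ball 0 r := hζr₀.trans (Metric.ball_subset_ball (le_max_left _ _))
  have hζc : HasCompactSupport ζ := (isCompact_closedBall 0 2).of_isClosed_subset
    (isClosed_tsupport _) (hζs.trans Metric.ball_subset_closedBall)
  -- a second cutoff, equal to one on the support of the first
  let χ : ContDiffBump (0 : EuclideanSpace ℝ (Fin (d + 1))) :=
    ⟨r, (r + 2) / 2, by linarith, by linarith⟩
  have hχ : ContDiff ℝ ∞ χ := χ.contDiff
  have hχs : tsupport χ ⊆ Metric.ball 0 2 := by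
    rw [χ.tsupport_eq]
    exact Metric.closedBall_subset_ball (by change (r + 2) / 2 < 2; linarith)
  have h23 : Metric.ball (0 : EuclideanSpace ℝ (Fin (d + 1))) 2 ⊆ Metric.ball 0 3 :=
    Metric.ball_subset_ball (by norm_num)
  obtain ⟨S, hS0, hS⟩ := exists_abs_le_of_hasCompactSupport hζ.continuous hζc
  have hχ1 : ∀ x, |χ x| ≤ 1 := fun x => by
    rw [abs_of_nonneg χ.nonneg]; exact χ.le_one
  have hχe : ∀ x ∈ Metric.ball (0 : EuclideanSpace ℝ (Fin (d + 1))) r, χ x = 1 := fun x hx =>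
    χ.one_of_mem_closedBall (Metric.ball_subset_closedBall hx)
  have hχd : ∀ i, ∀ x ∈ Metric.ball (0 : EuclideanSpace ℝ (Fin (d + 1))) r, pderiv i χ x = 0 := by
    intro i x hx
    have : (χ : EuclideanSpace ℝ (Fin (d + 1)) → ℝ) =ᶠ[𝓝 x] fun _ => 1 := by
      filter_upwards [Metric.isOpen_ball.mem_nhds hx] with z hz using hχe z hz
    unfold pderiv
    rw [this.fderiv_eq]
    simp
  refine ⟨S, hS0, fun f h Kf Kh hf hh hKf hKh i => ?_⟩
  have h1 := abs_integral_halfSpace_le (r := (r + 2) / 2) (R := 2)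
    (memLp_indicator_cutoff hf hζ.continuous (hζs.trans h23))
    (memLp_indicator_cutoff_deriv hf hζ (hζs.trans h23))
    (memLp_indicator_cutoff hh hχ.continuous (hχs.trans h23))
    (memLp_indicator_cutoff_deriv hh hχ (hχs.trans h23)) (by linarith)
    (fun x hx => by
      by_cases hxU : x ∈ halfBall d 3
      · rw [Set.indicator_of_mem hxU, χ.zero_of_le_dist (by simpa using hx), zero_mul]
      · rw [Set.indicator_of_notMem hxU])
    (fun i φ a b c => hh.integral_indicator_cutoff hχ (hχs.trans h23) i a b c)
    (mul_nonneg hKf.1 hS0) (mul_nonneg hKh.1 zero_le_one)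
    (fun i φ a b _ => hKf.abs_integral_cutoff_le hf hζ hζs hS0 hS i a b)
    (fun i φ a b _ => hKh.abs_integral_cutoff_le hh hχ hχs zero_le_one hχ1 i a b) i
  have e : ∀ x, (halfBall d 3).indicator (fun x => ζ x * f x) x *
      (halfBall d 3).indicator (fun x => pderiv i χ x * h x + χ x * dW i h x) x +
      (halfBall d 3).indicator (fun x => pderiv i ζ x * f x + ζ x * dW i f x) x *
      (halfBall d 3).indicator (fun x => χ x * h x) x =
      (halfBall d 3).indicator (fun x =>
        ζ x * (dW i f x * h x + f x * dW i h x) + pderiv i ζ x * (f x * h x)) x := by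
    intro x
    by_cases hx : x ∈ halfBall d 3
    · simp only [Set.indicator_of_mem hx]
      by_cases hxr : x ∈ Metric.ball (0 : EuclideanSpace ℝ (Fin (d + 1))) r
      · rw [hχe x hxr, hχd i x hxr]; ring
      · have z1 : ζ x = 0 := image_eq_zero_of_notMem_tsupport fun hh => hxr (hζr hh)
        have z2 : pderiv i ζ x = 0 :=
          image_eq_zero_of_notMem_tsupport fun hh => hxr (hζr (tsupport_pderiv_subset i hh))
        rw [z1, z2]; ring
    · simp [Set.indicator_of_notMem hx]
  simp only [e] at h1
  rw [integral_halfSpace_indicator] at h1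
  refine h1.trans (le_of_eq ?_)
  ring

end GreenSobolev

/-! ### Functions with square integrable traces -/

section TraceAlgebra

variable {d : ℕ} {k : ℕ} {f h : EuclideanSpace ℝ (Fin (d + 1)) → ℝ}

theorem TraceBound.congr {K : ℝ} (hK : TraceBound f K) (hfh : f =ᵐ[hbMeasure d] h) :
    TraceBound h K := by
  refine ⟨hK.1, fun φ a b c => ?_⟩
  rw [← dW_ae_eq_of_ae_eq hfh]
  refine (le_of_eq ?_).trans (hK.2 φ a b c)
  congr 1
  refine integral_congr_ae ?_
  filter_upwards [hfh] with x hx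
  rw [hx]

theorem TraceBound.mono {K K' : ℝ} (hK : TraceBound f K) (h : K ≤ K') : TraceBound f K' :=
  ⟨hK.1.trans h, fun φ a b c => (hK.2 φ a b c).trans
    (mul_le_mul_of_nonneg_right h (bdryNorm_nonneg φ))⟩

theorem traceBound_zero {K : ℝ} (hK : 0 ≤ K) :
    TraceBound (fun _ : EuclideanSpace ℝ (Fin (d + 1)) => (0 : ℝ)) K := by
  refine ⟨hK, fun φ _ _ _ => ?_⟩
  have h0 := (hasWeakPartial_zero (U := halfBall d 3) (i := Fin.last d)).weakPartial_ae_eq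
    (isOpen_halfBall 3)
  have : ∫ x in halfBall d 3, ((0 : ℝ) * pderiv (Fin.last d) φ x +
      dW (Fin.last d) (fun _ => 0) x * φ x) = 0 := by
    refine integral_eq_zero_of_ae ?_
    filter_upwards [h0] with x hx
    simp [hx]
  rw [this, abs_zero]
  exact mul_nonneg hK (bdryNorm_nonneg φ)

theorem MemH.integrable_trace (hf : MemH 1 f) {φ : EuclideanSpace ℝ (Fin (d + 1)) → ℝ}
    (hφ : ContDiff ℝ ∞ φ) (hs : tsupport φ ⊆ Metric.ball 0 2) (i : Fin (d + 1)) :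
    Integrable (fun x => f x * pderiv i φ x + dW i f x * φ x) (hbMeasure d) := by
  have hs3 := hs.trans (Metric.ball_subset_ball (by norm_num : (2 : ℝ) ≤ 3))
  refine ((hf.integrable_cutoff_mul (contDiff_pderiv hφ i).continuous
    ((tsupport_pderiv_subset i).trans hs3)).add
    ((hf.deriv i).integrable_cutoff_mul hφ.continuous hs3)).congr (ae_of_all _ fun x => ?_)
  simp only [Pi.add_apply]; ring

theorem TraceBound.add {K K' : ℝ} (hf : MemH 1 f) (hh : MemH 1 h) (hK : TraceBound f K)
    (hK' : TraceBound h K') : TraceBound (fun x => f x + h x) (K + K') := by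
  refine ⟨add_nonneg hK.1 hK'.1, fun φ a b c => ?_⟩
  have e : ∫ x in halfBall d 3, ((f x + h x) * pderiv (Fin.last d) φ x +
      dW (Fin.last d) (fun x => f x + h x) x * φ x) =
      (∫ x in halfBall d 3, (f x * pderiv (Fin.last d) φ x + dW (Fin.last d) f x * φ x)) +
      ∫ x in halfBall d 3, (h x * pderiv (Fin.last d) φ x + dW (Fin.last d) h x * φ x) := by
    rw [← integral_add (hf.integrable_trace a c _) (hh.integrable_trace a c _)]
    refine integral_congr_ae ?_
    filter_upwards [dW_add hf hh (Fin.last d)] with x hx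
    rw [hx]; ring
  rw [e, add_mul]
  exact (abs_add_le _ _).trans (add_le_add (hK.2 φ a b c) (hK'.2 φ a b c))

theorem TraceBound.smooth_mul {a : EuclideanSpace ℝ (Fin (d + 1)) → ℝ} (ha : ContDiff ℝ ∞ a)
    {S : ℝ} (hS0 : 0 ≤ S) (hS : ∀ x ∈ Metric.ball 0 2, |a x| ≤ S) {K : ℝ} (hf : MemH 1 f)
    (hK : TraceBound f K) : TraceBound (fun x => a x * f x) (S * K) := by
  refine ⟨mul_nonneg hS0 hK.1, fun φ hφ hc hs => ?_⟩
  have e : ∫ x in halfBall d 3, (a x * f x * pderiv (Fin.last d) φ x +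
      dW (Fin.last d) (fun x => a x * f x) x * φ x) =
      ∫ x in halfBall d 3, (f x * pderiv (Fin.last d) (fun z => a z * φ z) x +
        dW (Fin.last d) f x * (a x * φ x)) := by
    refine integral_congr_ae ?_
    filter_upwards [dW_smooth_mul ha hf (Fin.last d)] with x hx
    rw [hx, pderiv_mul ha hφ]; ring
  rw [e]
  refine (hK.2 _ (ha.mul hφ) hc.mul_left ((tsupport_mul_subset_right).trans hs)).trans ?_
  rw [mul_comm S K, mul_assoc]
  refine mul_le_mul_of_nonneg_left (bdryNorm_mul_le hφ.continuous hc ha.continuous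
    (fun x hx => hS x (hs (subset_tsupport _ hx))) hS0) hK.1

end TraceAlgebra

section TraceScale

variable {d : ℕ} {I : Set (Fin (d + 1))}

/-- Trace bounds for all derivatives of order at most `k` in the directions belonging to `I`. -/
def TraceBoundH (I : Set (Fin (d + 1))) :
    ℕ → (EuclideanSpace ℝ (Fin (d + 1)) → ℝ) → ℝ → Prop
  | 0, f, K => TraceBound f K
  | k + 1, f, K => TraceBound f K ∧ ∀ i ∈ I, TraceBoundH I k (dW i f) K

theorem TraceBoundH.traceBound : ∀ {k : ℕ} {f : EuclideanSpace ℝ (Fin (d + 1)) → ℝ} {K : ℝ},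
    TraceBoundH I k f K → TraceBound f K
  | 0, _, _, h => h
  | _ + 1, _, _, h => h.1

theorem TraceBoundH.congr : ∀ {k : ℕ} {f h : EuclideanSpace ℝ (Fin (d + 1)) → ℝ} {K : ℝ},
    TraceBoundH I k f K → f =ᵐ[hbMeasure d] h → TraceBoundH I k h K
  | 0, _, _, _, hK, hfh => TraceBound.congr hK hfh
  | _ + 1, _, _, _, hK, hfh => ⟨hK.1.congr hfh, fun i hi => by
      rw [← dW_ae_eq_of_ae_eq hfh]; exact hK.2 i hi⟩

theorem TraceBoundH.mono : ∀ {k : ℕ} {f : EuclideanSpace ℝ (Fin (d + 1)) → ℝ} {K K' : ℝ},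
    TraceBoundH I k f K → K ≤ K' → TraceBoundH I k f K'
  | 0, _, _, _, hK, h => TraceBound.mono hK h
  | _ + 1, _, _, _, hK, h => ⟨hK.1.mono h, fun i hi => (hK.2 i hi).mono h⟩

theorem TraceBoundH.pred : ∀ {k : ℕ} {f : EuclideanSpace ℝ (Fin (d + 1)) → ℝ} {K : ℝ},
    TraceBoundH I (k + 1) f K → TraceBoundH I k f K
  | 0, _, _, h => h.1
  | _ + 1, _, _, h => ⟨h.1, fun i hi => (h.2 i hi).pred⟩

theorem traceBoundH_zero : ∀ {k : ℕ} {K : ℝ}, 0 ≤ K →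
    TraceBoundH I k (fun _ : EuclideanSpace ℝ (Fin (d + 1)) => (0 : ℝ)) K
  | 0, _, h => traceBound_zero h
  | _ + 1, _, h => ⟨traceBound_zero h, fun _ _ => (traceBoundH_zero h).congr
      (hasWeakPartial_zero.weakPartial_ae_eq (isOpen_halfBall 3)).symm⟩

theorem TraceBoundH.add : ∀ {k : ℕ} {f h : EuclideanSpace ℝ (Fin (d + 1)) → ℝ} {K K' : ℝ},
    MemH (k + 1) f → MemH (k + 1) h → TraceBoundH I k f K → TraceBoundH I k h K' →
    TraceBoundH I k (fun x => f x + h x) (K + K')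
  | 0, _, _, _, _, hf, hh, hK, hK' => TraceBound.add hf hh hK hK'
  | k + 1, _, _, _, _, hf, hh, hK, hK' =>
    ⟨TraceBound.add (hf.mono (by omega)) (hh.mono (by omega)) hK.1 hK'.1, fun i hi =>
      ((hK.2 i hi).add (hf.deriv i) (hh.deriv i) (hK'.2 i hi)).congr
        (dW_add (hf.mono (by omega)) (hh.mono (by omega)) i).symm⟩

theorem TraceBoundH.sum {k : ℕ} {ι : Type*} (s : Finset ι)
    {F : ι → EuclideanSpace ℝ (Fin (d + 1)) → ℝ} {K : ι → ℝ}
    (hF : ∀ m ∈ s, MemH (k + 1) (F m)) (hK : ∀ m ∈ s, TraceBoundH I k (F m) (K m)) :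
    TraceBoundH I k (fun x => ∑ m ∈ s, F m x) (∑ m ∈ s, K m) := by
  classical
  induction s using Finset.induction_on with
  | empty => simpa using traceBoundH_zero le_rfl
  | insert m s hm ih =>
    simp only [Finset.sum_insert hm]
    exact (hK m (by simp)).add (hF m (by simp)) (MemH.sum s fun l hl => hF l (by simp [hl]))
      (ih (fun l hl => hF l (by simp [hl])) fun l hl => hK l (by simp [hl]))

theorem exists_bound_ball_two {a : EuclideanSpace ℝ (Fin (d + 1)) → ℝ} (ha : Continuous a) :
    ∃ S, 0 ≤ S ∧ ∀ x ∈ Metric.ball 0 2, |a x| ≤ S := by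
  obtain ⟨S, hS⟩ := (isCompact_closedBall (0 : EuclideanSpace ℝ (Fin (d + 1)))
    2).exists_bound_of_continuousOn ha.continuousOn
  exact ⟨S, (norm_nonneg _).trans (hS 0 (by simp)),
    fun x hx => hS x (Metric.ball_subset_closedBall hx)⟩

theorem exists_traceBoundH_smooth_mul (I : Set (Fin (d + 1))) (k : ℕ) :
    ∀ {a : EuclideanSpace ℝ (Fin (d + 1)) → ℝ}, ContDiff ℝ ∞ a →
    ∃ C, 0 ≤ C ∧ ∀ (f : EuclideanSpace ℝ (Fin (d + 1)) → ℝ) (K : ℝ), MemH (k + 1) f →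
      TraceBoundH I k f K → TraceBoundH I k (fun x => a x * f x) (C * K) := by
  induction k with
  | zero =>
    intro a ha
    obtain ⟨S, hS0, hS⟩ := exists_bound_ball_two ha.continuous
    exact ⟨S, hS0, fun f K hf hK => TraceBound.smooth_mul ha hS0 hS hf hK⟩
  | succ k ih =>
    intro a ha
    obtain ⟨S, hS0, hS⟩ := exists_bound_ball_two ha.continuous
    obtain ⟨C, hC0, hC⟩ := ih ha
    choose C' hC0' hC' using fun i : Fin (d + 1) => ih (contDiff_pderiv ha i)
    have hsum : 0 ≤ ∑ i, C' i := Finset.sum_nonneg fun i _ => hC0' i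
    refine ⟨S + (∑ i, C' i + C), by positivity, fun f K hf hK => ?_⟩
    have hK0 : 0 ≤ K := hK.1.1
    constructor
    · refine (TraceBound.smooth_mul ha hS0 hS (hf.mono (by omega)) hK.1).mono ?_
      exact mul_le_mul_of_nonneg_right (by linarith) hK0
    · intro i hi
      have h1 := hC' i f K hf.pred hK.pred
      have h2 := hC (dW i f) K (hf.deriv i) (hK.2 i hi)
      have h3 := (h1.add (MemH.smooth_mul (contDiff_pderiv ha i) hf.pred)
        (MemH.smooth_mul ha (hf.deriv i)) h2).congr (dW_smooth_mul ha (hf.mono (by omega)) i).symm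
      refine h3.mono ?_
      rw [← add_mul]
      refine mul_le_mul_of_nonneg_right ?_ hK0
      have := Finset.single_le_sum (f := C') (fun j _ => hC0' j) (Finset.mem_univ i)
      linarith

/-- Trace bounds pass to linear combinations with smooth coefficients. -/
theorem exists_traceBoundH_sum_smooth_mul (I : Set (Fin (d + 1))) (k : ℕ) {ι : Type*}
    (s : Finset ι) {a : ι → EuclideanSpace ℝ (Fin (d + 1)) → ℝ} (ha : ∀ m, ContDiff ℝ ∞ (a m)) :
    ∃ C, 0 ≤ C ∧ ∀ (F : ι → EuclideanSpace ℝ (Fin (d + 1)) → ℝ) (K : ℝ),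
      (∀ m ∈ s, MemH (k + 1) (F m)) → (∀ m ∈ s, TraceBoundH I k (F m) K) →
      TraceBoundH I k (fun x => ∑ m ∈ s, a m x * F m x) (C * K) := by
  choose C hC0 hC using fun m => exists_traceBoundH_smooth_mul I k (ha m)
  refine ⟨∑ m ∈ s, C m, Finset.sum_nonneg fun m _ => hC0 m, fun F K hF hK => ?_⟩
  rw [Finset.sum_mul]
  exact TraceBoundH.sum s (fun m hm => MemH.smooth_mul (ha m) (hF m hm))
    fun m hm => hC m (F m) K (hF m hm) (hK m hm)

/-- The tangential directions. -/
def tang (d : ℕ) : Set (Fin (d + 1)) := {i | i ≠ Fin.last d}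

/-- Tangential derivatives of the trace of `f` and all derivatives of the trace of a transversal
derivative `N f` together control all derivatives of `f` on the boundary. -/
theorem exists_traceBoundH_of_transversal
    {ν : Fin (d + 1) → EuclideanSpace ℝ (Fin (d + 1)) → ℝ} (hν : ∀ i, ContDiff ℝ ∞ (ν i))
    {c : EuclideanSpace ℝ (Fin (d + 1)) → ℝ} (hc : ContDiff ℝ ∞ c)
    (hcν : ∀ x ∈ halfBall d 3, c x * ν (Fin.last d) x = 1) (m : ℕ) :
    ∃ C, 0 ≤ C ∧ ∀ (f : EuclideanSpace ℝ (Fin (d + 1)) → ℝ) (K : ℝ), MemH (m + 2) f →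
      TraceBoundH Set.univ m (fun x => ∑ i, ν i x * dW i f x) K →
      TraceBoundH (tang d) (m + 1) f K → TraceBoundH Set.univ (m + 1) f (C * K) := by
  have hmemN : ∀ {k : ℕ} {f : EuclideanSpace ℝ (Fin (d + 1)) → ℝ}, MemH (k + 1) f →
      MemH k (fun x => ∑ i, ν i x * dW i f x) := fun hf =>
    MemH.sum _ fun i _ => MemH.smooth_mul (hν i) (hf.deriv i)
  -- tangential first derivatives suffice
  have hred : ∀ m : ℕ, (∃ C, 0 ≤ C ∧ ∀ (f : EuclideanSpace ℝ (Fin (d + 1)) → ℝ) (K : ℝ),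
      MemH (m + 2) f → TraceBoundH Set.univ m (fun x => ∑ i, ν i x * dW i f x) K →
      TraceBoundH (tang d) (m + 1) f K → ∀ i ∈ tang d, TraceBoundH Set.univ m (dW i f) (C * K)) →
      ∃ C, 0 ≤ C ∧ ∀ (f : EuclideanSpace ℝ (Fin (d + 1)) → ℝ) (K : ℝ), MemH (m + 2) f →
      TraceBoundH Set.univ m (fun x => ∑ i, ν i x * dW i f x) K →
      TraceBoundH (tang d) (m + 1) f K → TraceBoundH Set.univ (m + 1) f (C * K) := by
    rintro m ⟨C, hC0, hC⟩
    obtain ⟨C₁, hC₁0, hC₁⟩ := exists_traceBoundH_smooth_mul (d := d) Set.univ m hc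
    obtain ⟨C₂, hC₂0, hC₂⟩ := exists_traceBoundH_sum_smooth_mul (d := d) Set.univ m
      (Finset.univ.erase (Fin.last d)) (a := fun i x => (-c x) * ν i x)
      (fun i => hc.neg.mul (hν i))
    refine ⟨1 + C + (C₁ + C₂ * C), by positivity, fun f K hf hN hT => ?_⟩
    have hK0 : 0 ≤ K := hT.1.1
    have htan := hC f K hf hN hT
    have hC20 := mul_nonneg hC₂0 hC0
    refine ⟨hT.1.mono (le_mul_of_one_le_left hK0 (by linarith)), fun i _ => ?_⟩
    by_cases hi : i = Fin.last d
    · subst hi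
      have h1 := hC₁ _ K (hmemN hf) hN
      have h2 := hC₂ (fun i => dW i f) (C * K) (fun i _ => hf.deriv i)
        (fun i hi => htan i (by simpa [tang] using hi))
      have h3 := h1.add (MemH.smooth_mul hc (hmemN hf))
        (MemH.sum _ fun i _ => MemH.smooth_mul (hc.neg.mul (hν i)) (hf.deriv i)) h2
      refine (h3.mono ?_).congr ?_
      · rw [← mul_assoc, ← add_mul]
        exact mul_le_mul_of_nonneg_right (by linarith) hK0
      · filter_upwards [ae_restrict_mem (measurableSet_halfBall 3)] with x hx
        rw [← Finset.add_sum_erase Finset.univ _ (Finset.mem_univ (Fin.last d)), mul_add,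
          ← mul_assoc, hcν x hx, Finset.mul_sum, add_assoc, ← Finset.sum_add_distrib, one_mul]
        simp only [neg_mul, mul_assoc, add_neg_cancel, Finset.sum_const_zero, add_zero]
    · exact (htan i hi).mono (mul_le_mul_of_nonneg_right (by linarith) hK0)
  induction m with
  | zero =>
    refine hred 0 ⟨1, zero_le_one, fun f K hf hN hT i hi => ?_⟩
    rw [one_mul]
    exact hT.2 i hi
  | succ m ih =>
    obtain ⟨C, hC0, hC⟩ := ih
    choose C' hC0' hC' using fun i : Fin (d + 1) =>
      exists_traceBoundH_sum_smooth_mul (d := d) Set.univ m Finset.univ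
        (a := fun j x => (-1) * pderiv i (ν j) x)
        (fun j => contDiff_const.mul (contDiff_pderiv (hν j) i))
    have hsum : 0 ≤ ∑ i, C' i := Finset.sum_nonneg fun i _ => hC0' i
    refine hred (m + 1) ⟨C * (1 + (∑ i, C' i) * C), by positivity, fun f K hf hN hT i hi => ?_⟩
    have hK0 : 0 ≤ K := hT.1.1
    have hfull : TraceBoundH Set.univ (m + 1) f (C * K) := hC f K hf.pred hN.pred hT.pred
    -- the commutator of `∂_i` and `N` is a first order operator applied to `f`
    have hcomm : TraceBoundH Set.univ m (fun x => ∑ j, ν j x * dW j (dW i f) x)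
        (K + C' i * (C * K)) := by
      have h1 := hN.2 i (Set.mem_univ i)
      have h2 := hC' i (fun j => dW j f) (C * K) (fun j _ => (hf.deriv j).pred)
        (fun j _ => hfull.2 j (Set.mem_univ j))
      refine (h1.add ((hmemN hf).deriv i) (MemH.sum _ fun j _ => MemH.smooth_mul
        (contDiff_const.mul (contDiff_pderiv (hν j) i)) (hf.deriv j).pred) h2).congr ?_
      have e1 := dW_sum Finset.univ (F := fun j x => ν j x * dW j f x)
        (fun j _ => MemH.smooth_mul (hν j) ((hf.deriv j).mono (by omega))) i
      have e2 : ∀ᵐ x ∂hbMeasure d, ∀ j, dW i (fun x => ν j x * dW j f x) x =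
          pderiv i (ν j) x * dW j f x + ν j x * dW i (dW j f) x :=
        ae_all_iff.2 fun j => dW_smooth_mul (hν j) ((hf.deriv j).mono (by omega)) i
      have e3 : ∀ᵐ x ∂hbMeasure d, ∀ j, dW i (dW j f) x = dW j (dW i f) x :=
        ae_all_iff.2 fun j => dW_comm (hf.mono (by omega)) i j
      filter_upwards [e1, e2, e3] with x h1 h2 h3
      rw [h1, ← Finset.sum_add_distrib]
      refine Finset.sum_congr rfl fun j _ => ?_
      rw [h2 j, h3 j]; ring
    have hle : C' i ≤ ∑ i, C' i :=
      Finset.single_le_sum (f := C') (fun j _ => hC0' j) (Finset.mem_univ i)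
    have hKle : K ≤ (1 + (∑ i, C' i) * C) * K := by
      nlinarith [mul_nonneg (mul_nonneg hsum hC0) hK0]
    have hfin := hC (dW i f) ((1 + (∑ i, C' i) * C) * K) (hf.deriv i)
      (hcomm.mono (by nlinarith [mul_le_mul_of_nonneg_right hle (mul_nonneg hC0 hK0)]))
      ((hT.2 i hi).mono hKle)
    rw [mul_assoc]
    exact hfin

end TraceScale

/-! ### Traces in Sobolev spaces of the boundary -/

theorem abs_integral_mul_le {α : Type*} [MeasurableSpace α] {ν : Measure α} {A B : α → ℝ}
    (hA : MemLp A 2 ν) (hB : MemLp B 2 ν) :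
    |∫ x, A x * B x ∂ν| ≤ (eLpNorm A 2 ν).toReal * (eLpNorm B 2 ν).toReal := by
  have key : inner ℝ (hA.toLp A) (hB.toLp B) = ∫ x, A x * B x ∂ν := by
    rw [L2.inner_def]
    apply integral_congr_ae
    filter_upwards [hA.coeFn_toLp, hB.coeFn_toLp] with x h1 h2
    rw [h1, h2]
    simp [mul_comm]
  have h1 := abs_real_inner_le_norm (hA.toLp A) (hB.toLp B)
  rwa [key, Lp.norm_toLp, Lp.norm_toLp] at h1

section TraceSobolev

variable {d : ℕ}

/-- The trace of `f` on the flat boundary ball of radius 2 is `b`, as seen by test functions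
supported in the full ball of radius 2. -/
def HasTraceOn (f : EuclideanSpace ℝ (Fin (d + 1)) → ℝ) (b : EuclideanSpace ℝ (Fin d) → ℝ) : Prop :=
  ∀ φ : EuclideanSpace ℝ (Fin (d + 1)) → ℝ, ContDiff ℝ ∞ φ → HasCompactSupport φ →
    tsupport φ ⊆ Metric.ball 0 2 →
    ∫ x in halfBall d 3, (f x * pderiv (Fin.last d) φ x + dW (Fin.last d) f x * φ x) =
      - ∫ y in Metric.ball (0 : EuclideanSpace ℝ (Fin d)) 2, b y * φ (bdryPt y)

theorem tsupport_comp_bdryPt_subset {φ : EuclideanSpace ℝ (Fin (d + 1)) → ℝ} {r : ℝ}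
    (hs : tsupport φ ⊆ Metric.ball 0 r) :
    tsupport (fun y : EuclideanSpace ℝ (Fin d) => φ (bdryPt y)) ⊆ Metric.ball 0 r := by
  intro y hy
  have h1 : bdryPt y ∈ tsupport φ :=
    tsupport_comp_subset_preimage φ continuous_bdryPt hy
  have h2 := hs h1
  rwa [mem_ball_zero_iff, norm_bdryPt, ← mem_ball_zero_iff] at h2

variable {f : EuclideanSpace ℝ (Fin (d + 1)) → ℝ} {b b' : EuclideanSpace ℝ (Fin d) → ℝ}

theorem IsTrace.hasTraceOn (hb : IsTrace d 3 f b) : HasTraceOn f b := by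
  obtain ⟨f', hw, -, hgreen⟩ := hb
  intro φ hφ hc hs
  have h1 := hgreen φ hφ hc (hs.trans (Metric.ball_subset_ball (by norm_num)))
  have h2 : ∫ x in halfBall d 3, (f x * pderiv (Fin.last d) φ x + dW (Fin.last d) f x * φ x) =
      ∫ x in halfBall d 3, (f x * pderiv (Fin.last d) φ x + f' x * φ x) := by
    refine integral_congr_ae ?_
    filter_upwards [hw.weakPartial_ae_eq (isOpen_halfBall 3)] with x hx
    simp only [dW, hx]
  rw [h2, h1]
  congr 1
  refine setIntegral_eq_of_subset_of_forall_sdiff_eq_zero measurableSet_ball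
    (Metric.ball_subset_ball (by norm_num)) fun y hy => ?_
  rw [image_eq_zero_of_notMem_tsupport (f := fun y => φ (bdryPt y))
    (fun h => hy.2 (tsupport_comp_bdryPt_subset hs h)), mul_zero]

/-- The tangential derivatives of the trace are the traces of the tangential derivatives. -/
theorem HasTraceOn.tangential (hb : HasTraceOn f b) (hf : MemH 2 f) {j : Fin d}
    (hw : HasWeakPartial (Metric.ball 0 2) j b b') : HasTraceOn (dW j.castSucc f) b' := by
  intro φ hφ hc hs
  set i : Fin (d + 1) := j.castSucc with hi
  have hil : i ≠ Fin.last d := (Fin.castSucc_lt_last j).ne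
  have hs3 := hs.trans (Metric.ball_subset_ball (by norm_num : (2 : ℝ) ≤ 3))
  have hφi := contDiff_pderiv hφ i
  have hsi := (tsupport_pderiv_subset (φ := φ) i).trans hs
  have hφn := contDiff_pderiv hφ (Fin.last d)
  have hsn := (tsupport_pderiv_subset (φ := φ) (Fin.last d)).trans hs
  have hcn := hasCompactSupport_pderiv hc (Fin.last d)
  have h23 := Metric.ball_subset_ball (x := (0 : EuclideanSpace ℝ (Fin (d + 1))))
    (by norm_num : (2 : ℝ) ≤ 3)
  have h1 := hb (pderiv i φ) hφi (hasCompactSupport_pderiv hc i) hsi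
  have t1 := (hf.mono one_le_two).integral_tangential hil hφn hcn (hsn.trans h23)
  have t2 := (hf.deriv (Fin.last d)).integral_tangential hil hφ hc hs3
  have i1 := (hf.mono one_le_two).integrable_trace hφi hsi (Fin.last d)
  have i2 := (hf.mono one_le_two).integrable_trace hφn hsn i
  have i3 := (hf.deriv (Fin.last d)).integrable_trace hφ hs i
  have key : ∫ x in halfBall d 3, (dW i f x * pderiv (Fin.last d) φ x +
      dW (Fin.last d) (dW i f) x * φ x) =
      (∫ x in halfBall d 3, (f x * pderiv i (pderiv (Fin.last d) φ) x +
        dW i f x * pderiv (Fin.last d) φ x)) +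
      (∫ x in halfBall d 3, (dW (Fin.last d) f x * pderiv i φ x +
        dW i (dW (Fin.last d) f) x * φ x)) -
      ∫ x in halfBall d 3, (f x * pderiv (Fin.last d) (pderiv i φ) x +
        dW (Fin.last d) f x * pderiv i φ x) := by
    have h0 := integral_sub (i2.add i3) i1
    simp only [Pi.add_apply] at h0
    rw [← integral_add i2 i3, ← h0]
    refine integral_congr_ae ?_
    filter_upwards [dW_comm hf i (Fin.last d)] with x hx
    rw [← hx, pderiv_comm hφ i (Fin.last d)]; ring
  rw [key, t1, t2, h1]
  have hbd : ∀ y : EuclideanSpace ℝ (Fin d),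
      pderiv j (fun y => φ (bdryPt y)) y = pderiv i φ (bdryPt y) := by
    intro y
    have hlin : ∃ L : EuclideanSpace ℝ (Fin d) →L[ℝ] EuclideanSpace ℝ (Fin (d + 1)),
        ∀ z, L z = bdryPt z := by
      refine ⟨LinearMap.toContinuousLinearMap
        { toFun := bdryPt, map_add' := fun x y => ?_, map_smul' := fun c x => ?_ }, fun z => rfl⟩
      · ext m
        refine Fin.lastCases ?_ (fun m => ?_) m <;> simp [bdryPt]
      · ext m
        refine Fin.lastCases ?_ (fun m => ?_) m <;> simp [bdryPt]
    obtain ⟨L, hL⟩ := hlin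
    have e : (fun y => φ (bdryPt y)) = φ ∘ L := by funext z; simp [hL]
    unfold pderiv
    rw [e, fderiv_comp y (hφ.differentiable (by simp) _) L.differentiableAt]
    simp only [L.fderiv, ContinuousLinearMap.comp_apply, hL]
    congr 1
    ext m
    refine Fin.lastCases ?_ (fun m => ?_) m
    · simp [bdryPt, hi, (Fin.castSucc_lt_last j).ne']
    · simp [bdryPt, hi]
  have hcb : ContDiff ℝ ∞ fun y : EuclideanSpace ℝ (Fin d) => φ (bdryPt y) := by
    refine hφ.comp ?_
    rw [contDiff_euclidean]
    intro m
    refine Fin.lastCases ?_ (fun m => ?_) m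
    · simpa [bdryPt] using contDiff_const
    · simpa [bdryPt] using (EuclideanSpace.proj (𝕜 := ℝ) m).contDiff
  have h2 := hw.2.2 _ hcb (hasCompactSupport_comp_bdryPt hc) (tsupport_comp_bdryPt_subset hs)
  simp only [hbd] at h2
  rw [h2]; ring

theorem HasTraceOn.traceBound (hb : HasTraceOn f b)
    (hm : AEStronglyMeasurable b (volume.restrict (Metric.ball 0 2))) {K : ℝ} (hK : 0 ≤ K)
    (hn : ∫⁻ y in Metric.ball (0 : EuclideanSpace ℝ (Fin d)) 2, ‖b y‖ₑ ^ 2 ≤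
      ENNReal.ofReal (K ^ 2)) : TraceBound f K := by
  refine ⟨hK, fun φ hφ hc hs => ?_⟩
  rw [hb φ hφ hc hs, abs_neg]
  set ν : Measure (EuclideanSpace ℝ (Fin d)) := volume.restrict (Metric.ball 0 2)
  have hle : eLpNorm b 2 ν ≤ ENNReal.ofReal K := by
    rw [← eLpNorm_two_sq, ENNReal.ofReal_pow hK] at hn
    by_contra! hlt
    exact absurd hn (not_le.2 (ENNReal.pow_lt_pow_left two_ne_zero hlt))
  have hbL : MemLp b 2 ν := ⟨hm, hle.trans_lt ENNReal.ofReal_lt_top⟩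
  have hφL : MemLp (fun y : EuclideanSpace ℝ (Fin d) => φ (bdryPt y)) 2 volume :=
    (hφ.continuous.comp continuous_bdryPt).memLp_of_hasCompactSupport
      (hasCompactSupport_comp_bdryPt hc)
  have hφν := hφL.mono_measure (Measure.restrict_le_self : ν ≤ volume)
  refine (abs_integral_mul_le hbL hφν).trans ?_
  have h1 : (eLpNorm b 2 ν).toReal ≤ K := ENNReal.toReal_le_of_le_ofReal hK hle
  have h2 : (eLpNorm (fun y : EuclideanSpace ℝ (Fin d) => φ (bdryPt y)) 2 ν).toReal ≤
      bdryNorm φ := by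
    refine (ENNReal.toReal_mono hφL.2.ne
      (eLpNorm_mono_measure _ Measure.restrict_le_self)).trans (le_of_eq ?_)
    have h3 : (eLpNorm (fun y : EuclideanSpace ℝ (Fin d) => φ (bdryPt y)) 2 volume).toReal ^ 2 =
        ∫ y : EuclideanSpace ℝ (Fin d), φ (bdryPt y) ^ 2 := by
      rw [← ENNReal.toReal_pow, eLpNorm_two_sq,
        integral_eq_lintegral_of_nonneg_ae (ae_of_all _ fun y => sq_nonneg _)
          (integrable_sq_bdryPt hφ.continuous hc).1]
      congr 2
      funext y
      rw [Real.enorm_eq_ofReal_abs, ← ENNReal.ofReal_pow (abs_nonneg _), sq_abs]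
    unfold bdryNorm
    rw [← h3, Real.sqrt_sq ENNReal.toReal_nonneg]
  exact mul_le_mul h1 h2 ENNReal.toReal_nonneg hK

theorem HasTraceOn.traceBoundH {K : ℝ} (hK : 0 ≤ K) : ∀ {k : ℕ}
    {f : EuclideanSpace ℝ (Fin (d + 1)) → ℝ} {b : EuclideanSpace ℝ (Fin d) → ℝ},
    HasTraceOn f b → MemH (k + 1) f →
    AEStronglyMeasurable b (volume.restrict (Metric.ball 0 2)) →
    sobolevNormSq (Metric.ball 0 2) k b ≤ ENNReal.ofReal (K ^ 2) → TraceBoundH (tang d) k f K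
  | 0, _, _, hb, _, hm, hn => hb.traceBound hm hK hn
  | k + 1, f, b, hb, hf, hm, hn => by
    classical
    simp only [sobolevNormSq] at hn
    refine ⟨hb.traceBound hm hK (le_self_add.trans hn), fun i hi => ?_⟩
    obtain ⟨j, rfl⟩ := Fin.exists_castSucc_eq.2 hi
    have h1 := (Finset.single_le_sum (f := fun i : Fin d =>
      if ∃ f', HasWeakPartial (Metric.ball 0 2) i b f' then
        sobolevNormSq (Metric.ball 0 2) k (weakPartial (Metric.ball 0 2) i b) else ∞)
      (fun _ _ => zero_le) (Finset.mem_univ j)).trans (le_add_self.trans hn)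
    by_cases hex : ∃ f', HasWeakPartial (Metric.ball 0 2) j b f'
    · simp only [if_pos hex] at h1
      have hw := weakPartial_spec hex
      exact HasTraceOn.traceBoundH hK (hb.tangential (hf.mono (by omega)) hw) (hf.deriv _)
        hw.2.1.aestronglyMeasurable h1
    · simp only [if_neg hex] at h1
      exact absurd h1 (not_le.2 ENNReal.ofReal_lt_top)

/-- A bound for the Sobolev norm of the trace bounds the traces of the tangential derivatives. -/
theorem traceBoundH_of_bdrySobolevNorm_le {k : ℕ} {K : ℝ} (hK : 0 ≤ K) (hf : MemH (k + 1) f)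
    (hn : bdrySobolevNorm d 2 3 k f ≤ ENNReal.ofReal K) : TraceBoundH (tang d) k f K := by
  unfold bdrySobolevNorm at hn
  split_ifs at hn with hex
  · have hb := hex.choose_spec
    set b := hex.choose
    have hm : AEStronglyMeasurable b (volume.restrict (Metric.ball 0 2)) := by
      obtain ⟨_, -, hi, -⟩ := hb
      exact (hi 2 (by norm_num)).2.2.1
    refine hb.hasTraceOn.traceBoundH hK hf hm ?_
    unfold sobolevNorm at hn
    have h1 := ENNReal.rpow_le_rpow hn (z := 2) (by norm_num)
    rw [← ENNReal.rpow_mul] at h1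
    norm_num at h1
    rw [ENNReal.ofReal_pow hK]
    exact h1
  · exact absurd hn (not_le.2 ENNReal.ofReal_lt_top)

end TraceSobolev

/-! ### Bilinear estimates -/

section Bilinear

variable {d : ℕ}

/-- The `L^2` norm over the half ball of radius 3. -/
noncomputable def nrm (f : EuclideanSpace ℝ (Fin (d + 1)) → ℝ) : ℝ :=
  (eLpNorm f 2 (hbMeasure d)).toReal

variable {f h p q m : EuclideanSpace ℝ (Fin (d + 1)) → ℝ} {k l : ℕ}

theorem nrm_nonneg : 0 ≤ nrm f := ENNReal.toReal_nonneg

theorem nrm_congr (hfh : f =ᵐ[hbMeasure d] h) : nrm f = nrm h := by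
  unfold nrm; rw [eLpNorm_congr_ae hfh]

theorem integral_sq_eq_nrm (hf : MemLp f 2 (hbMeasure d)) :
    ∫ x in halfBall d 3, f x ^ 2 = nrm f ^ 2 := by
  unfold nrm
  rw [← ENNReal.toReal_pow, eLpNorm_two_sq,
    integral_eq_lintegral_of_nonneg_ae (ae_of_all _ fun y => sq_nonneg _) (hf.1.pow 2)]
  congr 2
  funext y
  rw [Real.enorm_eq_ofReal_abs, ← ENNReal.ofReal_pow (abs_nonneg _), sq_abs]

theorem nrm_add_le (hf : MemLp f 2 (hbMeasure d)) (hh : MemLp h 2 (hbMeasure d)) :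
    nrm (fun x => f x + h x) ≤ nrm f + nrm h := by
  unfold nrm
  rw [← ENNReal.toReal_add hf.2.ne hh.2.ne]
  exact ENNReal.toReal_mono (ENNReal.add_ne_top.2 ⟨hf.2.ne, hh.2.ne⟩)
    (eLpNorm_add_le hf.1 hh.1 (by norm_num))

theorem exists_bound_halfBall (hm : Continuous m) :
    ∃ S, 0 ≤ S ∧ ∀ x ∈ halfBall d 3, |m x| ≤ S := by
  obtain ⟨S, hS⟩ := (isCompact_closedBall (0 : EuclideanSpace ℝ (Fin (d + 1)))
    3).exists_bound_of_continuousOn hm.continuousOn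
  exact ⟨S, (norm_nonneg _).trans (hS 0 (by simp)), fun x hx => hS x (by simpa using hx.1.le)⟩

theorem nrm_mul_le {S : ℝ} (hS0 : 0 ≤ S) (hS : ∀ x ∈ halfBall d 3, |m x| ≤ S)
    (hp : MemLp p 2 (hbMeasure d)) : nrm (fun x => m x * p x) ≤ S * nrm p := by
  unfold nrm
  have h1 : eLpNorm (fun x => m x * p x) 2 (hbMeasure d) ≤
      ENNReal.ofReal S * eLpNorm p 2 (hbMeasure d) := by
    refine eLpNorm_le_mul_eLpNorm_of_ae_le_mul ?_ 2
    filter_upwards [ae_restrict_mem (measurableSet_halfBall 3)] with x hx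
    rw [norm_mul]
    exact mul_le_mul_of_nonneg_right (hS x hx) (norm_nonneg _)
  refine (ENNReal.toReal_mono (ENNReal.mul_ne_top ENNReal.ofReal_ne_top hp.2.ne) h1).trans ?_
  rw [ENNReal.toReal_mul, ENNReal.toReal_ofReal hS0]

theorem integrable_bounded_mul_mul (hm : Continuous m) (hp : MemLp p 2 (hbMeasure d))
    (hq : MemLp q 2 (hbMeasure d)) :
    Integrable (fun x => m x * (p x * q x)) (hbMeasure d) := by
  have h1 : Integrable (fun x => (m x * p x) * q x) (hbMeasure d) :=
    (memLp_continuous_mul hm hp).integrable_mul hq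
  exact h1.congr (ae_of_all _ fun x => by simp only; ring)

/-- The Cauchy-Schwarz inequality for a finite sum of products with bounded coefficients. -/
theorem exists_abs_integral_sum_le {ι : Type*} (s : Finset ι)
    {m : ι → EuclideanSpace ℝ (Fin (d + 1)) → ℝ} (hm : ∀ i, Continuous (m i)) :
    ∃ C, 0 ≤ C ∧ ∀ (p q : ι → EuclideanSpace ℝ (Fin (d + 1)) → ℝ) (P Q : ℝ),
      (∀ i, MemLp (p i) 2 (hbMeasure d)) → (∀ i, MemLp (q i) 2 (hbMeasure d)) →
      (∀ i, nrm (p i) ≤ P) → (∀ i, nrm (q i) ≤ Q) → 0 ≤ P →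
      |∫ x in halfBall d 3, ∑ i ∈ s, m i x * (p i x * q i x)| ≤ C * (P * Q) := by
  choose S hS0 hS using fun i => exists_bound_halfBall (hm i)
  refine ⟨∑ i ∈ s, S i, Finset.sum_nonneg fun i _ => hS0 i, fun p q P Q hp hq hP hQ hP0 => ?_⟩
  rw [integral_finsetSum s fun i _ => integrable_bounded_mul_mul (hm i) (hp i) (hq i),
    Finset.sum_mul]
  refine (Finset.abs_sum_le_sum_abs _ _).trans (Finset.sum_le_sum fun i _ => ?_)
  have e : ∫ x in halfBall d 3, m i x * (p i x * q i x) =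
      ∫ x in halfBall d 3, (m i x * p i x) * q i x := by
    congr 1; funext x; ring
  rw [e]
  refine (abs_integral_mul_le (memLp_continuous_mul (hm i) (hp i)) (hq i)).trans ?_
  have h1 := nrm_mul_le (hS0 i) (hS i) (hp i)
  calc _ ≤ (S i * nrm (p i)) * nrm (q i) := mul_le_mul_of_nonneg_right h1 nrm_nonneg
    _ = S i * (nrm (p i) * nrm (q i)) := by ring
    _ ≤ S i * (P * Q) := mul_le_mul_of_nonneg_left
        (mul_le_mul (hP i) (hQ i) nrm_nonneg hP0) (hS0 i)

theorem exists_nrm_sum_le {ι : Type*} (s : Finset ι)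
    {m : ι → EuclideanSpace ℝ (Fin (d + 1)) → ℝ} (hm : ∀ i, Continuous (m i)) :
    ∃ C, 0 ≤ C ∧ ∀ (p : ι → EuclideanSpace ℝ (Fin (d + 1)) → ℝ) (P : ℝ),
      (∀ i, MemLp (p i) 2 (hbMeasure d)) → (∀ i, nrm (p i) ≤ P) →
      MemLp (fun x => ∑ i ∈ s, m i x * p i x) 2 (hbMeasure d) ∧
      nrm (fun x => ∑ i ∈ s, m i x * p i x) ≤ C * P := by
  choose S hS0 hS using fun i => exists_bound_halfBall (hm i)
  refine ⟨∑ i ∈ s, S i, Finset.sum_nonneg fun i _ => hS0 i, fun p P hp hP => ?_⟩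
  classical
  induction s using Finset.induction_on with
  | empty => simp [nrm]
  | insert a s ha ih =>
    simp only [Finset.sum_insert ha]
    have h1 := memLp_continuous_mul (hm a) (hp a)
    refine ⟨h1.add ih.1, (nrm_add_le h1 ih.1).trans ?_⟩
    rw [add_mul]
    exact add_le_add ((nrm_mul_le (hS0 a) (hS a) (hp a)).trans
      (mul_le_mul_of_nonneg_left (hP a) (hS0 a))) ih.2

theorem MemH.integrable_cutoff_mul_mul (hf : MemH k f) (hh : MemH l h)
    {ζ : EuclideanSpace ℝ (Fin (d + 1)) → ℝ} (hζ : Continuous ζ)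
    (hs : tsupport ζ ⊆ Metric.ball 0 3) :
    Integrable (fun x => ζ x * (f x * h x)) (hbMeasure d) := by
  obtain ⟨r, hr, hsr⟩ := exists_lt_subset_ball (isClosed_tsupport ζ) hs
  have h1 : IntegrableOn (fun x => ζ x * (f x * h x)) (halfBall d r) := by
    have h2 : Integrable (fun x => (ζ x * f x) * h x) (volume.restrict (halfBall d r)) :=
      (memLp_continuous_mul hζ (hf.memLp hr)).integrable_mul (hh.memLp hr)
    exact h2.congr (ae_of_all _ fun x => by simp only; ring)
  refine IntegrableOn.of_forall_sdiff_eq_zero h1 (measurableSet_halfBall 3) fun x hx => ?_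
  rw [image_eq_zero_of_notMem_tsupport (f := ζ), zero_mul]
  exact fun hxs => hx.2 ⟨by simpa using hsr hxs, hx.1.2⟩

end Bilinear

/-! ### Second order operators in divergence form -/

section Operator

variable {d : ℕ}

/-- Smooth coefficients of an elliptic operator `w⁻¹ ∂_i (A^ij ∂_j)` with uniform bounds on the half
ball of radius 3: `A` is bounded below as a quadratic form on vectors, and so is `A ⊗ A` on
2-tensors. -/
structure EllipticCoeffs (d : ℕ) where
  /-- The coefficients `A^ij`. -/
  A : Fin (d + 1) → Fin (d + 1) → EuclideanSpace ℝ (Fin (d + 1)) → ℝ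
  /-- The weight. -/
  w : EuclideanSpace ℝ (Fin (d + 1)) → ℝ
  /-- The ellipticity constant. -/
  lam : ℝ
  smooth : ∀ i j, ContDiff ℝ ∞ (A i j)
  smooth_w : ContDiff ℝ ∞ w
  lam_pos : 0 < lam
  symm : ∀ x ∈ halfBall d 3, ∀ i j, A i j x = A j i x
  le_w : ∀ x ∈ halfBall d 3, lam ≤ w x
  elliptic : ∀ x ∈ halfBall d 3, ∀ ξ : Fin (d + 1) → ℝ,
    lam * ∑ i, ξ i ^ 2 ≤ ∑ a : Fin (d + 1) × Fin (d + 1), A a.1 a.2 x * (ξ a.1 * ξ a.2)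
  elliptic_tensor : ∀ x ∈ halfBall d 3, ∀ ξ : Fin (d + 1) × Fin (d + 1) → ℝ,
    lam * ∑ i, ξ i ^ 2 ≤ ∑ a : (Fin (d + 1) × Fin (d + 1)) × (Fin (d + 1) × Fin (d + 1)),
      A a.1.1 a.2.1 x * A a.1.2 a.2.2 x * (ξ a.1 * ξ a.2)

/-- The divergence form operator `∂_i (A^ij ∂_j f)`, expanded. -/
noncomputable def divOp (A : Fin (d + 1) → Fin (d + 1) → EuclideanSpace ℝ (Fin (d + 1)) → ℝ)
    (f : EuclideanSpace ℝ (Fin (d + 1)) → ℝ) (x : EuclideanSpace ℝ (Fin (d + 1))) : ℝ :=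
  ∑ a : Fin (d + 1) × Fin (d + 1),
    (A a.1 a.2 x * dW a.1 (dW a.2 f) x + pderiv a.1 (A a.1 a.2) x * dW a.2 f x)

/-- Green's formula for `∂_i (A^ij ∂_j)`, with the boundary term estimated. -/
theorem exists_divOp_green {A : Fin (d + 1) → Fin (d + 1) → EuclideanSpace ℝ (Fin (d + 1)) → ℝ}
    (hA : ∀ i j, ContDiff ℝ ∞ (A i j)) {ζ : EuclideanSpace ℝ (Fin (d + 1)) → ℝ}
    (hζ : ContDiff ℝ ∞ ζ) (hζs : tsupport ζ ⊆ Metric.ball 0 2) :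
    ∃ C, 0 ≤ C ∧ ∀ (f h : EuclideanSpace ℝ (Fin (d + 1)) → ℝ) (Kf Kh : ℝ), MemH 2 f → MemH 1 h →
      TraceBoundH Set.univ 1 f Kf → TraceBound h Kh →
      |∫ x in halfBall d 3, (ζ x * (divOp A f x * h x) +
        ∑ a : Fin (d + 1) × Fin (d + 1), ζ x * A a.1 a.2 x * (dW a.2 f x * dW a.1 h x) +
        ∑ a : Fin (d + 1) × Fin (d + 1), pderiv a.1 ζ x * A a.1 a.2 x * (dW a.2 f x * h x))|
        ≤ C * (Kf * Kh) := by
  have hs : ∀ a : Fin (d + 1) × Fin (d + 1), tsupport (fun x => ζ x * A a.1 a.2 x) ⊆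
      Metric.ball 0 2 := fun a => tsupport_mul_subset_left.trans hζs
  choose C hC0 hC using fun a : Fin (d + 1) × Fin (d + 1) =>
    green_inequality (hζ.mul (hA a.1 a.2)) (hs a)
  refine ⟨∑ a, C a, Finset.sum_nonneg fun a _ => hC0 a, fun f h Kf Kh hf hh hKf hKh => ?_⟩
  have h1 := fun a : Fin (d + 1) × Fin (d + 1) => hC a (dW a.2 f) h Kf Kh (hf.deriv a.2) hh
    (hKf.2 a.2 (Set.mem_univ _)) hKh a.1
  have h23 := Metric.ball_subset_ball (x := (0 : EuclideanSpace ℝ (Fin (d + 1))))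
    (by norm_num : (2 : ℝ) ≤ 3)
  have hint : ∀ a : Fin (d + 1) × Fin (d + 1), Integrable (fun x =>
      ζ x * A a.1 a.2 x * (dW a.1 (dW a.2 f) x * h x + dW a.2 f x * dW a.1 h x) +
        pderiv a.1 (fun z => ζ z * A a.1 a.2 z) x * (dW a.2 f x * h x)) (hbMeasure d) := by
    intro a
    have i1 := ((hf.deriv a.2).deriv a.1).integrable_cutoff_mul_mul hh
      (hζ.mul (hA a.1 a.2)).continuous ((hs a).trans h23)
    have i2 := (hf.deriv a.2).integrable_cutoff_mul_mul (hh.deriv a.1)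
      (hζ.mul (hA a.1 a.2)).continuous ((hs a).trans h23)
    have i3 := (hf.deriv a.2).integrable_cutoff_mul_mul hh
      (contDiff_pderiv (hζ.mul (hA a.1 a.2)) a.1).continuous
      ((tsupport_pderiv_subset a.1).trans ((hs a).trans h23))
    refine ((i1.add i2).add i3).congr (ae_of_all _ fun x => ?_)
    simp only [Pi.add_apply]; ring
  have e : ∀ x, ζ x * (divOp A f x * h x) +
        ∑ a : Fin (d + 1) × Fin (d + 1), ζ x * A a.1 a.2 x * (dW a.2 f x * dW a.1 h x) +
        ∑ a : Fin (d + 1) × Fin (d + 1), pderiv a.1 ζ x * A a.1 a.2 x * (dW a.2 f x * h x) =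
      ∑ a : Fin (d + 1) × Fin (d + 1),
        (ζ x * A a.1 a.2 x * (dW a.1 (dW a.2 f) x * h x + dW a.2 f x * dW a.1 h x) +
        pderiv a.1 (fun z => ζ z * A a.1 a.2 z) x * (dW a.2 f x * h x)) := by
    intro x
    unfold divOp
    rw [Finset.sum_mul, Finset.mul_sum, ← Finset.sum_add_distrib, ← Finset.sum_add_distrib]
    refine Finset.sum_congr rfl fun a _ => ?_
    rw [pderiv_mul hζ (hA a.1 a.2)]; ring
  simp only [e]
  rw [integral_finsetSum _ fun a _ => hint a, Finset.sum_mul]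
  exact (Finset.abs_sum_le_sum_abs _ _).trans (Finset.sum_le_sum fun a _ => h1 a)

end Operator

/-! ### Energy estimates -/

section Energy

variable {d : ℕ}

theorem pderiv_pow {n : ℕ} {η : EuclideanSpace ℝ (Fin n) → ℝ} (hη : ContDiff ℝ ∞ η) (k : ℕ)
    (i : Fin n) (x : EuclideanSpace ℝ (Fin n)) :
    pderiv i (fun z => η z ^ k) x = k * η x ^ (k - 1) * pderiv i η x := by
  have h1 := (hη.differentiable (by simp)) x
  simp only [pderiv]
  rw [fderiv_fun_pow k h1]
  simp

theorem tsupport_pow_subset {η : EuclideanSpace ℝ (Fin (d + 1)) → ℝ} {s : Set _}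
    (hs : tsupport η ⊆ s) {k : ℕ} (hk : k ≠ 0) : tsupport (fun x => η x ^ k) ⊆ s :=
  (closure_mono fun x hx => by
    simp only [Function.mem_support] at hx ⊢
    exact fun h => hx (by rw [h, zero_pow hk])).trans hs

theorem tsupport_subset_three {η : EuclideanSpace ℝ (Fin (d + 1)) → ℝ}
    (hs : tsupport η ⊆ Metric.ball 0 2) : tsupport η ⊆ Metric.ball 0 3 :=
  hs.trans (Metric.ball_subset_ball (by norm_num))

variable (E : EllipticCoeffs d)

/-- The weighted Dirichlet form `∫ ζ A^ij ∂_i f ∂_j h`. -/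
noncomputable def dirichlet (ζ f h : EuclideanSpace ℝ (Fin (d + 1)) → ℝ) : ℝ :=
  ∫ x in halfBall d 3,
    ∑ a : Fin (d + 1) × Fin (d + 1), ζ x * E.A a.1 a.2 x * (dW a.2 f x * dW a.1 h x)

theorem dirichlet_comm (ζ f h : EuclideanSpace ℝ (Fin (d + 1)) → ℝ) :
    dirichlet E ζ f h = dirichlet E ζ h f := by
  unfold dirichlet
  refine setIntegral_congr_fun (measurableSet_halfBall 3) fun x hx => ?_
  rw [← (Equiv.prodComm (Fin (d + 1)) (Fin (d + 1))).sum_comp]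
  refine Finset.sum_congr rfl fun a _ => ?_
  simp only [Equiv.prodComm_apply, Prod.fst_swap, Prod.snd_swap]
  rw [E.symm x hx a.2 a.1]; ring

theorem memH_divOp {f : EuclideanSpace ℝ (Fin (d + 1)) → ℝ} {k : ℕ} (hf : MemH (k + 2) f) :
    MemH k (divOp E.A f) := by
  refine MemH.sum _ fun a _ => MemH.add ?_ ?_
  · exact MemH.smooth_mul (E.smooth _ _) ((hf.deriv _).deriv _)
  · exact MemH.smooth_mul (contDiff_pderiv (E.smooth _ _) _) (hf.deriv _).pred

theorem integrable_dirichlet {ζ f h : EuclideanSpace ℝ (Fin (d + 1)) → ℝ} (hζ : ContDiff ℝ ∞ ζ)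
    (hζs : tsupport ζ ⊆ Metric.ball 0 2) (hf : MemH 1 f) (hh : MemH 1 h) :
    Integrable (fun x => ∑ a : Fin (d + 1) × Fin (d + 1),
      ζ x * E.A a.1 a.2 x * (dW a.2 f x * dW a.1 h x)) (hbMeasure d) :=
  integrable_finsetSum _ fun a _ => (hf.deriv a.2).integrable_cutoff_mul_mul (hh.deriv a.1)
    (hζ.mul (E.smooth a.1 a.2)).continuous
    (tsupport_mul_subset_left.trans (tsupport_subset_three hζs))

/-- Green's formula in which the term carrying the derivative of the cutoff is also estimated. -/
theorem exists_source_add_dirichlet_le {ζ σ τ : EuclideanSpace ℝ (Fin (d + 1)) → ℝ}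
    (hζ : ContDiff ℝ ∞ ζ) (hσ : ContDiff ℝ ∞ σ) (hτ : ContDiff ℝ ∞ τ)
    (hζs : tsupport ζ ⊆ Metric.ball 0 2) (hσs : tsupport σ ⊆ Metric.ball 0 2)
    (hτs : tsupport τ ⊆ Metric.ball 0 2)
    {m : Fin (d + 1) → EuclideanSpace ℝ (Fin (d + 1)) → ℝ} (hm : ∀ i, Continuous (m i))
    (hmζ : ∀ i x, pderiv i ζ x = m i x * (σ x * τ x)) :
    ∃ C, 0 ≤ C ∧ ∀ (f h : EuclideanSpace ℝ (Fin (d + 1)) → ℝ) (Kf Kh P Q : ℝ), MemH 2 f →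
      MemH 1 h → TraceBoundH Set.univ 1 f Kf → TraceBound h Kh →
      (∀ j, nrm (fun x => σ x * dW j f x) ≤ P) → nrm (fun x => τ x * h x) ≤ Q →
      |(∫ x in halfBall d 3, ζ x * (divOp E.A f x * h x)) + dirichlet E ζ f h| ≤
        C * (Kf * Kh + P * Q) := by
  obtain ⟨C₁, hC₁0, hC₁⟩ := exists_divOp_green E.smooth hζ hζs
  obtain ⟨C₂, hC₂0, hC₂⟩ := exists_abs_integral_sum_le
    (Finset.univ : Finset (Fin (d + 1) × Fin (d + 1)))
    (m := fun a x => m a.1 x * E.A a.1 a.2 x)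
    (fun a => (hm a.1).mul (E.smooth a.1 a.2).continuous)
  refine ⟨max C₁ C₂, le_max_of_le_left hC₁0,
    fun f h Kf Kh P Q hf hh hKf hKh hP hQ => ?_⟩
  have hP0 : 0 ≤ P := nrm_nonneg.trans (hP 0)
  have hQ0 : 0 ≤ Q := nrm_nonneg.trans hQ
  have hKK : 0 ≤ Kf * Kh := mul_nonneg hKf.1.1 hKh.1
  have h1 := hC₁ f h Kf Kh hf hh hKf hKh
  have h2 := hC₂ (fun a x => σ x * dW a.2 f x) (fun _ x => τ x * h x) P Q
    (fun a => (hf.deriv a.2).memLp_cutoff_mul hσ.continuous (tsupport_subset_three hσs))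
    (fun _ => hh.memLp_cutoff_mul hτ.continuous (tsupport_subset_three hτs))
    (fun a => hP a.2) (fun _ => hQ) hP0
  have e2 : ∀ x, ∑ a : Fin (d + 1) × Fin (d + 1), m a.1 x * E.A a.1 a.2 x *
      ((σ x * dW a.2 f x) * (τ x * h x)) =
      ∑ a : Fin (d + 1) × Fin (d + 1), pderiv a.1 ζ x * E.A a.1 a.2 x * (dW a.2 f x * h x) :=
    fun x => Finset.sum_congr rfl fun a _ => by rw [hmζ]; ring
  simp only [e2] at h2
  have i1 : Integrable (fun x => ζ x * (divOp E.A f x * h x)) (hbMeasure d) :=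
    (memH_divOp E hf).integrable_cutoff_mul_mul hh hζ.continuous (tsupport_subset_three hζs)
  have i2 := integrable_dirichlet E hζ hζs (hf.mono one_le_two) hh
  have i3 : Integrable (fun x => ∑ a : Fin (d + 1) × Fin (d + 1),
      pderiv a.1 ζ x * E.A a.1 a.2 x * (dW a.2 f x * h x)) (hbMeasure d) :=
    integrable_finsetSum _ fun a _ => (hf.deriv a.2).integrable_cutoff_mul_mul hh
      ((contDiff_pderiv hζ a.1).mul (E.smooth a.1 a.2)).continuous
      (tsupport_mul_subset_left.trans
        ((tsupport_pderiv_subset _).trans (tsupport_subset_three hζs)))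
  have i12 : Integrable (fun x => ζ x * (divOp E.A f x * h x) +
      ∑ a : Fin (d + 1) × Fin (d + 1), ζ x * E.A a.1 a.2 x * (dW a.2 f x * dW a.1 h x))
      (hbMeasure d) := i1.add i2
  rw [integral_add i12 i3, integral_add i1 i2] at h1
  have h3 := abs_le.1 h1
  have h4 := abs_le.1 h2
  have h5 : C₁ * (Kf * Kh) ≤ max C₁ C₂ * (Kf * Kh) :=
    mul_le_mul_of_nonneg_right (le_max_left _ _) hKK
  have h6 : C₂ * (P * Q) ≤ max C₁ C₂ * (P * Q) :=
    mul_le_mul_of_nonneg_right (le_max_right _ _) (mul_nonneg hP0 hQ0)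
  unfold dirichlet
  rw [abs_le, mul_add]
  constructor <;> linarith [h3.1, h3.2, h4.1, h4.2]

theorem nrm_sq_sum_le_dirichlet {σ f : EuclideanSpace ℝ (Fin (d + 1)) → ℝ} (hσ : ContDiff ℝ ∞ σ)
    (hσs : tsupport σ ⊆ Metric.ball 0 2) (hf : MemH 1 f) :
    E.lam * ∑ j, nrm (fun x => σ x * dW j f x) ^ 2 ≤ dirichlet E (fun x => σ x ^ 2) f f := by
  have hL : ∀ j, MemLp (fun x => σ x * dW j f x) 2 (hbMeasure d) := fun j =>
    (hf.deriv j).memLp_cutoff_mul hσ.continuous (tsupport_subset_three hσs)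
  have e : E.lam * ∑ j, nrm (fun x => σ x * dW j f x) ^ 2 =
      ∫ x in halfBall d 3, E.lam * ∑ j, (σ x * dW j f x) ^ 2 := by
    rw [integral_const_mul, integral_finsetSum _ fun j _ => (hL j).integrable_sq]
    simp only [integral_sq_eq_nrm (hL _)]
  rw [e]
  refine setIntegral_mono_on ((integrable_finsetSum _ fun j _ => (hL j).integrable_sq).const_mul _)
    (integrable_dirichlet E (hσ.pow 2) (tsupport_pow_subset hσs two_ne_zero) hf hf)
    (measurableSet_halfBall 3) fun x hx => ?_
  refine (E.elliptic x hx fun j => σ x * dW j f x).trans (le_of_eq ?_)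
  refine Finset.sum_congr rfl fun a _ => ?_
  ring

/-- A weighted bound for second derivatives: two integrations by parts exchange `∂_ij u ∂_kl u` for
`∂_ik u ∂_jl u`, the third derivatives cancelling, so that the Hessian is bounded by the operator up
to boundary terms and terms of lower order. -/
theorem exists_hessian_le {η : EuclideanSpace ℝ (Fin (d + 1)) → ℝ} (hη : ContDiff ℝ ∞ η)
    (hηs : tsupport η ⊆ Metric.ball 0 2) :
    ∃ C, 0 ≤ C ∧ ∀ (u : EuclideanSpace ℝ (Fin (d + 1)) → ℝ) (K B G H : ℝ), MemH 3 u →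
      TraceBoundH Set.univ 2 u K → (∀ j, nrm (fun x => η x * dW j u x) ≤ G) →
      nrm (fun x => η x ^ 2 * ∑ a : Fin (d + 1) × Fin (d + 1),
        E.A a.1 a.2 x * dW a.1 (dW a.2 u) x) ≤ B →
      (∀ a : Fin (d + 1) × Fin (d + 1), nrm (fun x => η x ^ 2 * dW a.1 (dW a.2 u) x) ≤ H) →
      E.lam * ∑ a : Fin (d + 1) × Fin (d + 1), nrm (fun x => η x ^ 2 * dW a.1 (dW a.2 u) x) ^ 2 ≤
        B ^ 2 + C * (G * H + K ^ 2) := by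
  let Q := (Fin (d + 1) × Fin (d + 1)) × (Fin (d + 1) × Fin (d + 1))
  let c : Q → EuclideanSpace ℝ (Fin (d + 1)) → ℝ := fun a x =>
    E.A a.1.1 a.2.1 x * E.A a.1.2 a.2.2 x
  have hc : ∀ a, ContDiff ℝ ∞ (c a) := fun a => (E.smooth _ _).mul (E.smooth _ _)
  let ζ : Q → EuclideanSpace ℝ (Fin (d + 1)) → ℝ := fun a x => η x ^ 4 * c a x
  have hζ : ∀ a, ContDiff ℝ ∞ (ζ a) := fun a => (hη.pow 4).mul (hc a)
  have hζs : ∀ a, tsupport (ζ a) ⊆ Metric.ball 0 2 := fun a =>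
    tsupport_mul_subset_left.trans (tsupport_pow_subset hηs (by norm_num))
  let m : Fin (d + 1) → Q → EuclideanSpace ℝ (Fin (d + 1)) → ℝ := fun i a x =>
    4 * pderiv i η x * c a x + η x * pderiv i (c a) x
  have hm : ∀ i a, Continuous (m i a) := fun i a =>
    ((continuous_const.mul (contDiff_pderiv hη i).continuous).mul (hc a).continuous).add
      (hη.continuous.mul (contDiff_pderiv (hc a) i).continuous)
  have hζd : ∀ i a x, pderiv i (ζ a) x = m i a x * (η x * η x ^ 2) := by
    intro i a x
    rw [pderiv_mul (hη.pow 4) (hc a), pderiv_pow hη]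
    simp only [m]; push_cast; ring
  choose C₁ hC₁0 hC₁ using fun a => green_inequality (hζ a) (hζs a)
  obtain ⟨C₂, hC₂0, hC₂⟩ := exists_abs_integral_sum_le (Finset.univ : Finset Q)
    (m := fun a => m a.1.2 a) (fun a => hm _ a)
  obtain ⟨C₃, hC₃0, hC₃⟩ := exists_abs_integral_sum_le (Finset.univ : Finset Q)
    (m := fun a => m a.2.1 a) (fun a => hm _ a)
  have hC₁s : 0 ≤ ∑ a, C₁ a := Finset.sum_nonneg fun a _ => hC₁0 a
  refine ⟨2 * ∑ a, C₁ a + (C₂ + C₃), by positivity, fun u K B G H hu hK hG hB hH => ?_⟩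
  have hG0 : 0 ≤ G := nrm_nonneg.trans (hG 0)
  have hH0 : 0 ≤ H := nrm_nonneg.trans (hH (0, 0))
  have hs3 := fun a => tsupport_subset_three (hζs a)
  have hK1 : ∀ i, TraceBound (dW i u) K := fun i => (hK.2 i (Set.mem_univ i)).1
  have hK2 : ∀ i j, TraceBound (dW i (dW j u)) K := fun i j =>
    (hK.2 j (Set.mem_univ j)).2 i (Set.mem_univ i)
  have hu1 : ∀ i, MemH 2 (dW i u) := fun i => hu.deriv i
  have hu2 : ∀ i j, MemH 1 (dW i (dW j u)) := fun i j => (hu1 j).deriv i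
  have hL1 : ∀ i, MemLp (fun x => η x * dW i u x) 2 (hbMeasure d) := fun i =>
    (hu1 i).memLp_cutoff_mul hη.continuous (tsupport_subset_three hηs)
  have hη2s := tsupport_subset_three (tsupport_pow_subset hηs (k := 2) two_ne_zero)
  have hL2 : ∀ i j, MemLp (fun x => η x ^ 2 * dW i (dW j u) x) 2 (hbMeasure d) := fun i j =>
    (hu2 i j).memLp_cutoff_mul (hη.pow 2).continuous hη2s
  -- the two applications of Green's formula for each quadruple of indices
  have g1 : ∀ a : Q, _ := fun a => hC₁ a (dW a.1.1 u) (dW a.2.1 (dW a.2.2 u)) K K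
    ((hu1 _).mono one_le_two) (hu2 _ _) (hK1 _) (hK2 _ _) a.1.2
  have g2 : ∀ a : Q, _ := fun a => hC₁ a (dW a.1.1 u) (dW a.1.2 (dW a.2.2 u)) K K
    ((hu1 _).mono one_le_two) (hu2 _ _) (hK1 _) (hK2 _ _) a.2.1
  have l1 := hC₂ (fun a x => η x * dW a.1.1 u x) (fun a x => η x ^ 2 * dW a.2.1 (dW a.2.2 u) x)
    G H (fun a => hL1 _) (fun a => hL2 _ _) (fun a => hG _) (fun a => hH (a.2.1, a.2.2)) hG0
  have l2 := hC₃ (fun a x => η x * dW a.1.1 u x) (fun a x => η x ^ 2 * dW a.1.2 (dW a.2.2 u) x)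
    G H (fun a => hL1 _) (fun a => hL2 _ _) (fun a => hG _) (fun a => hH (a.1.2, a.2.2)) hG0
  -- integrability of all the products
  have j1 : ∀ (a : Q) (p q : Fin (d + 1) × Fin (d + 1)), Integrable (fun x =>
      ζ a x * (dW p.1 (dW p.2 u) x * dW q.1 (dW q.2 u) x)) (hbMeasure d) := fun a p q =>
    (hu2 _ _).integrable_cutoff_mul_mul (hu2 _ _) (hζ a).continuous (hs3 a)
  have j2 : ∀ (a : Q) (i : Fin (d + 1)) (p : Fin (d + 1) × Fin (d + 1)), Integrable (fun x =>
      pderiv i (ζ a) x * (dW a.1.1 u x * dW p.1 (dW p.2 u) x)) (hbMeasure d) := fun a i p =>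
    (hu1 _).integrable_cutoff_mul_mul (hu2 _ _) (contDiff_pderiv (hζ a) i).continuous
      ((tsupport_pderiv_subset i).trans (hs3 a))
  have j3 : ∀ (a : Q) (i : Fin (d + 1)) (p : Fin (d + 1) × Fin (d + 1)), Integrable (fun x =>
      ζ a x * (dW i (dW a.1.1 u) x * dW p.1 (dW p.2 u) x +
        dW a.1.1 u x * dW i (dW p.1 (dW p.2 u)) x) +
      pderiv i (ζ a) x * (dW a.1.1 u x * dW p.1 (dW p.2 u) x)) (hbMeasure d) := by
    intro a i p
    have h2 := (hu1 a.1.1).integrable_cutoff_mul_mul ((hu2 p.1 p.2).deriv i)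
      (hζ a).continuous (hs3 a)
    refine (((j1 a (i, a.1.1) p).add h2).add (j2 a i p)).congr (ae_of_all _ fun x => ?_)
    simp only [Pi.add_apply]; ring
  have hT : Integrable (fun x => ∑ a : Q,
      ζ a x * (dW a.1.1 (dW a.1.2 u) x * dW a.2.1 (dW a.2.2 u) x)) (hbMeasure d) :=
    integrable_finsetSum _ fun a _ => j1 a a.1 a.2
  have hsq : ∀ x, (η x ^ 2 * ∑ a : Fin (d + 1) × Fin (d + 1),
      E.A a.1 a.2 x * dW a.1 (dW a.2 u) x) ^ 2 =
      ∑ a : Q, ζ a x * (dW a.1.1 (dW a.2.1 u) x * dW a.1.2 (dW a.2.2 u) x) := by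
    intro x
    rw [mul_pow, sq (∑ a : Fin (d + 1) × Fin (d + 1), _), Finset.sum_mul_sum,
      ← Finset.sum_product', Finset.univ_product_univ, Finset.mul_sum,
      ← (Equiv.prodProdProdComm (Fin (d + 1)) (Fin (d + 1)) (Fin (d + 1)) (Fin (d + 1))).sum_comp]
    refine Finset.sum_congr rfl fun a _ => ?_
    simp only [Equiv.prodProdProdComm_apply, ζ, c]
    ring
  have hBL : MemLp (fun x => η x ^ 2 * ∑ a : Fin (d + 1) × Fin (d + 1),
      E.A a.1 a.2 x * dW a.1 (dW a.2 u) x) 2 (hbMeasure d) :=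
    (MemH.sum _ fun a _ => MemH.smooth_mul (E.smooth _ _) (hu2 a.1 a.2)).memLp_cutoff_mul
      (hη.pow 2).continuous hη2s
  have key : (∫ x in halfBall d 3, ∑ a : Q,
      ζ a x * (dW a.1.1 (dW a.1.2 u) x * dW a.2.1 (dW a.2.2 u) x)) =
      (∫ x in halfBall d 3, (η x ^ 2 * ∑ a : Fin (d + 1) × Fin (d + 1),
        E.A a.1 a.2 x * dW a.1 (dW a.2 u) x) ^ 2) +
      (∑ a : Q, ((∫ x in halfBall d 3,
        (ζ a x * (dW a.1.2 (dW a.1.1 u) x * dW a.2.1 (dW a.2.2 u) x +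
          dW a.1.1 u x * dW a.1.2 (dW a.2.1 (dW a.2.2 u)) x) +
        pderiv a.1.2 (ζ a) x * (dW a.1.1 u x * dW a.2.1 (dW a.2.2 u) x))) -
        ∫ x in halfBall d 3,
        (ζ a x * (dW a.2.1 (dW a.1.1 u) x * dW a.1.2 (dW a.2.2 u) x +
          dW a.1.1 u x * dW a.2.1 (dW a.1.2 (dW a.2.2 u)) x) +
        pderiv a.2.1 (ζ a) x * (dW a.1.1 u x * dW a.1.2 (dW a.2.2 u) x)))) -
      (∫ x in halfBall d 3, ∑ a : Q, m a.1.2 a x *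
        ((η x * dW a.1.1 u x) * (η x ^ 2 * dW a.2.1 (dW a.2.2 u) x))) +
      ∫ x in halfBall d 3, ∑ a : Q, m a.2.1 a x *
        ((η x * dW a.1.1 u x) * (η x ^ 2 * dW a.1.2 (dW a.2.2 u) x)) := by
    simp only [hsq]
    rw [integral_finsetSum _ fun a _ => j1 a a.1 a.2,
      integral_finsetSum _ fun a _ => j1 a (a.1.1, a.2.1) (a.1.2, a.2.2),
      integral_finsetSum _ fun a _ => integrable_bounded_mul_mul (hm _ a) (hL1 _) (hL2 _ _),
      integral_finsetSum _ fun a _ => integrable_bounded_mul_mul (hm _ a) (hL1 _) (hL2 _ _),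
      ← Finset.sum_add_distrib, ← Finset.sum_sub_distrib, ← Finset.sum_add_distrib]
    refine Finset.sum_congr rfl fun a _ => ?_
    have hi1 := j1 a (a.1.1, a.2.1) (a.1.2, a.2.2)
    have hi2 := j3 a a.1.2 (a.2.1, a.2.2)
    have hi3 := j3 a a.2.1 (a.1.2, a.2.2)
    have hi4 := integrable_bounded_mul_mul (hm a.1.2 a) (hL1 a.1.1) (hL2 a.2.1 a.2.2)
    have hi5 := integrable_bounded_mul_mul (hm a.2.1 a) (hL1 a.1.1) (hL2 a.1.2 a.2.2)
    have hs := integral_add' ((hi1.add (hi2.sub hi3)).sub hi4) hi5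
    rw [integral_sub' (hi1.add (hi2.sub hi3)) hi4, integral_add' hi1 (hi2.sub hi3),
      integral_sub' hi2 hi3] at hs
    refine Eq.trans ?_ hs
    refine integral_congr_ae ?_
    filter_upwards [dW_comm (hu.mono (by norm_num)) a.1.2 a.1.1,
      dW_comm (hu.mono (by norm_num)) a.2.1 a.1.1, dW_comm (hu1 a.2.2) a.1.2 a.2.1]
      with x h1 h2 h3
    simp only [Pi.add_apply, Pi.sub_apply]
    rw [h1, h2, h3, hζd, hζd]
    ring
  have e : E.lam * ∑ a : Fin (d + 1) × Fin (d + 1), nrm (fun x => η x ^ 2 * dW a.1 (dW a.2 u) x) ^ 2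
      = ∫ x in halfBall d 3, E.lam * ∑ a : Fin (d + 1) × Fin (d + 1),
        (η x ^ 2 * dW a.1 (dW a.2 u) x) ^ 2 := by
    rw [integral_const_mul, integral_finsetSum _ fun a _ => (hL2 _ _).integrable_sq]
    simp only [integral_sq_eq_nrm (hL2 _ _)]
  have hell : E.lam * ∑ a : Fin (d + 1) × Fin (d + 1),
      nrm (fun x => η x ^ 2 * dW a.1 (dW a.2 u) x) ^ 2 ≤ ∫ x in halfBall d 3, ∑ a : Q,
      ζ a x * (dW a.1.1 (dW a.1.2 u) x * dW a.2.1 (dW a.2.2 u) x) := by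
    rw [e]
    refine setIntegral_mono_on
      ((integrable_finsetSum _ fun a _ => (hL2 _ _).integrable_sq).const_mul _) hT
      (measurableSet_halfBall 3) fun x hx => ?_
    refine (E.elliptic_tensor x hx fun a => η x ^ 2 * dW a.1 (dW a.2 u) x).trans (le_of_eq ?_)
    refine Finset.sum_congr rfl fun a _ => ?_
    simp only [ζ, c]; ring
  rw [key, integral_sq_eq_nrm hBL] at hell
  have hB2 : nrm (fun x => η x ^ 2 * ∑ a : Fin (d + 1) × Fin (d + 1),
      E.A a.1 a.2 x * dW a.1 (dW a.2 u) x) ^ 2 ≤ B ^ 2 := pow_le_pow_left₀ nrm_nonneg hB 2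
  have hsum := Finset.sum_le_sum (s := (Finset.univ : Finset Q)) fun a _ =>
    sub_le_sub (abs_le.1 (g1 a)).2 (abs_le.1 (g2 a)).1
  have hsum2 : ∑ a : Q, (C₁ a * (K * K) - -(C₁ a * (K * K))) = 2 * (∑ a, C₁ a) * K ^ 2 := by
    rw [Finset.mul_sum, Finset.sum_mul]
    refine Finset.sum_congr rfl fun a _ => ?_
    ring
  rw [hsum2] at hsum
  have h4 := (abs_le.1 l1).1
  have h5 := (abs_le.1 l2).2
  have h6 : 0 ≤ (∑ a, C₁ a) * (G * H) := by positivity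
  have h7 : 0 ≤ (C₂ + C₃) * K ^ 2 := by positivity
  nlinarith [hell, hB2, hsum, h4, h5, h6, h7]

end Energy

/-! ### The Caccioppoli inequality for a second order system -/

section Absorb

/-- A quadratic inequality in which the linear term can be absorbed. -/
theorem le_two_mul_of_sq_le {D z s : ℝ} (hD : 1 ≤ D) (hs : 0 ≤ s) (hz : 0 ≤ z)
    (h : z ^ 2 ≤ D * (s * (s + z))) : z ≤ 2 * D * s := by
  by_contra! hlt
  have h1 : s ≤ D * s := le_mul_of_one_le_left hs hD
  have h2 : D * s < z / 2 := by linarith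
  have hz0 : 0 < z := by nlinarith
  have h3 : (D * s) * (s + z) ≤ (z / 2) * (z / 2 + z) :=
    mul_le_mul h2.le (by linarith) (by linarith) (by linarith)
  nlinarith

/-- The coupled system of energy inequalities bounds `Y`: if `Y` were large compared with `A`, the
other two quantities would be too small to allow it. -/
theorem le_of_energy_system {D A G Y Z : ℝ} (hD : 1 ≤ D) (hA : 0 ≤ A) (hG : 0 ≤ G) (hY : 0 ≤ Y)
    (hZ : 0 ≤ Z) (h1 : Z ^ 2 ≤ D * (A * Y + Z * Y + A ^ 2))
    (h2 : G ^ 2 ≤ D * (Y * A + G * A + A ^ 2)) (h3 : Y ^ 2 ≤ D * (2 * A ^ 2 + Z * A + G * Y)) :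
    Y ≤ 40 * D ^ 3 * A := by
  -- otherwise `A` is at most `Y / (40 D³)`, and every term of the bound for `Y ^ 2` is a small
  -- multiple of `Y ^ 2`
  by_contra! hlt
  have hD0 : 0 < D := by linarith
  have hZ' : Z ≤ 2 * D * (Y + A) := by
    refine le_two_mul_of_sq_le hD (by linarith) hZ (h1.trans ?_)
    refine mul_le_mul_of_nonneg_left ?_ hD0.le
    nlinarith [mul_nonneg hY hY, mul_nonneg hA hZ, mul_nonneg hA hY]
  have hD2 : 1 ≤ D ^ 2 := one_le_pow₀ hD
  have hD3 : 1 ≤ D ^ 3 := one_le_pow₀ hD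
  have hY0 : 0 < Y := lt_of_le_of_lt (by positivity) hlt
  have hAY : A ≤ Y := by nlinarith
  -- the gradient term is small compared with `Y`
  have hGY : D * G ≤ Y / 4 := by
    by_contra! hG4
    have hG0 : 0 < G := by
      by_contra! hle
      have : G = 0 := le_antisymm hle hG
      rw [this] at hG4; linarith
    have a1 : Y * A + G * A + A ^ 2 ≤ (2 * Y + G) * A := by nlinarith
    have a2 : G ^ 2 ≤ D * ((9 * D * G) * A) := by
      refine h2.trans (mul_le_mul_of_nonneg_left (a1.trans ?_) hD0.le)
      exact mul_le_mul_of_nonneg_right (by nlinarith) hA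
    have a3 : G ≤ 9 * D ^ 2 * A := by
      have : G * G ≤ (9 * D ^ 2 * A) * G := by nlinarith
      exact le_of_mul_le_mul_right this hG0
    have a4 : D * G ≤ 9 * D ^ 3 * A := by
      calc D * G ≤ D * (9 * D ^ 2 * A) := mul_le_mul_of_nonneg_left a3 hD0.le
        _ = 9 * D ^ 3 * A := by ring
    nlinarith [mul_nonneg (by positivity : (0:ℝ) ≤ D ^ 3) hA]
  have b1 : D * (G * Y) ≤ Y ^ 2 / 4 := by nlinarith
  have b2 : D * A ^ 2 ≤ Y ^ 2 / 40 := by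
    have : D * A ≤ D ^ 3 * A := mul_le_mul_of_nonneg_right (by nlinarith) hA
    nlinarith
  have b3 : D * (Z * A) ≤ Y ^ 2 / 10 := by
    have c1 : D * Z ≤ 4 * D ^ 2 * Y := by nlinarith
    have c2 : D * (Z * A) ≤ (4 * D ^ 2 * Y) * A := by
      rw [← mul_assoc]; exact mul_le_mul_of_nonneg_right c1 hA
    have c3 : D ^ 2 * A ≤ D ^ 3 * A := mul_le_mul_of_nonneg_right (by nlinarith) hA
    nlinarith
  nlinarith

end Absorb

section Caccioppoli

variable {d : ℕ}

theorem exists_abs_integral_mul_mul_le {m : EuclideanSpace ℝ (Fin (d + 1)) → ℝ}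
    (hm : Continuous m) :
    ∃ C, 0 ≤ C ∧ ∀ p q : EuclideanSpace ℝ (Fin (d + 1)) → ℝ, MemLp p 2 (hbMeasure d) →
      MemLp q 2 (hbMeasure d) →
      |∫ x in halfBall d 3, m x * (p x * q x)| ≤ C * (nrm p * nrm q) := by
  obtain ⟨C, hC0, hC⟩ := exists_abs_integral_sum_le (Finset.univ : Finset Unit)
    (m := fun _ => m) (fun _ => hm)
  refine ⟨C, hC0, fun p q hp hq => ?_⟩
  simpa using hC (fun _ => p) (fun _ => q) (nrm p) (nrm q) (fun _ => hp) (fun _ => hq)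
    (fun _ => le_rfl) (fun _ => le_rfl) nrm_nonneg

theorem le_sqrt_sum_sq {ι : Type*} [Fintype ι] (f : ι → ℝ) (i : ι) :
    f i ≤ √(∑ i, f i ^ 2) :=
  Real.le_sqrt_of_sq_le (Finset.single_le_sum (f := fun i => f i ^ 2) (fun _ _ => sq_nonneg _)
    (Finset.mem_univ i))

variable (E : EllipticCoeffs d)

theorem mul_eq_self_of_eqOn_tsupport {f η χ : EuclideanSpace ℝ (Fin (d + 1)) → ℝ}
    (hηχ : ∀ x ∈ tsupport η, χ x = 1) (hf : tsupport f ⊆ tsupport η)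
    (x : EuclideanSpace ℝ (Fin (d + 1))) : f x * χ x = f x := by
  by_cases hx : x ∈ tsupport η
  · rw [hηχ x hx, mul_one]
  · rw [image_eq_zero_of_notMem_tsupport fun h => hx (hf h), zero_mul]

/-- The energy inequality of `∂_i (A^ij ∂_j v) = w W u`. -/
theorem exists_energy_source_le {η χ : EuclideanSpace ℝ (Fin (d + 1)) → ℝ} (hη : ContDiff ℝ ∞ η)
    (hηs : tsupport η ⊆ Metric.ball 0 2)
    (hηχ : ∀ x ∈ tsupport η, χ x = 1) :
    ∃ S, 0 ≤ S ∧ ∀ (u v W : EuclideanSpace ℝ (Fin (d + 1)) → ℝ) (K N Y Z : ℝ), MemH 2 v →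
      MemLp (fun x => W x * (χ x * u x)) 2 (hbMeasure d) →
      divOp E.A v =ᵐ[hbMeasure d] (fun x => E.w x * (W x * u x)) →
      TraceBoundH Set.univ 1 v K → nrm (fun x => W x * (χ x * u x)) ≤ N →
      nrm (fun x => η x ^ 2 * v x) ≤ Y → (∀ j, nrm (fun x => η x ^ 3 * dW j v x) ≤ Z) →
      E.lam * ∑ j, nrm (fun x => η x ^ 3 * dW j v x) ^ 2 ≤ S * (N * Y + Z * Y + K * K) := by
  obtain ⟨S₁, hS₁0, hS₁⟩ := exists_source_add_dirichlet_le E (ζ := fun x => (η x ^ 3) ^ 2)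
    (σ := fun x => η x ^ 3) (τ := fun x => η x ^ 2) ((hη.pow 3).pow 2) (hη.pow 3) (hη.pow 2)
    (tsupport_pow_subset (tsupport_pow_subset hηs (by norm_num)) two_ne_zero)
    (tsupport_pow_subset hηs (by norm_num)) (tsupport_pow_subset hηs two_ne_zero)
    (m := fun i x => 6 * pderiv i η x)
    (fun i => continuous_const.mul (contDiff_pderiv hη i).continuous)
    (fun i x => by rw [pderiv_pow (hη.pow 3), pderiv_pow hη]; push_cast; ring)
  obtain ⟨B₁, hB₁0, hB₁⟩ := exists_abs_integral_mul_mul_le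
    (E.smooth_w.mul (hη.pow 4)).continuous
  refine ⟨S₁ + B₁, by positivity, fun u v W K N Y Z hv hWu hvW hK hN hY hZ => ?_⟩
  have hK0 : 0 ≤ K := hK.1.1
  have hY0 : 0 ≤ Y := nrm_nonneg.trans hY
  have hZ0 : 0 ≤ Z := nrm_nonneg.trans (hZ 0)
  have hN0 : 0 ≤ N := nrm_nonneg.trans hN
  have hv1 : MemH 1 v := hv.mono (by norm_num)
  have hvL : MemLp (fun x => η x ^ 2 * v x) 2 (hbMeasure d) :=
    hv.memLp_cutoff_mul (hη.pow 2).continuous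
      (tsupport_pow_subset (tsupport_subset_three hηs) two_ne_zero)
  have h1 := (abs_le.1 (hS₁ v v K K Z Y hv hv1 hK hK.1 hZ hY)).2
  have h2 := nrm_sq_sum_le_dirichlet E (hη.pow 3) (tsupport_pow_subset hηs (by norm_num)) hv1
  have h3 := (abs_le.1 (hB₁ _ _ hWu hvL)).1
  have e : ∫ x in halfBall d 3, (η x ^ 3) ^ 2 * (divOp E.A v x * v x) =
      ∫ x in halfBall d 3, E.w x * η x ^ 4 * ((W x * (χ x * u x)) * (η x ^ 2 * v x)) := by
    refine integral_congr_ae ?_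
    filter_upwards [hvW] with x hx
    rw [hx]
    have := mul_eq_self_of_eqOn_tsupport hηχ subset_rfl x
    linear_combination (-(E.w x * η x ^ 5 * W x * u x * v x)) * this
  have h4 : B₁ * (nrm (fun x => W x * (χ x * u x)) * nrm (fun x => η x ^ 2 * v x)) ≤
      B₁ * (N * Y) :=
    mul_le_mul_of_nonneg_left (mul_le_mul hN hY nrm_nonneg hN0) hB₁0
  have h5 : 0 ≤ S₁ * (N * Y) := by positivity
  have h6 : 0 ≤ B₁ * (Z * Y + K * K) := by positivity
  rw [e] at h1
  linarith

/-- The energy inequality of `∂_i (A^ij ∂_j u) = w v`. -/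
theorem exists_energy_le {η χ : EuclideanSpace ℝ (Fin (d + 1)) → ℝ} (hη : ContDiff ℝ ∞ η)
    (hηs : tsupport η ⊆ Metric.ball 0 2) (hχ : ContDiff ℝ ∞ χ)
    (hχs : tsupport χ ⊆ Metric.ball 0 2) (hηχ : ∀ x ∈ tsupport η, χ x = 1) :
    ∃ S, 0 ≤ S ∧ ∀ (u v : EuclideanSpace ℝ (Fin (d + 1)) → ℝ) (K X Y G : ℝ), MemH 2 u →
      MemH 2 v → divOp E.A u =ᵐ[hbMeasure d] (fun x => E.w x * v x) →
      TraceBoundH Set.univ 1 u K → nrm (fun x => χ x * u x) ≤ X →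
      nrm (fun x => η x ^ 2 * v x) ≤ Y → (∀ j, nrm (fun x => η x * dW j u x) ≤ G) →
      E.lam * ∑ j, nrm (fun x => η x * dW j u x) ^ 2 ≤ S * (Y * X + G * X + K * K) := by
  obtain ⟨S₄, hS₄0, hS₄⟩ := exists_source_add_dirichlet_le E (ζ := fun x => η x ^ 2)
    (σ := η) (τ := χ) (hη.pow 2) hη hχ (tsupport_pow_subset hηs two_ne_zero) hηs hχs
    (m := fun i x => 2 * pderiv i η x)
    (fun i => continuous_const.mul (contDiff_pderiv hη i).continuous)
    (fun i x => by
      have := mul_eq_self_of_eqOn_tsupport hηχ (tsupport_pderiv_subset i) x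
      rw [pderiv_pow hη]; push_cast; linear_combination (-(2 * η x)) * this)
  obtain ⟨B₃, hB₃0, hB₃⟩ := exists_abs_integral_mul_mul_le E.smooth_w.continuous
  refine ⟨S₄ + B₃, by positivity, fun u v K X Y G hu hv huv hK hX hY hG => ?_⟩
  have hK0 : 0 ≤ K := hK.1.1
  have hY0 : 0 ≤ Y := nrm_nonneg.trans hY
  have hX0 : 0 ≤ X := nrm_nonneg.trans hX
  have hG0 : 0 ≤ G := nrm_nonneg.trans (hG 0)
  have hu1 : MemH 1 u := hu.mono (by norm_num)
  have hvL : MemLp (fun x => η x ^ 2 * v x) 2 (hbMeasure d) :=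
    hv.memLp_cutoff_mul (hη.pow 2).continuous
      (tsupport_pow_subset (tsupport_subset_three hηs) two_ne_zero)
  have huL : MemLp (fun x => χ x * u x) 2 (hbMeasure d) :=
    hu.memLp_cutoff_mul hχ.continuous (tsupport_subset_three hχs)
  have h1 := (abs_le.1 (hS₄ u u K K G X hu hu1 hK hK.1 hG hX)).2
  have h2 := nrm_sq_sum_le_dirichlet E hη hηs hu1
  have h3 := (abs_le.1 (hB₃ _ _ hvL huL)).1
  have e : ∫ x in halfBall d 3, η x ^ 2 * (divOp E.A u x * u x) =
      ∫ x in halfBall d 3, E.w x * ((η x ^ 2 * v x) * (χ x * u x)) := by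
    refine integral_congr_ae ?_
    filter_upwards [huv] with x hx
    rw [hx]
    have := mul_eq_self_of_eqOn_tsupport hηχ subset_rfl x
    linear_combination (-(E.w x * η x * u x * v x)) * this
  have h4 : B₃ * (nrm (fun x => η x ^ 2 * v x) * nrm (fun x => χ x * u x)) ≤ B₃ * (Y * X) :=
    mul_le_mul_of_nonneg_left (mul_le_mul hY hX nrm_nonneg hY0) hB₃0
  have h5 : 0 ≤ S₄ * (Y * X) := by positivity
  have h6 : 0 ≤ B₃ * (G * X + K * K) := by positivity
  rw [e] at h1
  linarith

/-- A bound for `∫ η⁴ v²` from Green's formula: `∫ η⁴ w v² = ∫ η⁴ v ∂_i (A^ij ∂_j u)`, and both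
functions exchange their roles. -/
theorem exists_sq_le {η χ : EuclideanSpace ℝ (Fin (d + 1)) → ℝ} (hη : ContDiff ℝ ∞ η)
    (hηs : tsupport η ⊆ Metric.ball 0 2) (hχ : ContDiff ℝ ∞ χ)
    (hχs : tsupport χ ⊆ Metric.ball 0 2) (hηχ : ∀ x ∈ tsupport η, χ x = 1) :
    ∃ S, 0 ≤ S ∧ ∀ (u v W : EuclideanSpace ℝ (Fin (d + 1)) → ℝ) (K N X Y Z G : ℝ), MemH 2 u →
      MemH 2 v → MemLp (fun x => W x * (χ x * u x)) 2 (hbMeasure d) →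
      divOp E.A u =ᵐ[hbMeasure d] (fun x => E.w x * v x) →
      divOp E.A v =ᵐ[hbMeasure d] (fun x => E.w x * (W x * u x)) →
      TraceBoundH Set.univ 1 u K → TraceBoundH Set.univ 1 v K →
      nrm (fun x => W x * (χ x * u x)) ≤ N → nrm (fun x => χ x * u x) ≤ X →
      nrm (fun x => η x ^ 2 * v x) ≤ Y → (∀ j, nrm (fun x => η x ^ 3 * dW j v x) ≤ Z) →
      (∀ j, nrm (fun x => η x * dW j u x) ≤ G) →
      E.lam * nrm (fun x => η x ^ 2 * v x) ^ 2 ≤ S * (N * X + Z * X + G * Y + K * K) := by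
  obtain ⟨S₂, hS₂0, hS₂⟩ := exists_source_add_dirichlet_le E (ζ := fun x => η x ^ 4)
    (σ := η) (τ := fun x => η x ^ 2) (hη.pow 4) hη (hη.pow 2)
    (tsupport_pow_subset hηs (by norm_num)) hηs (tsupport_pow_subset hηs two_ne_zero)
    (m := fun i x => 4 * pderiv i η x)
    (fun i => continuous_const.mul (contDiff_pderiv hη i).continuous)
    (fun i x => by rw [pderiv_pow hη]; push_cast; ring)
  obtain ⟨S₃, hS₃0, hS₃⟩ := exists_source_add_dirichlet_le E (ζ := fun x => η x ^ 4)
    (σ := fun x => η x ^ 3) (τ := χ) (hη.pow 4) (hη.pow 3) hχ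
    (tsupport_pow_subset hηs (by norm_num)) (tsupport_pow_subset hηs (by norm_num)) hχs
    (m := fun i x => 4 * pderiv i η x)
    (fun i => continuous_const.mul (contDiff_pderiv hη i).continuous)
    (fun i x => by
      have := mul_eq_self_of_eqOn_tsupport hηχ (tsupport_pderiv_subset i) x
      rw [pderiv_pow hη]; push_cast; linear_combination (-(4 * η x ^ 3)) * this)
  obtain ⟨B₁, hB₁0, hB₁⟩ := exists_abs_integral_mul_mul_le
    (E.smooth_w.mul (hη.pow 4)).continuous
  refine ⟨S₂ + S₃ + B₁, by positivity,
    fun u v W K N X Y Z G hu hv hWu huv hvW hKu hKv hN hX hY hZ hG => ?_⟩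
  have hK0 : 0 ≤ K := hKu.1.1
  have hY0 : 0 ≤ Y := nrm_nonneg.trans hY
  have hX0 : 0 ≤ X := nrm_nonneg.trans hX
  have hN0 : 0 ≤ N := nrm_nonneg.trans hN
  have hZ0 : 0 ≤ Z := nrm_nonneg.trans (hZ 0)
  have hG0 : 0 ≤ G := nrm_nonneg.trans (hG 0)
  have hu1 : MemH 1 u := hu.mono (by norm_num)
  have hv1 : MemH 1 v := hv.mono (by norm_num)
  have hvL : MemLp (fun x => η x ^ 2 * v x) 2 (hbMeasure d) :=
    hv.memLp_cutoff_mul (hη.pow 2).continuous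
      (tsupport_pow_subset (tsupport_subset_three hηs) two_ne_zero)
  have huL : MemLp (fun x => χ x * u x) 2 (hbMeasure d) :=
    hu.memLp_cutoff_mul hχ.continuous (tsupport_subset_three hχs)
  have h1 := (abs_le.1 (hS₂ u v K K G Y hu hv1 hKu hKv.1 hG hY)).2
  have h2 := (abs_le.1 (hS₃ v u K K Z X hv hu1 hKv hKu.1 hZ hX)).1
  rw [dirichlet_comm] at h2
  have h3 := (abs_le.1 (hB₁ _ _ hWu huL)).2
  have e : ∫ x in halfBall d 3, η x ^ 4 * (divOp E.A v x * u x) =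
      ∫ x in halfBall d 3, E.w x * η x ^ 4 * ((W x * (χ x * u x)) * (χ x * u x)) := by
    refine integral_congr_ae ?_
    filter_upwards [hvW] with x hx
    rw [hx]
    have := mul_eq_self_of_eqOn_tsupport hηχ subset_rfl x
    linear_combination (-(E.w x * η x ^ 3 * W x * u x * u x * (1 + χ x))) * this
  have e' : E.lam * nrm (fun x => η x ^ 2 * v x) ^ 2 ≤
      ∫ x in halfBall d 3, η x ^ 4 * (divOp E.A u x * v x) := by
    have e1 : ∫ x in halfBall d 3, η x ^ 4 * (divOp E.A u x * v x) =
        ∫ x in halfBall d 3, E.w x * ((η x ^ 2 * v x) * (η x ^ 2 * v x)) := by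
      refine integral_congr_ae ?_
      filter_upwards [huv] with x hx
      rw [hx]; ring
    rw [e1, ← integral_sq_eq_nrm hvL, ← integral_const_mul]
    refine setIntegral_mono_on (hvL.integrable_sq.const_mul _)
      (integrable_bounded_mul_mul E.smooth_w.continuous hvL hvL) (measurableSet_halfBall 3)
      fun x hx => ?_
    rw [← sq]
    exact mul_le_mul_of_nonneg_right (E.le_w x hx) (sq_nonneg _)
  have h4 : B₁ * (nrm (fun x => W x * (χ x * u x)) * nrm (fun x => χ x * u x)) ≤ B₁ * (N * X) :=
    mul_le_mul_of_nonneg_left (mul_le_mul hN hX nrm_nonneg hN0) hB₁0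
  have h5 : 0 ≤ S₂ * (N * X + Z * X) := by positivity
  have h6 : 0 ≤ S₃ * (N * X + G * Y) := by positivity
  have h7 : 0 ≤ B₁ * (Z * X + G * Y + K * K) := by positivity
  rw [e] at h2
  linarith

/-- The second derivatives of a solution of `∂_i (A^ij ∂_j u) = w v`. -/
theorem exists_hessian_solution_le {η : EuclideanSpace ℝ (Fin (d + 1)) → ℝ} (hη : ContDiff ℝ ∞ η)
    (hηs : tsupport η ⊆ Metric.ball 0 2) :
    ∃ S, 0 ≤ S ∧ ∀ (u v : EuclideanSpace ℝ (Fin (d + 1)) → ℝ) (K Y G H : ℝ), MemH 3 u →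
      MemH 2 v → divOp E.A u =ᵐ[hbMeasure d] (fun x => E.w x * v x) →
      TraceBoundH Set.univ 2 u K → nrm (fun x => η x ^ 2 * v x) ≤ Y →
      (∀ j, nrm (fun x => η x * dW j u x) ≤ G) →
      (∀ a : Fin (d + 1) × Fin (d + 1), nrm (fun x => η x ^ 2 * dW a.1 (dW a.2 u) x) ≤ H) →
      E.lam * ∑ a : Fin (d + 1) × Fin (d + 1), nrm (fun x => η x ^ 2 * dW a.1 (dW a.2 u) x) ^ 2 ≤
        S * ((Y + G) ^ 2 + G * H + K ^ 2) := by
  obtain ⟨C₄, hC₄0, hC₄⟩ := exists_hessian_le E hη hηs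
  obtain ⟨T₁, hT₁0, hT₁⟩ := exists_bound_halfBall E.smooth_w.continuous
  obtain ⟨T₂, hT₂0, hT₂⟩ := exists_nrm_sum_le (Finset.univ : Finset (Fin (d + 1) × Fin (d + 1)))
    (m := fun a x => -(η x * pderiv a.1 (E.A a.1 a.2) x))
    (fun a => (hη.mul (contDiff_pderiv (E.smooth a.1 a.2) a.1)).continuous.neg)
  refine ⟨(T₁ + T₂) ^ 2 + C₄, by positivity, fun u v K Y G H hu hv huv hK hY hG hH => ?_⟩
  have hY0 : 0 ≤ Y := nrm_nonneg.trans hY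
  have hG0 : 0 ≤ G := nrm_nonneg.trans (hG 0)
  have hH0 : 0 ≤ H := nrm_nonneg.trans (hH (0, 0))
  have hvL : MemLp (fun x => η x ^ 2 * v x) 2 (hbMeasure d) :=
    hv.memLp_cutoff_mul (hη.pow 2).continuous
      (tsupport_pow_subset (tsupport_subset_three hηs) two_ne_zero)
  have hduL : ∀ j, MemLp (fun x => η x * dW j u x) 2 (hbMeasure d) := fun j =>
    (hu.deriv j).memLp_cutoff_mul hη.continuous (tsupport_subset_three hηs)
  have hd2 := hT₂ (fun a x => η x * dW a.2 u x) G (fun a => hduL a.2) (fun a => hG a.2)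
  have hwv : MemLp (fun x => E.w x * (η x ^ 2 * v x)) 2 (hbMeasure d) :=
    memLp_continuous_mul E.smooth_w.continuous hvL
  have hBn : nrm (fun x => η x ^ 2 * ∑ a : Fin (d + 1) × Fin (d + 1),
      E.A a.1 a.2 x * dW a.1 (dW a.2 u) x) ≤ T₁ * Y + T₂ * G := by
    have e1 : (fun x => η x ^ 2 * ∑ a : Fin (d + 1) × Fin (d + 1),
        E.A a.1 a.2 x * dW a.1 (dW a.2 u) x) =ᵐ[hbMeasure d] fun x =>
        E.w x * (η x ^ 2 * v x) + ∑ a : Fin (d + 1) × Fin (d + 1),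
          -(η x * pderiv a.1 (E.A a.1 a.2) x) * (η x * dW a.2 u x) := by
      filter_upwards [huv] with x hx
      have e2 : E.w x * (η x ^ 2 * v x) = η x ^ 2 * divOp E.A u x := by rw [hx]; ring
      rw [e2]
      unfold divOp
      rw [Finset.mul_sum, Finset.mul_sum, ← Finset.sum_add_distrib]
      refine Finset.sum_congr rfl fun a _ => ?_
      ring
    rw [nrm_congr e1]
    exact (nrm_add_le hwv hd2.1).trans (add_le_add
      ((nrm_mul_le hT₁0 hT₁ hvL).trans (mul_le_mul_of_nonneg_left hY hT₁0)) hd2.2)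
  have h1 := hC₄ u K (T₁ * Y + T₂ * G) G H hu hK hG hBn hH
  have h2 : (T₁ * Y + T₂ * G) ^ 2 ≤ ((T₁ + T₂) * (Y + G)) ^ 2 := by
    refine pow_le_pow_left₀ (by positivity) ?_ 2
    have : 0 ≤ T₁ * G + T₂ * Y := by positivity
    linarith
  rw [mul_pow] at h2
  have h3 : 0 ≤ (T₁ + T₂) ^ 2 * (G * H + K ^ 2) := by positivity
  have h4 : 0 ≤ C₄ * (Y + G) ^ 2 := by positivity
  linarith

/-- The Caccioppoli inequality for the system `∂_i (A^ij ∂_j u) = w v`, `∂_i (A^ij ∂_j v) = w W u`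
in terms of the trace bounds of `u` and `v`. -/
theorem exists_caccioppoli {η χ : EuclideanSpace ℝ (Fin (d + 1)) → ℝ} (hη : ContDiff ℝ ∞ η)
    (hηs : tsupport η ⊆ Metric.ball 0 2) (hχ : ContDiff ℝ ∞ χ)
    (hχs : tsupport χ ⊆ Metric.ball 0 2) (hηχ : ∀ x ∈ tsupport η, χ x = 1) :
    ∃ C, 0 ≤ C ∧ ∀ (u v W : EuclideanSpace ℝ (Fin (d + 1)) → ℝ) (M K : ℝ), 1 ≤ M →
      AEStronglyMeasurable W (hbMeasure d) → (∀ᵐ x ∂hbMeasure d, |W x| ≤ M) →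
      MemH 4 u → MemH 2 v →
      divOp E.A u =ᵐ[hbMeasure d] (fun x => E.w x * v x) →
      divOp E.A v =ᵐ[hbMeasure d] (fun x => E.w x * (W x * u x)) →
      TraceBoundH Set.univ 3 u K → TraceBoundH Set.univ 1 v K →
      (∀ j, nrm (fun x => η x ^ 3 * dW j v x) ≤ C * (M * nrm (fun x => χ x * u x) + K)) ∧
      (∀ j, nrm (fun x => η x * dW j u x) ≤ C * (M * nrm (fun x => χ x * u x) + K)) ∧
      ∀ i j, nrm (fun x => η x ^ 2 * dW i (dW j u) x) ≤
        C * (M * nrm (fun x => χ x * u x) + K) := by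
  obtain ⟨S₁, hS₁0, hS₁⟩ := exists_energy_source_le E hη hηs hηχ
  obtain ⟨S₂, hS₂0, hS₂⟩ := exists_energy_le E hη hηs hχ hχs hηχ
  obtain ⟨S₃, hS₃0, hS₃⟩ := exists_sq_le E hη hηs hχ hχs hηχ
  obtain ⟨S₄, hS₄0, hS₄⟩ := exists_hessian_solution_le E hη hηs
  have hlam := E.lam_pos
  obtain ⟨D, hD, hDS⟩ : ∃ D : ℝ, 1 ≤ D ∧ S₁ ≤ D * E.lam ∧ S₂ ≤ D * E.lam ∧ S₃ ≤ D * E.lam ∧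
      S₄ ≤ D * E.lam := by
    refine ⟨1 + (S₁ + S₂ + S₃ + S₄) / E.lam, ?_, ?_⟩
    · have : 0 ≤ (S₁ + S₂ + S₃ + S₄) / E.lam := by positivity
      linarith
    · rw [add_mul, div_mul_cancel₀ _ hlam.ne']
      refine ⟨?_, ?_, ?_, ?_⟩ <;> linarith
  obtain ⟨hD1, hD2, hD3, hD4⟩ := hDS
  have hDle : ∀ {y S s t : ℝ}, S ≤ D * E.lam → E.lam * y ≤ S * s → 0 ≤ s → s ≤ t →
      y ≤ D * t := by
    intro y S s t hS h hs hst
    have h1 : E.lam * y ≤ E.lam * (D * s) := by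
      calc E.lam * y ≤ S * s := h
        _ ≤ D * E.lam * s := mul_le_mul_of_nonneg_right hS hs
        _ = E.lam * (D * s) := by ring
    exact (le_of_mul_le_mul_left h1 hlam).trans (mul_le_mul_of_nonneg_left hst (by linarith))
  obtain ⟨N, hN⟩ : ∃ N, N = 40 * D ^ 3 + 1 := ⟨_, rfl⟩
  have hN1 : 1 ≤ N := by
    have : 0 ≤ 40 * D ^ 3 := by positivity
    linarith
  refine ⟨2 * D * (N + 2 * D * N), by positivity,
    fun u v W M K hM hWm hWb hu hv huv hvW hKu hKv => ?_⟩
  have huL : MemLp (fun x => χ x * u x) 2 (hbMeasure d) :=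
    hu.memLp_cutoff_mul hχ.continuous (tsupport_subset_three hχs)
  have hWbd : ∀ᵐ x ∂hbMeasure d, ‖W x * (χ x * u x)‖ ≤ M * ‖χ x * u x‖ := by
    filter_upwards [hWb] with x hx
    rw [norm_mul]
    exact mul_le_mul_of_nonneg_right hx (norm_nonneg _)
  have hWuL : MemLp (fun x => W x * (χ x * u x)) 2 (hbMeasure d) :=
    MemLp.of_le_mul huL (hWm.mul huL.1) hWbd
  have hWun : nrm (fun x => W x * (χ x * u x)) ≤ M * nrm (fun x => χ x * u x) := by
    have h1 := eLpNorm_le_mul_eLpNorm_of_ae_le_mul hWbd 2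
    have h2 := ENNReal.toReal_mono (ENNReal.mul_ne_top ENNReal.ofReal_ne_top huL.2.ne) h1
    rwa [ENNReal.toReal_mul, ENNReal.toReal_ofReal (by linarith)] at h2
  obtain ⟨X, hX⟩ : ∃ X, X = nrm fun x => χ x * u x := ⟨_, rfl⟩
  obtain ⟨Y, hY⟩ : ∃ Y, Y = nrm fun x => η x ^ 2 * v x := ⟨_, rfl⟩
  obtain ⟨Z, hZ⟩ : ∃ Z, Z = √(∑ j, nrm (fun x => η x ^ 3 * dW j v x) ^ 2) := ⟨_, rfl⟩
  obtain ⟨G, hG⟩ : ∃ G, G = √(∑ j, nrm (fun x => η x * dW j u x) ^ 2) := ⟨_, rfl⟩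
  obtain ⟨H, hH⟩ : ∃ H, H = √(∑ a : Fin (d + 1) × Fin (d + 1),
    nrm (fun x => η x ^ 2 * dW a.1 (dW a.2 u) x) ^ 2) := ⟨_, rfl⟩
  obtain ⟨A, hA⟩ : ∃ A, A = M * X + K := ⟨_, rfl⟩
  rw [← hX] at hWun ⊢
  rw [← hA]
  have hX0 : 0 ≤ X := hX ▸ nrm_nonneg
  have hK0 : 0 ≤ K := hKu.1.1
  have hXM : X ≤ M * X := le_mul_of_one_le_left hX0 hM
  have hXA : X ≤ A := by linarith
  have hMXA : M * X ≤ A := by linarith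
  have hKA : K ≤ A := by linarith
  have hA0 : 0 ≤ A := hK0.trans hKA
  have hY0 : 0 ≤ Y := hY ▸ nrm_nonneg
  have hZ0 : 0 ≤ Z := hZ ▸ Real.sqrt_nonneg _
  have hG0 : 0 ≤ G := hG ▸ Real.sqrt_nonneg _
  have hH0 : 0 ≤ H := hH ▸ Real.sqrt_nonneg _
  have hZj : ∀ j, nrm (fun x => η x ^ 3 * dW j v x) ≤ Z := fun j => by
    rw [hZ]; exact le_sqrt_sum_sq (fun j => nrm (fun x => η x ^ 3 * dW j v x)) j
  have hGj : ∀ j, nrm (fun x => η x * dW j u x) ≤ G := fun j => by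
    rw [hG]; exact le_sqrt_sum_sq (fun j => nrm (fun x => η x * dW j u x)) j
  have hHj : ∀ a : Fin (d + 1) × Fin (d + 1), nrm (fun x => η x ^ 2 * dW a.1 (dW a.2 u) x) ≤ H :=
    fun a => by
      rw [hH]
      exact le_sqrt_sum_sq (fun a : Fin (d + 1) × Fin (d + 1) =>
        nrm (fun x => η x ^ 2 * dW a.1 (dW a.2 u) x)) a
  have hZ2 : Z ^ 2 = ∑ j, nrm (fun x => η x ^ 3 * dW j v x) ^ 2 := by
    rw [hZ]; exact Real.sq_sqrt (Finset.sum_nonneg fun _ _ => sq_nonneg _)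
  have hG2 : G ^ 2 = ∑ j, nrm (fun x => η x * dW j u x) ^ 2 := by
    rw [hG]; exact Real.sq_sqrt (Finset.sum_nonneg fun _ _ => sq_nonneg _)
  have hH2 : H ^ 2 = ∑ a : Fin (d + 1) × Fin (d + 1),
      nrm (fun x => η x ^ 2 * dW a.1 (dW a.2 u) x) ^ 2 := by
    rw [hH]; exact Real.sq_sqrt (Finset.sum_nonneg fun _ _ => sq_nonneg _)
  have hu2 : MemH 2 u := hu.mono (by norm_num)
  have hKK : K * K ≤ A ^ 2 := by rw [sq]; exact mul_le_mul hKA hKA hK0 hA0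
  have hMX0 : 0 ≤ M * X := hX0.trans hXM
  have E1 : Z ^ 2 ≤ D * (A * Y + Z * Y + A ^ 2) := by
    have h1 := hS₁ u v W K (M * X) Y Z hv hWuL hvW hKv hWun hY.ge hZj
    rw [← hZ2] at h1
    refine hDle hD1 h1 (by positivity) ?_
    have := mul_le_mul_of_nonneg_right hMXA hY0
    linarith
  have E2 : G ^ 2 ≤ D * (Y * A + G * A + A ^ 2) := by
    have h1 := hS₂ u v K X Y G hu2 hv huv hKu.pred.pred hX.ge hY.ge hGj
    rw [← hG2] at h1
    refine hDle hD2 h1 (by positivity) ?_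
    have h2 := mul_le_mul_of_nonneg_left hXA hY0
    have h3 := mul_le_mul_of_nonneg_left hXA hG0
    linarith
  have E3 : Y ^ 2 ≤ D * (2 * A ^ 2 + Z * A + G * Y) := by
    have h1 := hS₃ u v W K (M * X) X Y Z G hu2 hv hWuL huv hvW hKu.pred.pred hKv hWun hX.ge hY.ge
      hZj hGj
    rw [← hY] at h1
    refine hDle hD3 h1 (by positivity) ?_
    have h2 := mul_le_mul_of_nonneg_left hXA hZ0
    have h3 : M * X * X ≤ A * A := mul_le_mul hMXA hXA hX0 hA0
    linarith
  have E4 : H ^ 2 ≤ D * ((Y + G + A) * (Y + G + A + H)) := by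
    have h1 := hS₄ u v K Y G H (hu.mono (by norm_num)) hv huv hKu.pred hY.ge hGj hHj
    rw [← hH2] at h1
    refine hDle hD4 h1 (by positivity) ?_
    have h2 := mul_nonneg (add_nonneg hY0 hA0) hH0
    have h3 := mul_nonneg (add_nonneg hY0 hG0) hA0
    linarith
  have hD2' : (1 : ℝ) ≤ 2 * D := by linarith
  have hYle := le_of_energy_system hD hA0 hG0 hY0 hZ0 E1 E2 E3
  have hYAle : Y + A ≤ N * A := by rw [hN]; linarith
  have hZle : Z ≤ 2 * D * (Y + A) := by
    refine le_two_mul_of_sq_le hD (by linarith) hZ0 (E1.trans ?_)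
    refine mul_le_mul_of_nonneg_left ?_ (by linarith)
    have h2 := mul_nonneg hZ0 hA0
    have h3 := mul_nonneg hY0 hA0
    linarith [sq_nonneg Y]
  have hGle : G ≤ 2 * D * (Y + A) := by
    refine le_two_mul_of_sq_le hD (by linarith) hG0 (E2.trans ?_)
    refine mul_le_mul_of_nonneg_left ?_ (by linarith)
    have h2 := mul_nonneg hG0 hY0
    have h3 := mul_nonneg hY0 hA0
    linarith [sq_nonneg Y]
  have hHle : H ≤ 2 * D * (Y + G + A) := le_two_mul_of_sq_le hD (by linarith) hH0 E4
  have hstep : 2 * D * (Y + A) ≤ 2 * D * (N * A) :=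
    mul_le_mul_of_nonneg_left hYAle (by linarith)
  have hext : 2 * D * (N * A) ≤ 2 * D * (N + 2 * D * N) * A := by
    have : 0 ≤ 2 * D * (2 * D * N) * A := by positivity
    linarith
  refine ⟨fun j => (hZj j).trans (hZle.trans (hstep.trans hext)),
    fun j => (hGj j).trans (hGle.trans (hstep.trans hext)), fun i j => ?_⟩
  refine (hHj (i, j)).trans (hHle.trans ?_)
  rw [mul_assoc (2 * D) (N + 2 * D * N) A]
  refine mul_le_mul_of_nonneg_left ?_ (by linarith)
  have := hGle.trans hstep
  linarith

end Caccioppoli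

/-! ### Smooth coefficients built from the metric -/

section Coefficients

theorem exists_contDiff_cutoff {n : ℕ} {K V : Set (EuclideanSpace ℝ (Fin n))} (hK : IsClosed K)
    (hV : IsOpen V) (hKV : K ⊆ V) :
    ∃ χ : EuclideanSpace ℝ (Fin n) → ℝ, ContDiff ℝ ∞ χ ∧ tsupport χ ⊆ V ∧ (∀ x ∈ K, χ x = 1) ∧
      ∀ x, |χ x| ≤ 1 := by
  obtain ⟨f, h0, h1, hf⟩ := exists_contMDiffMap_zero_one_nhds_of_isClosed
    (modelWithCornersSelf ℝ (EuclideanSpace ℝ (Fin n))) (n := (⊤ : ℕ∞)) hV.isClosed_compl hK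
    (Set.disjoint_left.2 fun x hx hx' => hx (hKV hx'))
  refine ⟨f, f.contMDiff.contDiff, fun x hx => ?_, fun x hx => h1.self_of_nhdsSet x hx,
    fun x => abs_le.2 ⟨by linarith [(hf x).1], (hf x).2⟩⟩
  by_contra hxV
  exact notMem_tsupport_iff_eventuallyEq.2 (h0.filter_mono (nhds_le_nhdsSet hxV)) hx

/-- A function that is smooth near a compact set agrees on it with a smooth function on the whole
space. -/
theorem exists_contDiff_eqOn {n : ℕ} {K V : Set (EuclideanSpace ℝ (Fin n))} (hK : IsClosed K)
    (hV : IsOpen V) (hKV : K ⊆ V) {f : EuclideanSpace ℝ (Fin n) → ℝ} (hf : ContDiffOn ℝ ∞ f V) :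
    ∃ F : EuclideanSpace ℝ (Fin n) → ℝ, ContDiff ℝ ∞ F ∧ ∀ x ∈ K, F x = f x := by
  obtain ⟨χ, hχ, hχs, h1, -⟩ := exists_contDiff_cutoff hK hV hKV
  refine ⟨fun x => χ x * f x, contDiff_iff_contDiffAt.2 fun x => ?_, fun x hx => by
    simp only [h1 x hx, one_mul]⟩
  by_cases hx : x ∈ V
  · exact hχ.contDiffAt.mul ((hf x hx).contDiffAt (hV.mem_nhds hx))
  · have h2 : (fun x => χ x * f x) =ᶠ[𝓝 x] fun _ => 0 := by
      filter_upwards [(isClosed_tsupport χ).isOpen_compl.mem_nhds fun h => hx (hχs h)] with y hy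
      rw [image_eq_zero_of_notMem_tsupport hy, zero_mul]
    exact contDiffAt_const.congr_of_eventuallyEq h2

theorem contDiffOn_det {E ι : Type*} [NormedAddCommGroup E] [NormedSpace ℝ E] [Fintype ι]
    [DecidableEq ι] {V : Set E} {B : E → Matrix ι ι ℝ}
    (hB : ∀ i j, ContDiffOn ℝ ∞ (fun x => B x i j) V) :
    ContDiffOn ℝ ∞ (fun x => (B x).det) V := by
  simp only [Matrix.det_apply']
  exact ContDiffOn.sum fun σ _ => contDiffOn_const.mul (contDiffOn_prod fun i _ => hB _ _)

theorem contDiffOn_inv_apply {E ι : Type*} [NormedAddCommGroup E] [NormedSpace ℝ E] [Fintype ι]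
    [DecidableEq ι] {V : Set E} {B : E → Matrix ι ι ℝ}
    (hB : ∀ i j, ContDiffOn ℝ ∞ (fun x => B x i j) V) (hdet : ∀ x ∈ V, (B x).det ≠ 0) (i j : ι) :
    ContDiffOn ℝ ∞ (fun x => (B x)⁻¹ i j) V := by
  simp only [Matrix.inv_def, Ring.inverse_eq_inv', Matrix.smul_apply, smul_eq_mul,
    Matrix.adjugate_apply]
  refine ((contDiffOn_det hB).fun_inv hdet).mul (contDiffOn_det fun k l => ?_)
  by_cases hk : k = j
  · subst hk
    simp only [Matrix.updateRow_self]
    exact contDiffOn_const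
  · simp only [Matrix.updateRow_ne hk]
    exact hB k l

theorem contDiffOn_pderiv {n : ℕ} {V : Set (EuclideanSpace ℝ (Fin n))} (hV : IsOpen V)
    {f : EuclideanSpace ℝ (Fin n) → ℝ} (hf : ContDiffOn ℝ ∞ f V) (i : Fin n) :
    ContDiffOn ℝ ∞ (pderiv i f) V :=
  (hf.fderiv_of_isOpen hV (m := ∞) (by simp)).clm_apply contDiffOn_const

/-- A continuous family of positive quadratic forms over a compact set is uniformly positive. -/
theorem exists_pos_le_quadratic {X ι : Type*} [TopologicalSpace X] [Fintype ι] {K : Set X}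
    (hK : IsCompact K) {B : X → ι → ι → ℝ} (hB : ∀ i j, ContinuousOn (fun x => B x i j) K)
    (hpos : ∀ x ∈ K, ∀ ξ : ι → ℝ, ξ ≠ 0 → 0 < ∑ a : ι × ι, B x a.1 a.2 * (ξ a.1 * ξ a.2)) :
    ∃ c, 0 < c ∧ ∀ x ∈ K, ∀ ξ : ι → ℝ,
      c * ∑ i, ξ i ^ 2 ≤ ∑ a : ι × ι, B x a.1 a.2 * (ξ a.1 * ξ a.2) := by
  have hS : IsCompact {ξ : ι → ℝ | ∑ i, ξ i ^ 2 = 1} := by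
    refine Metric.isCompact_of_isClosed_isBounded
      (isClosed_eq (by fun_prop) continuous_const) ?_
    refine (Metric.isBounded_closedBall (x := (0 : ι → ℝ)) (r := 1)).subset fun ξ hξ => ?_
    rw [mem_closedBall_zero_iff, pi_norm_le_iff_of_nonneg zero_le_one]
    intro i
    have h1 : ξ i ^ 2 ≤ ∑ i, ξ i ^ 2 :=
      Finset.single_le_sum (f := fun i => ξ i ^ 2) (fun _ _ => sq_nonneg _) (Finset.mem_univ i)
    rw [hξ.out] at h1
    exact (sq_le_one_iff_abs_le_one _).1 h1
  obtain ⟨c, hc, hle⟩ := (hK.prod hS).exists_forall_le'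
    (f := fun p : X × (ι → ℝ) => ∑ a : ι × ι, B p.1 a.1 a.2 * (p.2 a.1 * p.2 a.2)) (a := 0)
    (continuousOn_finsetSum _ fun a _ => ((hB a.1 a.2).comp continuousOn_fst
      fun p hp => hp.1).mul (by fun_prop))
    (fun p hp => hpos p.1 hp.1 p.2 fun h => by
      have := hp.2
      rw [h] at this
      simp at this)
  refine ⟨c, hc, fun x hx ξ => ?_⟩
  obtain ⟨s, hs⟩ : ∃ s, s = ∑ i, ξ i ^ 2 := ⟨_, rfl⟩
  have hs0 : 0 ≤ s := hs ▸ Finset.sum_nonneg fun _ _ => sq_nonneg _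
  rcases hs0.eq_or_lt with h0 | h0
  · have hξ : ξ = 0 := by
      funext i
      have := (Finset.sum_eq_zero_iff_of_nonneg fun i _ => sq_nonneg (ξ i)).1
        (hs.symm.trans h0.symm)
        i (Finset.mem_univ i)
      simpa using this
    simp [hξ]
  · have hr : √s ^ 2 = s := Real.sq_sqrt hs0
    have hr0 : 0 < √s := Real.sqrt_pos.2 h0
    have h1 := hle (x, fun i => ξ i / √s) ⟨hx, by
      simp only [Set.mem_ofPred_eq, div_pow, hr, ← Finset.sum_div, ← hs]
      exact div_self h0.ne'⟩
    have h2 : ∑ a : ι × ι, B x a.1 a.2 * (ξ a.1 / √s * (ξ a.2 / √s)) =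
        (∑ a : ι × ι, B x a.1 a.2 * (ξ a.1 * ξ a.2)) / s := by
      rw [Finset.sum_div]
      refine Finset.sum_congr rfl fun a _ => ?_
      rw [div_mul_div_comm, ← sq, hr, ← mul_div_assoc]
    simp only at h1
    rw [h2, le_div_iff₀ h0] at h1
    rwa [← hs]

theorem _root_.Matrix.PosDef.sum_mul_pos {ι : Type*} [Fintype ι] {B : Matrix ι ι ℝ}
    (hB : B.PosDef) {ξ : ι → ℝ} (hξ : ξ ≠ 0) : 0 < ∑ a : ι × ι, B a.1 a.2 * (ξ a.1 * ξ a.2) := by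
  have h := hB.dotProduct_mulVec_pos hξ
  refine h.trans_eq ?_
  simp only [dotProduct, Matrix.mulVec, Fintype.sum_prod_type, Finset.mul_sum]
  refine Finset.sum_congr rfl fun i _ => Finset.sum_congr rfl fun j _ => ?_
  simp only [star_trivial]
  ring

variable {d : ℕ}

theorem isCompact_closure_halfBall (R : ℝ) : IsCompact (closure (halfBall d R)) :=
  (isCompact_closedBall (0 : EuclideanSpace ℝ (Fin (d + 1))) R).of_isClosed_subset isClosed_closure
    (closure_minimal (fun _ hx => mem_closedBall_zero_iff.2 hx.1.le) Metric.isClosed_closedBall)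

/-- Smooth functions on the whole space that represent on the half ball of radius 3 the density of
the Riemannian measure, the inverse metric, the normal field and the Christoffel symbols. -/
structure SmoothModel (g : MetricCoeff (d + 1)) where
  /-- The density `√(det g)`. -/
  rho : EuclideanSpace ℝ (Fin (d + 1)) → ℝ
  /-- The inverse of the density. -/
  rhoInv : EuclideanSpace ℝ (Fin (d + 1)) → ℝ
  /-- The inverse metric. -/
  ginv : Fin (d + 1) → Fin (d + 1) → EuclideanSpace ℝ (Fin (d + 1)) → ℝ
  /-- The unit normal. -/
  nu : Fin (d + 1) → EuclideanSpace ℝ (Fin (d + 1)) → ℝ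
  /-- The inverse of the last component of the unit normal. -/
  nuInv : EuclideanSpace ℝ (Fin (d + 1)) → ℝ
  /-- The Christoffel symbols. -/
  chr : Fin (d + 1) → Fin (d + 1) → Fin (d + 1) → EuclideanSpace ℝ (Fin (d + 1)) → ℝ
  /-- The ellipticity constant. -/
  lam : ℝ
  smooth_rho : ContDiff ℝ ∞ rho
  smooth_rhoInv : ContDiff ℝ ∞ rhoInv
  smooth_ginv : ∀ i j, ContDiff ℝ ∞ (ginv i j)
  smooth_nu : ∀ i, ContDiff ℝ ∞ (nu i)
  smooth_nuInv : ContDiff ℝ ∞ nuInv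
  smooth_chr : ∀ k i j, ContDiff ℝ ∞ (chr k i j)
  rho_eq : ∀ x ∈ halfBall d 3, rho x = √(g x).det
  rhoInv_eq : ∀ x ∈ halfBall d 3, rhoInv x = (√(g x).det)⁻¹
  ginv_eq : ∀ x ∈ halfBall d 3, ∀ i j, ginv i j x = (g x)⁻¹ i j
  nu_eq : ∀ x ∈ halfBall d 3, ∀ i, nu i x = normal g x i
  nuInv_mul : ∀ x ∈ halfBall d 3, nuInv x * nu (Fin.last d) x = 1
  chr_eq : ∀ x ∈ halfBall d 3, ∀ k i j, chr k i j x = christoffel g k i j x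
  symm : ∀ x ∈ halfBall d 3, ∀ i j, ginv i j x = ginv j i x
  lam_pos : 0 < lam
  le_rho : ∀ x ∈ halfBall d 3, lam ≤ rho x
  elliptic : ∀ x ∈ halfBall d 3, ∀ ξ : Fin (d + 1) → ℝ, lam * ∑ i, ξ i ^ 2 ≤
    ∑ a : Fin (d + 1) × Fin (d + 1), rho x * ginv a.1 a.2 x * (ξ a.1 * ξ a.2)
  elliptic_tensor : ∀ x ∈ halfBall d 3, ∀ ξ : Fin (d + 1) × Fin (d + 1) → ℝ, lam * ∑ i, ξ i ^ 2 ≤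
    ∑ a : (Fin (d + 1) × Fin (d + 1)) × (Fin (d + 1) × Fin (d + 1)),
      (rho x * ginv a.1.1 a.2.1 x) * (rho x * ginv a.1.2 a.2.2 x) * (ξ a.1 * ξ a.2)

theorem exists_smoothModel {g : MetricCoeff (d + 1)}
    (hg : IsSmoothMetricNear (closure (halfBall d 3)) g) : Nonempty (SmoothModel g) := by
  obtain ⟨V, hV, hKV, hgs, hgp⟩ := hg
  have hK := isCompact_closure_halfBall (d := d) 3
  have hsub : halfBall d 3 ⊆ closure (halfBall d 3) := subset_closure
  have hdet : ∀ x ∈ V, 0 < (g x).det := fun x hx => (hgp x hx).det_pos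
  have hsq : ∀ x ∈ V, 0 < √(g x).det := fun x hx => Real.sqrt_pos.2 (hdet x hx)
  have hinv : ∀ i j, ContDiffOn ℝ ∞ (fun x => (g x)⁻¹ i j) V :=
    contDiffOn_inv_apply hgs fun x hx => (hdet x hx).ne'
  have hrho : ContDiffOn ℝ ∞ (fun x => √(g x).det) V :=
    (contDiffOn_det hgs).sqrt fun x hx => (hdet x hx).ne'
  have hnn : ∀ x ∈ V, 0 < (g x)⁻¹ (Fin.last d) (Fin.last d) := fun x hx =>
    (hgp x hx).inv.diag_pos
  have hsn : ContDiffOn ℝ ∞ (fun x => √((g x)⁻¹ (Fin.last d) (Fin.last d))) V :=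
    (hinv _ _).sqrt fun x hx => (hnn x hx).ne'
  have hsn0 : ∀ x ∈ V, √((g x)⁻¹ (Fin.last d) (Fin.last d)) ≠ 0 := fun x hx =>
    (Real.sqrt_pos.2 (hnn x hx)).ne'
  have hnormal : ∀ i, ContDiffOn ℝ ∞ (fun x => normal g x i) V := fun i =>
    (hinv _ _).neg.div hsn hsn0
  have hchr : ∀ k i j, ContDiffOn ℝ ∞ (fun x => christoffel g k i j x) V := fun k i j =>
    contDiffOn_const.mul (ContDiffOn.sum fun l _ => (hinv k l).mul
      (((contDiffOn_pderiv hV (hgs j l) i).add (contDiffOn_pderiv hV (hgs i l) j)).sub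
        (contDiffOn_pderiv hV (hgs i j) l)))
  have hnuInv : ContDiffOn ℝ ∞ (fun x => -(√((g x)⁻¹ (Fin.last d) (Fin.last d)))⁻¹) V :=
    (hsn.fun_inv hsn0).neg
  obtain ⟨rho, hr, hre⟩ := exists_contDiff_eqOn hK.isClosed hV hKV hrho
  obtain ⟨rhoInv, hri, hrie⟩ := exists_contDiff_eqOn hK.isClosed hV hKV
    (hrho.fun_inv fun x hx => (hsq x hx).ne')
  choose ginv hgi hgie using fun i j => exists_contDiff_eqOn hK.isClosed hV hKV (hinv i j)
  choose nu hn hne using fun i => exists_contDiff_eqOn hK.isClosed hV hKV (hnormal i)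
  choose chr hc hce using fun k i j => exists_contDiff_eqOn hK.isClosed hV hKV (hchr k i j)
  obtain ⟨nuInv, hni, hnie⟩ := exists_contDiff_eqOn hK.isClosed hV hKV hnuInv
  have hpd : ∀ x ∈ closure (halfBall d 3), (√(g x).det • (g x)⁻¹).PosDef := fun x hx =>
    (hgp x (hKV hx)).inv.smul (hsq x (hKV hx))
  obtain ⟨c₀, hc₀, hle₀⟩ := hK.exists_forall_le' (f := fun x => √(g x).det) (a := 0)
    (hrho.continuousOn.mono hKV) fun x hx => hsq x (hKV hx)
  obtain ⟨c₁, hc₁, hle₁⟩ := exists_pos_le_quadratic hK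
    (B := fun x i j => rho x * ginv i j x)
    (fun i j => (hr.continuous.mul (hgi i j).continuous).continuousOn) (by
      intro x hx ξ hξ
      have := (hpd x hx).sum_mul_pos hξ
      simpa only [hre x hx, hgie _ _ x hx, Matrix.smul_apply, smul_eq_mul] using this)
  obtain ⟨c₂, hc₂, hle₂⟩ := exists_pos_le_quadratic hK
    (B := fun x (p q : Fin (d + 1) × Fin (d + 1)) =>
      (rho x * ginv p.1 q.1 x) * (rho x * ginv p.2 q.2 x))
    (fun p q => ((hr.continuous.mul (hgi p.1 q.1).continuous).mul
      (hr.continuous.mul (hgi p.2 q.2).continuous)).continuousOn) (by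
      intro x hx ξ hξ
      have := ((hpd x hx).kronecker (hpd x hx)).sum_mul_pos hξ
      simpa only [hre x hx, hgie _ _ x hx, Matrix.kroneckerMap_apply, Matrix.smul_apply,
        smul_eq_mul] using this)
  refine ⟨⟨rho, rhoInv, ginv, nu, nuInv, chr, min c₀ (min c₁ c₂), hr, hri, hgi, hn, hni, hc,
    fun x hx => hre x (hsub hx), fun x hx => hrie x (hsub hx), fun x hx i j => hgie i j x (hsub hx),
    fun x hx i => hne i x (hsub hx), fun x hx => ?_, fun x hx k i j => hce k i j x (hsub hx),
    fun x hx i j => ?_, by positivity, fun x hx => ?_, fun x hx ξ => ?_, fun x hx ξ => ?_⟩⟩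
  · have hxV := hKV (hsub hx)
    rw [hnie x (hsub hx), hne _ x (hsub hx)]
    have h1 : √((g x)⁻¹ (Fin.last d) (Fin.last d)) ^ 2 = (g x)⁻¹ (Fin.last d) (Fin.last d) :=
      Real.sq_sqrt (hnn x hxV).le
    have h2 := hsn0 x hxV
    unfold normal
    rw [neg_div, neg_mul_neg]
    nth_rw 2 [← h1]
    field_simp
  · rw [hgie i j x (hsub hx), hgie j i x (hsub hx)]
    exact ((hgp x (hKV (hsub hx))).inv.isHermitian.apply i j).symm
  · rw [hre x (hsub hx)]
    exact (min_le_left _ _).trans (hle₀ x (hsub hx))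
  · refine (mul_le_mul_of_nonneg_right ((min_le_right _ _).trans (min_le_left _ _))
      (Finset.sum_nonneg fun _ _ => sq_nonneg _)).trans (hle₁ x (hsub hx) ξ)
  · refine (mul_le_mul_of_nonneg_right ((min_le_right _ _).trans (min_le_right _ _))
      (Finset.sum_nonneg fun _ _ => sq_nonneg _)).trans (hle₂ x (hsub hx) ξ)

/-- The Laplace-Beltrami operator is, up to the density, in divergence form with these
coefficients. -/
def SmoothModel.ellipticCoeffs {g : MetricCoeff (d + 1)} (S : SmoothModel g) :
    EllipticCoeffs d where
  A i j x := S.rho x * S.ginv i j x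
  w := S.rho
  lam := S.lam
  smooth i j := S.smooth_rho.mul (S.smooth_ginv i j)
  smooth_w := S.smooth_rho
  lam_pos := S.lam_pos
  symm x hx i j := by rw [S.symm x hx i j]
  le_w := S.le_rho
  elliptic := S.elliptic
  elliptic_tensor := S.elliptic_tensor

end Coefficients

/-! ### The Laplace-Beltrami operator and the normal derivative -/

section Geometry

variable {d : ℕ} {g : MetricCoeff (d + 1)} {f u W : EuclideanSpace ℝ (Fin (d + 1)) → ℝ}

theorem ae_of_forall_halfBall {p : EuclideanSpace ℝ (Fin (d + 1)) → Prop} {r : ℝ}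
    (h : ∀ x ∈ halfBall d r, p x) : ∀ᵐ x ∂volume.restrict (halfBall d r), p x := by
  filter_upwards [ae_restrict_mem (measurableSet_halfBall r)] with x hx using h x hx

theorem laplace_ae_eq (S : SmoothModel g) (hf : MemH 2 f) :
    laplace g (halfBall d 3) f =ᵐ[hbMeasure d]
    fun x => S.rhoInv x * divOp S.ellipticCoeffs.A f x := by
  have hA : ∀ i j, ContDiff ℝ ∞ (S.ellipticCoeffs.A i j) := S.ellipticCoeffs.smooth
  have e : ∀ i, dW i (fun z => √(g z).det * ∑ j, (g z)⁻¹ i j * dW j f z) =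
      dW i fun z => ∑ j, S.ellipticCoeffs.A i j z * dW j f z := fun i =>
    dW_ae_eq_of_ae_eq (ae_of_forall_halfBall fun z hz => by
      rw [← S.rho_eq z hz, Finset.mul_sum]
      refine Finset.sum_congr rfl fun j _ => ?_
      rw [← S.ginv_eq z hz]
      exact (mul_assoc _ _ _).symm) i
  have h1 : ∀ i, dW i (fun z => ∑ j, S.ellipticCoeffs.A i j z * dW j f z) =ᵐ[hbMeasure d]
      fun x => ∑ j, dW i (fun z => S.ellipticCoeffs.A i j z * dW j f z) x := fun i =>
    dW_sum _ (fun j _ => MemH.smooth_mul (hA i j) (hf.deriv j)) i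
  have h2 : ∀ i j, dW i (fun z => S.ellipticCoeffs.A i j z * dW j f z) =ᵐ[hbMeasure d]
      fun x => pderiv i (S.ellipticCoeffs.A i j) x * dW j f x +
        S.ellipticCoeffs.A i j x * dW i (dW j f) x := fun i j =>
    dW_smooth_mul (hA i j) (hf.deriv j) i
  filter_upwards [ae_all_iff.2 h1, ae_all_iff.2 fun i => ae_all_iff.2 (h2 i),
    ae_restrict_mem (measurableSet_halfBall 3)] with x hx1 hx2 hx
  unfold laplace divOp
  rw [← S.rhoInv_eq x hx]
  congr 1
  rw [Fintype.sum_prod_type]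
  refine Finset.sum_congr rfl fun i _ => ?_
  refine (congrFun (e i) x).trans ((hx1 i).trans (Finset.sum_congr rfl fun j _ => ?_))
  rw [hx2 i j, add_comm]

theorem memH_laplace (S : SmoothModel g) {k : ℕ} (hf : MemH (k + 2) f) :
    MemH k (laplace g (halfBall d 3) f) :=
  MemH.congr (MemH.smooth_mul S.smooth_rhoInv (memH_divOp S.ellipticCoeffs hf))
    (laplace_ae_eq S (hf.mono (by omega))).symm

theorem divOp_ae_eq_of_laplace (S : SmoothModel g) (hf : MemH 2 f)
    (h : laplace g (halfBall d 3) f =ᵐ[hbMeasure d] W) :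
    divOp S.ellipticCoeffs.A f =ᵐ[hbMeasure d] fun x => S.ellipticCoeffs.w x * W x := by
  have hpos := S.lam_pos
  filter_upwards [h, laplace_ae_eq S hf, ae_restrict_mem (measurableSet_halfBall 3)]
    with x h1 h2 hx
  have h3 := S.le_rho x hx
  have h4 : S.rho x * S.rhoInv x = 1 := by
    rw [S.rhoInv_eq x hx, ← S.rho_eq x hx]
    exact mul_inv_cancel₀ (by linarith)
  rw [← h1, h2]
  change _ = S.rho x * _
  rw [← mul_assoc, h4, one_mul]

theorem normalDeriv_ae_eq (S : SmoothModel g) (f : EuclideanSpace ℝ (Fin (d + 1)) → ℝ) :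
    normalDeriv g (halfBall d 3) f =ᵐ[hbMeasure d] fun x => ∑ i, S.nu i x * dW i f x :=
  ae_of_forall_halfBall fun x hx => by
    unfold normalDeriv
    simp only [S.nu_eq x hx]

theorem memH_iterate_normalDeriv (S : SmoothModel g) : ∀ (j : ℕ) {k : ℕ}, MemH (k + j) u →
    MemH k ((normalDeriv g (halfBall d 3))^[j] u)
  | 0, _, hu => hu
  | j + 1, k, hu => by
    rw [Function.iterate_succ_apply']
    have h := memH_iterate_normalDeriv S j (k := k + 1) (hu.mono (by omega))
    exact MemH.congr (MemH.sum _ fun i _ => MemH.smooth_mul (S.smooth_nu i) (h.deriv i))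
      (normalDeriv_ae_eq S _).symm

/-- The norms of the normal derivatives on the flat boundary control the traces of all derivatives
up to order three. -/
theorem exists_traceBoundH_three (S : SmoothModel g) : ∃ C, 0 ≤ C ∧
    ∀ (u : EuclideanSpace ℝ (Fin (d + 1)) → ℝ) (K : ℝ),
    0 ≤ K → MemH 4 u → (∀ j ∈ Finset.range 4, bdrySobolevNorm d 2 3 (3 - j)
      ((normalDeriv g (halfBall d 3))^[j] u) ≤ ENNReal.ofReal K) →
    TraceBoundH Set.univ 3 u (C * K) := by
  obtain ⟨C₀, hC₀, h₀⟩ := exists_traceBoundH_of_transversal S.smooth_nu S.smooth_nuInv S.nuInv_mul 0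
  obtain ⟨C₁, hC₁, h₁⟩ := exists_traceBoundH_of_transversal S.smooth_nu S.smooth_nuInv S.nuInv_mul 1
  obtain ⟨C₂, hC₂, h₂⟩ := exists_traceBoundH_of_transversal S.smooth_nu S.smooth_nuInv S.nuInv_mul 2
  refine ⟨C₂ * ((C₁ + 1) * (C₀ + 1)), by positivity, fun u K hK hu hb => ?_⟩
  obtain ⟨N, hN⟩ : ∃ N, N = normalDeriv g (halfBall d 3) := ⟨_, rfl⟩
  have hm : ∀ j {k : ℕ}, MemH (k + j) u → MemH k (N^[j] u) := fun j _ h => by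
    rw [hN]; exact memH_iterate_normalDeriv S j h
  have hNae : ∀ f, N f =ᵐ[hbMeasure d] fun x => ∑ i, S.nu i x * dW i f x := fun f => by
    rw [hN]; exact normalDeriv_ae_eq S f
  rw [← hN] at hb
  have t : ∀ j k, j + k = 3 → TraceBoundH (tang d) k (N^[j] u) K := by
    intro j k hjk
    have h := hb j (Finset.mem_range.2 (by omega))
    rw [show 3 - j = k by omega] at h
    exact traceBoundH_of_bdrySobolevNorm_le hK (hm j (hu.mono (by omega))) h
  have hK1 : K ≤ (C₀ + 1) * K := le_mul_of_one_le_left hK (by linarith)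
  have hK1' : C₀ * K ≤ (C₀ + 1) * K := mul_le_mul_of_nonneg_right (by linarith) hK
  have hK2 : (C₀ + 1) * K ≤ (C₁ + 1) * ((C₀ + 1) * K) :=
    le_mul_of_one_le_left (hK.trans hK1) (by linarith)
  have hK2' : C₁ * ((C₀ + 1) * K) ≤ (C₁ + 1) * ((C₀ + 1) * K) :=
    mul_le_mul_of_nonneg_right (by linarith) (hK.trans hK1)
  have s3 : TraceBoundH Set.univ 0 (N (N (N u))) K := (t 3 0 rfl).traceBound
  have s2 : TraceBoundH Set.univ 1 (N (N u)) ((C₀ + 1) * K) :=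
    (h₀ _ K (hm 2 (k := 2) hu) (s3.congr (hNae _)) (t 2 1 rfl)).mono hK1'
  have s1 : TraceBoundH Set.univ 2 (N u) ((C₁ + 1) * ((C₀ + 1) * K)) :=
    (h₁ _ _ (hm 1 (k := 3) hu) (s2.congr (hNae _)) ((t 1 2 rfl).mono hK1)).mono hK2'
  have s0 := h₂ u _ hu (s1.congr (hNae _)) ((t 0 3 rfl).mono (hK1.trans hK2))
  convert s0 using 1
  ring

theorem exists_traceBoundH_laplace (S : SmoothModel g) : ∃ C, 0 ≤ C ∧
    ∀ (u : EuclideanSpace ℝ (Fin (d + 1)) → ℝ) (K : ℝ), MemH 4 u → TraceBoundH Set.univ 3 u K →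
      TraceBoundH Set.univ 1 (laplace g (halfBall d 3) u) (C * K) := by
  have hA : ∀ i j, ContDiff ℝ ∞ (S.ellipticCoeffs.A i j) := S.ellipticCoeffs.smooth
  obtain ⟨C₁, hC₁, h₁⟩ := exists_traceBoundH_sum_smooth_mul (Set.univ : Set (Fin (d + 1))) 1
    (Finset.univ : Finset (Fin (d + 1) × Fin (d + 1)))
    (a := fun a => S.ellipticCoeffs.A a.1 a.2) (fun a => hA a.1 a.2)
  obtain ⟨C₂, hC₂, h₂⟩ := exists_traceBoundH_sum_smooth_mul (Set.univ : Set (Fin (d + 1))) 1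
    (Finset.univ : Finset (Fin (d + 1) × Fin (d + 1)))
    (a := fun a => pderiv a.1 (S.ellipticCoeffs.A a.1 a.2))
    (fun a => contDiff_pderiv (hA a.1 a.2) _)
  obtain ⟨C₃, hC₃, h₃⟩ := exists_traceBoundH_smooth_mul (Set.univ : Set (Fin (d + 1))) 1
    S.smooth_rhoInv
  refine ⟨C₃ * (C₁ + C₂), by positivity, fun u K hu hK => ?_⟩
  have m1 : ∀ i j, MemH 2 (dW i (dW j u)) := fun i j => (hu.deriv j).deriv i
  have m2 : ∀ j, MemH 2 (dW j u) := fun j => (hu.deriv j).pred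
  have k1 := h₁ (fun a => dW a.1 (dW a.2 u)) K (fun a _ => m1 _ _)
    fun a _ => (hK.2 a.2 (Set.mem_univ _)).2 a.1 (Set.mem_univ _)
  have k2 := h₂ (fun a => dW a.2 u) K (fun a _ => m2 _)
    fun a _ => TraceBoundH.pred (hK.2 a.2 (Set.mem_univ _))
  have k3 := TraceBoundH.add (MemH.sum _ fun a _ => MemH.smooth_mul (hA a.1 a.2) (m1 a.1 a.2))
    (MemH.sum _ fun a _ => MemH.smooth_mul (contDiff_pderiv (hA a.1 a.2) a.1) (m2 a.2)) k1 k2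
  have e : (fun x => (∑ a : Fin (d + 1) × Fin (d + 1),
        S.ellipticCoeffs.A a.1 a.2 x * dW a.1 (dW a.2 u) x) +
      ∑ a : Fin (d + 1) × Fin (d + 1), pderiv a.1 (S.ellipticCoeffs.A a.1 a.2) x * dW a.2 u x) =
      divOp S.ellipticCoeffs.A u := by
    funext x
    exact Finset.sum_add_distrib.symm
  rw [e] at k3
  have k4 := (h₃ _ _ (memH_divOp S.ellipticCoeffs hu) k3).congr
    (laplace_ae_eq S (hu.mono (by norm_num))).symm
  convert k4 using 1
  ring

end Geometry

/-! ### Norms with respect to the metric -/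

section Norms

variable {d : ℕ} {g : MetricCoeff (d + 1)}

theorem eLpNorm_riemVol_le {V : Set (EuclideanSpace ℝ (Fin (d + 1)))} (hV : MeasurableSet V)
    {R : ℝ} (hR0 : 0 ≤ R) (hR : ∀ x ∈ V, √(g x).det ≤ R) (f : EuclideanSpace ℝ (Fin (d + 1)) → ℝ) :
    eLpNorm f 2 (riemVol g V) ≤
      ENNReal.ofReal (√R) * eLpNorm f 2 (volume.restrict V) := by
  have h1 : riemVol g V ≤ ENNReal.ofReal R • volume.restrict V := by
    rw [← withDensity_const]
    refine withDensity_mono ?_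
    filter_upwards [ae_restrict_mem hV] with x hx
    exact ENNReal.ofReal_le_ofReal (hR x hx)
  refine (eLpNorm_mono_measure f h1).trans ((eLpNorm_smul_measure_of_ne_top
    ENNReal.ofNat_ne_top f _).trans_le (le_of_eq ?_))
  rw [Real.sqrt_eq_rpow, ← ENNReal.ofReal_rpow_of_nonneg hR0 (by norm_num)]
  simp

theorem eLpNorm_le_riemVol {V : Set (EuclideanSpace ℝ (Fin (d + 1)))} (hV : MeasurableSet V)
    {r : ℝ} (hr0 : 0 ≤ r) (hr : ∀ x ∈ V, r ≤ √(g x).det) (f : EuclideanSpace ℝ (Fin (d + 1)) → ℝ) :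
    ENNReal.ofReal (√r) * eLpNorm f 2 (volume.restrict V) ≤
      eLpNorm f 2 (riemVol g V) := by
  have h1 : ENNReal.ofReal r • volume.restrict V ≤ riemVol g V := by
    rw [← withDensity_const]
    refine withDensity_mono ?_
    filter_upwards [ae_restrict_mem hV] with x hx
    exact ENNReal.ofReal_le_ofReal (hr x hx)
  refine le_trans (le_of_eq ?_) (eLpNorm_mono_measure f h1)
  rw [eLpNorm_smul_measure_of_ne_top ENNReal.ofNat_ne_top, Real.sqrt_eq_rpow,
    ← ENNReal.ofReal_rpow_of_nonneg hr0 (by norm_num)]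
  simp

/-- A pointwise bound on the half ball of radius `r` gives a bound of the norms. -/
theorem eLpNorm_le_of_abs_le_sum {ι : Type*} [Fintype ι] {r T P : ℝ} (hr : r ≤ 3) (hT : 0 ≤ T)
    {F : EuclideanSpace ℝ (Fin (d + 1)) → ℝ} {p : ι → EuclideanSpace ℝ (Fin (d + 1)) → ℝ}
    (hF : ∀ x ∈ halfBall d r, |F x| ≤ T * ∑ i, |p i x|)
    (hp : ∀ i, MemLp (p i) 2 (hbMeasure d)) (hP : ∀ i, nrm (p i) ≤ P) :
    eLpNorm F 2 (volume.restrict (halfBall d r)) ≤ ENNReal.ofReal (T * (Fintype.card ι * P)) := by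
  have h1 : eLpNorm F 2 (volume.restrict (halfBall d r)) ≤
      ENNReal.ofReal T * eLpNorm (fun x => ∑ i, |p i x|) 2 (volume.restrict (halfBall d r)) := by
    refine eLpNorm_le_mul_eLpNorm_of_ae_le_mul (ae_of_forall_halfBall fun x hx => ?_) 2
    rw [Real.norm_eq_abs, Real.norm_eq_abs,
      abs_of_nonneg (Finset.sum_nonneg fun i _ => abs_nonneg (p i x))]
    exact hF x hx
  have h2 : eLpNorm (fun x => ∑ i, |p i x|) 2 (volume.restrict (halfBall d r)) ≤
      eLpNorm (fun x => ∑ i, |p i x|) 2 (hbMeasure d) :=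
    eLpNorm_mono_measure _ (Measure.restrict_mono (halfBall_subset hr) le_rfl)
  have h3 : eLpNorm (fun x => ∑ i, |p i x|) 2 (hbMeasure d) ≤
      ∑ i, eLpNorm (fun x => |p i x|) 2 (hbMeasure d) := by
    have := eLpNorm_sum_le (s := (Finset.univ : Finset ι)) (f := fun i x => |p i x|) (p := 2)
      (μ := hbMeasure d) (fun i _ => (hp i).1.norm) (by norm_num)
    convert this using 2
    funext x
    simp
  have h4 : ∑ i, eLpNorm (fun x => |p i x|) 2 (hbMeasure d) ≤
      ENNReal.ofReal (Fintype.card ι * P) := by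
    have h5 : ∀ i ∈ (Finset.univ : Finset ι), eLpNorm (fun x => |p i x|) 2 (hbMeasure d) ≤
        ENNReal.ofReal P := fun i _ => by
      have : eLpNorm (fun x => |p i x|) 2 (hbMeasure d) = eLpNorm (p i) 2 (hbMeasure d) :=
        eLpNorm_norm (p i)
      rw [this, ← ENNReal.ofReal_toReal (hp i).2.ne]
      exact ENNReal.ofReal_le_ofReal (hP i)
    refine (Finset.sum_le_card_nsmul _ _ _ h5).trans (le_of_eq ?_)
    rw [ENNReal.ofReal_mul (Nat.cast_nonneg _), ENNReal.ofReal_natCast, nsmul_eq_mul,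
      Finset.card_univ]
  rw [ENNReal.ofReal_mul hT]
  exact h1.trans (mul_le_mul_right (h2.trans (h3.trans h4)) _)

theorem abs_sum_mul_le {ι κ : Type*} [Fintype ι] [Fintype κ] {b : ι → κ → ℝ} {p : ι → ℝ}
    {q : κ → ℝ} {T : ℝ} (hb : ∀ i j, |b i j| ≤ T) :
    ∑ i, ∑ j, b i j * p i * q j ≤ T * ((∑ i, |p i|) * ∑ j, |q j|) := by
  rw [Finset.sum_mul_sum, Finset.mul_sum]
  refine Finset.sum_le_sum fun i _ => ?_
  rw [Finset.mul_sum]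
  refine Finset.sum_le_sum fun j _ => (le_abs_self _).trans ?_
  rw [abs_mul, abs_mul, mul_assoc]
  exact mul_le_mul_of_nonneg_right (hb i j) (mul_nonneg (abs_nonneg _) (abs_nonneg _))

theorem exists_gradNorm_le (S : SmoothModel g) : ∃ T, 0 ≤ T ∧
    ∀ (f : EuclideanSpace ℝ (Fin (d + 1)) → ℝ),
    ∀ x ∈ halfBall d 3, |gradNorm g (halfBall d 3) f x| ≤ T * ∑ i, |dW i f x| := by
  choose s hs0 hs using fun i j => exists_bound_halfBall (S.smooth_ginv i j).continuous
  refine ⟨√(∑ i, ∑ j, s i j), Real.sqrt_nonneg _, fun f x hx => ?_⟩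
  have hs' : 0 ≤ ∑ i, ∑ j, s i j :=
    Finset.sum_nonneg fun i _ => Finset.sum_nonneg fun j _ => hs0 i j
  have hP : 0 ≤ ∑ i, |dW i f x| := Finset.sum_nonneg fun i _ => abs_nonneg _
  unfold gradNorm
  rw [abs_of_nonneg (Real.sqrt_nonneg _)]
  refine Real.sqrt_le_iff.2 ⟨by positivity, ?_⟩
  rw [mul_pow, Real.sq_sqrt hs', sq]
  refine abs_sum_mul_le fun i j => ?_
  rw [← S.ginv_eq x hx]
  refine (hs i j x hx).trans ((Finset.single_le_sum (f := fun j => s i j)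
    (fun j _ => hs0 i j) (Finset.mem_univ j)).trans ?_)
  exact Finset.single_le_sum (f := fun i => ∑ j, s i j)
    (fun i _ => Finset.sum_nonneg fun j _ => hs0 i j) (Finset.mem_univ i)

theorem exists_hessNorm_le (S : SmoothModel g) : ∃ T, 0 ≤ T ∧
    ∀ (f : EuclideanSpace ℝ (Fin (d + 1)) → ℝ),
    ∀ x ∈ halfBall d 3, |hessNorm g (halfBall d 3) f x| ≤
      T * ((∑ a : Fin (d + 1) × Fin (d + 1), |dW a.1 (dW a.2 f) x|) + ∑ i, |dW i f x|) := by
  choose s hs0 hs using fun i j => exists_bound_halfBall (S.smooth_ginv i j).continuous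
  choose c hc0 hc using fun k i j => exists_bound_halfBall (S.smooth_chr k i j).continuous
  obtain ⟨s', hs'⟩ : ∃ s', s' = ∑ i, ∑ j, s i j := ⟨_, rfl⟩
  obtain ⟨c', hc'⟩ : ∃ c', c' = ∑ a : Fin (d + 1) × Fin (d + 1), ∑ k, c k a.1 a.2 := ⟨_, rfl⟩
  have hs'0 : 0 ≤ s' := hs' ▸ Finset.sum_nonneg fun i _ => Finset.sum_nonneg fun j _ => hs0 i j
  have hc'0 : 0 ≤ c' := hc' ▸ Finset.sum_nonneg fun a _ => Finset.sum_nonneg fun k _ => hc0 k _ _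
  have hsle : ∀ x ∈ halfBall d 3, ∀ i j, |(g x)⁻¹ i j| ≤ s' := by
    intro x hx i j
    rw [← S.ginv_eq x hx, hs']
    refine (hs i j x hx).trans ((Finset.single_le_sum (f := fun j => s i j)
      (fun j _ => hs0 i j) (Finset.mem_univ j)).trans ?_)
    exact Finset.single_le_sum (f := fun i => ∑ j, s i j)
      (fun i _ => Finset.sum_nonneg fun j _ => hs0 i j) (Finset.mem_univ i)
  refine ⟨s' * (1 + c'), by positivity, fun f x hx => ?_⟩
  obtain ⟨h, hh⟩ : ∃ h : Fin (d + 1) × Fin (d + 1) → ℝ,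
      h = fun a => hess g (halfBall d 3) f a.1 a.2 x := ⟨_, rfl⟩
  have hG : 0 ≤ ∑ i, |dW i f x| := Finset.sum_nonneg fun i _ => abs_nonneg _
  have hH : 0 ≤ ∑ a : Fin (d + 1) × Fin (d + 1), |dW a.1 (dW a.2 f) x| :=
    Finset.sum_nonneg fun i _ => abs_nonneg _
  have h1 : |hessNorm g (halfBall d 3) f x| ≤ s' * ∑ a, |h a| := by
    have hP : 0 ≤ ∑ a, |h a| := Finset.sum_nonneg fun i _ => abs_nonneg _
    unfold hessNorm
    rw [abs_of_nonneg (Real.sqrt_nonneg _)]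
    refine Real.sqrt_le_iff.2 ⟨by positivity, ?_⟩
    have e : ∑ i, ∑ j, ∑ k, ∑ l, (g x)⁻¹ i k * (g x)⁻¹ j l * hess g (halfBall d 3) f i j x *
        hess g (halfBall d 3) f k l x =
        ∑ a, ∑ b, (g x)⁻¹ a.1 b.1 * (g x)⁻¹ a.2 b.2 * h a * h b := by
      simp only [Fintype.sum_prod_type, hh]
    rw [e, mul_pow, sq (∑ a, |h a|)]
    refine abs_sum_mul_le fun a b => ?_
    rw [abs_mul, sq]
    exact mul_le_mul (hsle x hx _ _) (hsle x hx _ _) (abs_nonneg _) hs'0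
  have h2 : ∑ a, |h a| ≤ (∑ a : Fin (d + 1) × Fin (d + 1), |dW a.1 (dW a.2 f) x|) +
      c' * ∑ i, |dW i f x| := by
    rw [hc', Finset.sum_mul, ← Finset.sum_add_distrib]
    refine Finset.sum_le_sum fun a _ => ?_
    rw [hh]
    refine (abs_sub _ _).trans (add_le_add le_rfl ?_)
    refine (Finset.abs_sum_le_sum_abs _ _).trans ?_
    rw [Finset.sum_mul]
    refine Finset.sum_le_sum fun k _ => ?_
    rw [abs_mul, ← S.chr_eq x hx]
    exact mul_le_mul (hc k _ _ x hx) (Finset.single_le_sum (f := fun i => |dW i f x|)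
      (fun _ _ => abs_nonneg _) (Finset.mem_univ k)) (abs_nonneg _) (hc0 _ _ _)
  have h3 := mul_le_mul_of_nonneg_left h2 hs'0
  have h4 : 0 ≤ s' * (c' * ∑ a : Fin (d + 1) × Fin (d + 1), |dW a.1 (dW a.2 f) x|) := by positivity
  have h5 : 0 ≤ s' * ∑ i, |dW i f x| := by positivity
  linarith

end Norms

/-! ### The inequality -/

theorem eLpNorm_cutoff_mul_le {d : ℕ} {χ : EuclideanSpace ℝ (Fin (d + 1)) → ℝ} {r : ℝ} (hr : r ≤ 3)
    (hχs : tsupport χ ⊆ Metric.ball 0 r) (hχ1 : ∀ x, |χ x| ≤ 1)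
    (u : EuclideanSpace ℝ (Fin (d + 1)) → ℝ) :
    eLpNorm (fun x => χ x * u x) 2 (hbMeasure d) ≤
      eLpNorm u 2 (volume.restrict (halfBall d r)) := by
  have e : (fun x => χ x * u x) = (Metric.ball 0 r).indicator fun x => χ x * u x := by
    refine (Set.indicator_eq_self.2 fun x hx => hχs (subset_tsupport _ fun h => hx ?_)).symm
    simp only [h, zero_mul]
  have hm : (hbMeasure d).restrict (Metric.ball 0 r) = volume.restrict (halfBall d r) := by
    rw [Measure.restrict_restrict measurableSet_ball]
    congr 1
    ext x
    simp only [Set.mem_inter_iff, mem_ball_zero_iff, halfBall, Set.mem_ofPred_eq]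
    exact ⟨fun h => ⟨h.1, h.2.2⟩, fun h => ⟨h.1, h.1.trans_le hr, h.2⟩⟩
  rw [e, eLpNorm_indicator_eq_eLpNorm_restrict measurableSet_ball, hm]
  refine eLpNorm_mono fun x => ?_
  rw [norm_mul]
  exact mul_le_of_le_one_left (norm_nonneg _) (hχ1 x)

end BiLaplace

open BiLaplace in
theorem mainTheorem7 (d : ℕ) (hd : 1 ≤ d) (g : BiLaplace.MetricCoeff (d + 1))
    (hg : BiLaplace.IsSmoothMetricNear (closure (BiLaplace.halfBall d 3)) g) :
    ∃ C : ℝ, 0 < C ∧ ∀ (M : ℝ) (W u : EuclideanSpace ℝ (Fin (d + 1)) → ℝ), 1 ≤ M →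
      AEStronglyMeasurable W (volume.restrict (BiLaplace.halfBall d 3)) →
      (∀ᵐ x ∂volume.restrict (BiLaplace.halfBall d 3), |W x| ≤ M) →
      BiLaplace.MemHUpToFlat d 3 4 u →
      (∀ᵐ x ∂volume.restrict (BiLaplace.halfBall d 3),
        BiLaplace.laplace g (BiLaplace.halfBall d 3)
          (BiLaplace.laplace g (BiLaplace.halfBall d 3) u) x = W x * u x) →
      eLpNorm (BiLaplace.gradNorm g (BiLaplace.halfBall d 3)
            (BiLaplace.laplace g (BiLaplace.halfBall d 3) u)) 2
            (BiLaplace.riemVol g (BiLaplace.halfBall d (1 / 2))) +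
          eLpNorm (BiLaplace.hessNorm g (BiLaplace.halfBall d 3) u) 2
            (BiLaplace.riemVol g (BiLaplace.halfBall d (1 / 2))) +
          eLpNorm (BiLaplace.gradNorm g (BiLaplace.halfBall d 3) u) 2
            (BiLaplace.riemVol g (BiLaplace.halfBall d (1 / 2))) ≤
        ENNReal.ofReal C *
          (ENNReal.ofReal M * eLpNorm u 2 (BiLaplace.riemVol g (BiLaplace.halfBall d 2)) +
            ∑ j ∈ Finset.range 4, BiLaplace.bdrySobolevNorm d 2 3 (3 - j)
              ((BiLaplace.normalDeriv g (BiLaplace.halfBall d 3))^[j] u)) := by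
  obtain ⟨S⟩ := exists_smoothModel hg
  obtain ⟨η, hη, hηs, hη1, -⟩ := exists_contDiff_cutoff
    (Metric.isClosed_closedBall (x := (0 : EuclideanSpace ℝ (Fin (d + 1)))) (ε := 1 / 2))
    (Metric.isOpen_ball (x := 0) (ε := 1)) (Metric.closedBall_subset_ball (by norm_num))
  obtain ⟨χ, hχ, hχs, hχ1, hχle⟩ := exists_contDiff_cutoff
    (Metric.isClosed_closedBall (x := (0 : EuclideanSpace ℝ (Fin (d + 1)))) (ε := 1))
    (Metric.isOpen_ball (x := 0) (ε := 2)) (Metric.closedBall_subset_ball (by norm_num))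
  have hηs2 : tsupport η ⊆ Metric.ball 0 2 :=
    hηs.trans (Metric.ball_subset_ball (by norm_num))
  obtain ⟨Ca, hCa, ha⟩ := exists_caccioppoli S.ellipticCoeffs hη hηs2 hχ hχs
    fun x hx => hχ1 x (Metric.ball_subset_closedBall (hηs hx))
  obtain ⟨Ct, hCt, ht⟩ := exists_traceBoundH_three S
  obtain ⟨Cl, hCl, hl⟩ := exists_traceBoundH_laplace S
  obtain ⟨T₁, hT₁, h₁⟩ := exists_gradNorm_le S
  obtain ⟨T₂, hT₂, h₂⟩ := exists_hessNorm_le S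
  obtain ⟨R, hR0, hR⟩ := exists_bound_halfBall S.smooth_rho.continuous
  have hlam := S.lam_pos
  obtain ⟨n₁, hn₁⟩ : ∃ n : ℝ, n = Fintype.card (Fin (d + 1)) := ⟨_, rfl⟩
  obtain ⟨n₂, hn₂⟩ : ∃ n : ℝ, n = Fintype.card ((Fin (d + 1) × Fin (d + 1)) ⊕ Fin (d + 1)) :=
    ⟨_, rfl⟩
  have hn₁0 : 0 ≤ n₁ := hn₁ ▸ Nat.cast_nonneg _
  have hn₂0 : 0 ≤ n₂ := hn₂ ▸ Nat.cast_nonneg _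
  obtain ⟨c, hc⟩ : ∃ c, c = (√S.lam)⁻¹ := ⟨_, rfl⟩
  have hc0 : 0 ≤ c := hc ▸ inv_nonneg.2 (Real.sqrt_nonneg _)
  obtain ⟨B, hB⟩ : ∃ B, B = Ca * (c + (1 + Cl) * Ct) := ⟨_, rfl⟩
  have hB0 : 0 ≤ B := by rw [hB]; positivity
  obtain ⟨Q, hQ⟩ : ∃ Q, Q = √R * (T₁ * n₁ + T₂ * n₂ + T₁ * n₁) := ⟨_, rfl⟩
  have hQ0 : 0 ≤ Q := by rw [hQ]; positivity
  have hC : 0 < Q * B + 1 := by positivity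
  refine ⟨Q * B + 1, hC, fun M W u hM hWm hWb hu hq => ?_⟩
  obtain ⟨b, hb⟩ : ∃ b, b = ∑ j ∈ Finset.range 4, bdrySobolevNorm d 2 3 (3 - j)
    ((normalDeriv g (halfBall d 3))^[j] u) := ⟨_, rfl⟩
  rw [← hb]
  rcases eq_or_ne b ⊤ with hbt | hbt
  · rw [hbt, add_top, ENNReal.mul_top (ENNReal.ofReal_pos.2 hC).ne']
    exact le_top
  obtain ⟨v, hv⟩ : ∃ v, v = laplace g (halfBall d 3) u := ⟨_, rfl⟩
  rw [← hv] at hq ⊢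
  have huH : MemH 4 u := hu
  have hvH : MemH 2 v := hv ▸ memH_laplace S huH
  obtain ⟨K, hK⟩ : ∃ K, K = b.toReal := ⟨_, rfl⟩
  have hK0 : 0 ≤ K := hK ▸ ENNReal.toReal_nonneg
  have hKb : b = ENNReal.ofReal K := by rw [hK, ENNReal.ofReal_toReal hbt]
  have hKu := ht u K hK0 huH fun j hj => by
    rw [← hKb, hb]
    exact Finset.single_le_sum (f := fun j => bdrySobolevNorm d 2 3 (3 - j)
      ((normalDeriv g (halfBall d 3))^[j] u)) (fun _ _ => zero_le) hj
  have hKv : TraceBoundH Set.univ 1 v (Cl * (Ct * K)) := hv ▸ hl u _ huH hKu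
  have hCtK : 0 ≤ Ct * K := by positivity
  have hClK : 0 ≤ Cl * (Ct * K) := by positivity
  -- both trace bounds with the same constant
  obtain ⟨e1, e2, e3⟩ := ha u v W M ((1 + Cl) * (Ct * K)) hM hWm hWb huH hvH
    (divOp_ae_eq_of_laplace S (huH.mono (by norm_num)) (by rw [hv]))
    (divOp_ae_eq_of_laplace S hvH hq) (hKu.mono (by linarith)) (hKv.mono (by linarith))
  obtain ⟨P, hP⟩ : ∃ P, P = Ca * (M * nrm (fun x => χ x * u x) + (1 + Cl) * (Ct * K)) := ⟨_, rfl⟩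
  rw [← hP] at e1 e2 e3
  have hP0 : 0 ≤ P := nrm_nonneg.trans (e2 0)
  -- the norm of `u` with respect to the metric
  have hu2 : MemLp u 2 (volume.restrict (halfBall d 2)) := huH.memLp (by norm_num)
  have hUt : eLpNorm u 2 (riemVol g (halfBall d 2)) ≠ ⊤ := by
    refine ne_top_of_le_ne_top (ENNReal.mul_ne_top ENNReal.ofReal_ne_top hu2.2.ne)
      (eLpNorm_riemVol_le (measurableSet_halfBall 2) hR0 (fun x hx => ?_) u)
    have hx3 := halfBall_subset (by norm_num : (2 : ℝ) ≤ 3) hx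
    rw [← S.rho_eq x hx3]
    exact (le_abs_self _).trans (hR x hx3)
  obtain ⟨U, hU⟩ : ∃ U, U = (eLpNorm u 2 (riemVol g (halfBall d 2))).toReal := ⟨_, rfl⟩
  have hU0 : 0 ≤ U := hU ▸ ENNReal.toReal_nonneg
  have hXU : nrm (fun x => χ x * u x) ≤ c * U := by
    have h3 := eLpNorm_le_riemVol (g := g) (measurableSet_halfBall 2) hlam.le (fun x hx => by
      have hx3 := halfBall_subset (by norm_num : (2 : ℝ) ≤ 3) hx
      rw [← S.rho_eq x hx3]
      exact S.le_rho x hx3) u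
    have h4 := ENNReal.toReal_mono hUt h3
    rw [ENNReal.toReal_mul, ENNReal.toReal_ofReal (Real.sqrt_nonneg _), ← hU] at h4
    have h5 := ENNReal.toReal_mono hu2.2.ne
      (eLpNorm_cutoff_mul_le (by norm_num) hχs hχle u)
    refine h5.trans ?_
    rw [hc, inv_mul_eq_div, le_div_iff₀ (Real.sqrt_pos.2 hlam), mul_comm]
    exact h4
  have hPle : P ≤ B * (M * U + K) := by
    have h3 : M * nrm (fun x => χ x * u x) ≤ M * (c * U) :=
      mul_le_mul_of_nonneg_left hXU (by linarith)
    have h4 : P ≤ Ca * (M * (c * U) + (1 + Cl) * (Ct * K)) := by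
      rw [hP]; exact mul_le_mul_of_nonneg_left (by linarith) hCa
    have h5 : 0 ≤ Ca * (c * K + (1 + Cl) * Ct * (M * U)) := by positivity
    rw [hB]
    linarith
  -- the three terms on the small half ball, where the cutoff is equal to one
  have hη3 := tsupport_subset_three hηs2
  have hη1' : ∀ x ∈ halfBall d (1 / 2), η x = 1 := fun x hx =>
    hη1 x (mem_closedBall_zero_iff.2 hx.1.le)
  have hsub : ∀ {x}, x ∈ halfBall d (1 / 2) → x ∈ halfBall d 3 := fun hx =>
    halfBall_subset (by norm_num) hx
  have hmeas : ∀ F : EuclideanSpace ℝ (Fin (d + 1)) → ℝ,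
      eLpNorm F 2 (riemVol g (halfBall d (1 / 2))) ≤
        ENNReal.ofReal (√R) * eLpNorm F 2 (volume.restrict (halfBall d (1 / 2))) := fun F =>
    eLpNorm_riemVol_le (measurableSet_halfBall _) hR0 (fun x hx => by
      rw [← S.rho_eq x (hsub hx)]
      exact (le_abs_self _).trans (hR x (hsub hx))) F
  have t1 := eLpNorm_le_of_abs_le_sum (F := gradNorm g (halfBall d 3) v)
    (p := fun j x => η x ^ 3 * dW j v x) (by norm_num : (1 / 2 : ℝ) ≤ 3) hT₁
    (fun x hx => by simpa only [hη1' x hx, one_pow, one_mul] using h₁ v x (hsub hx))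
    (fun j => (hvH.deriv j).memLp_cutoff_mul (hη.pow 3).continuous
      (tsupport_pow_subset hη3 (by norm_num))) e1
  have t3 := eLpNorm_le_of_abs_le_sum (F := gradNorm g (halfBall d 3) u)
    (p := fun j x => η x * dW j u x) (by norm_num : (1 / 2 : ℝ) ≤ 3) hT₁
    (fun x hx => by simpa only [hη1' x hx, one_mul] using h₁ u x (hsub hx))
    (fun j => (huH.deriv j).memLp_cutoff_mul hη.continuous hη3) e2
  have t2 := eLpNorm_le_of_abs_le_sum (F := hessNorm g (halfBall d 3) u)
    (p := Sum.elim (fun (a : Fin (d + 1) × Fin (d + 1)) x => η x ^ 2 * dW a.1 (dW a.2 u) x)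
      fun j x => η x * dW j u x) (by norm_num : (1 / 2 : ℝ) ≤ 3) hT₂
    (fun x hx => by
      simpa only [Fintype.sum_sum_type, Sum.elim_inl, Sum.elim_inr, hη1' x hx, one_pow, one_mul]
        using h₂ u x (hsub hx))
    (fun a => by
      rcases a with a | j
      · exact ((huH.deriv a.2).deriv a.1).memLp_cutoff_mul (hη.pow 2).continuous
          (tsupport_pow_subset hη3 two_ne_zero)
      · exact (huH.deriv j).memLp_cutoff_mul hη.continuous hη3)
    (fun a => by
      rcases a with a | j
      · exact e3 a.1 a.2
      · exact e2 j)
  rw [← hn₁] at t1 t3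
  rw [← hn₂] at t2
  have hsum := add_le_add (add_le_add ((hmeas _).trans (mul_le_mul_right t1 _))
    ((hmeas _).trans (mul_le_mul_right t2 _))) ((hmeas _).trans (mul_le_mul_right t3 _))
  refine hsum.trans ?_
  rw [← mul_add, ← mul_add, ← ENNReal.ofReal_add (by positivity) (by positivity),
    ← ENNReal.ofReal_add (by positivity) (by positivity),
    ← ENNReal.ofReal_mul (Real.sqrt_nonneg _), hKb, ← ENNReal.ofReal_toReal hUt, ← hU,
    ← ENNReal.ofReal_mul (by linarith), ← ENNReal.ofReal_add (by positivity) hK0,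
    ← ENNReal.ofReal_mul hC.le]
  refine ENNReal.ofReal_le_ofReal ?_
  have hMU : 0 ≤ M * U + K := by positivity
  calc √R * (T₁ * (n₁ * P) + T₂ * (n₂ * P) + T₁ * (n₁ * P)) = Q * P := by rw [hQ]; ring
    _ ≤ Q * (B * (M * U + K)) := mul_le_mul_of_nonneg_left hPle hQ0
    _ ≤ (Q * B + 1) * (M * U + K) := by linarith
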